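/- Notation. For $a,b\in\mathbb Q^\times$ let $$S_{a,b}=\{2x_1 : x_1,x_2,x_3,x_4\in\mathbb Q,\ x_1^2-ax_2^2-bx_3^2+abx_4^2=1\},\qquad T_{a,b}=S_{a,b}+S_{a,b},$$ where sums of sets are sumsets $A+B=\{x+y: x\in A,\ y\in B\}$. For $p,q\in\mathbb Q^\times$ let $$R_p^{[3]}=T_{-p,-p}+T_{2p,-p},\quad R_p^{[5]}=T_{-2p,-p}+T_{2p,-p},\quad R_p^{[7]}=T_{-p,-p}+T_{2p,p},\quad R_{p,q}^{[1]}=T_{2pq,q}+T_{-2pq,q}.$$ For a prime $l$ let $v_l$ be the $l$-adic valuation on $\mathbb Q$ and $\mathbb Z_{(l)}\subseteq\mathbb Q$ the ring of rationals $m/n$ with $m,n\in\mathbb Z$, $l\nmid n$. An intersection of rings $\mathbb Z_{(l)}$ over the empty set of primes is $\mathbb Q$. For $a\in\mathbb Q^\times$ let $\left(\!\left(\frac{a}{l}\right)\!\right)$ be $1$ if the $l$-adic unit $a\,l^{-v_l(a)}$ is a square modulo $l$, and $-1$ otherwise. For $p\in\mathbb Q^\times$ let $\mathbb P(p)$ be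 the set of primes $l$ with $v_l(p)$ odd, and $\mathbb P^{[k]}(p)=\{l\in\mathbb P(p): l\equiv k \bmod 8\}$. Write $p\equiv_2 k \bmod 8$ if $p\in k+8\mathbb Z_{(2)}$. Proposition. (a) $\mathbb Z_{(2)}=T_{3,3}+T_{2,5}$. (b) Let $k\in\{3,5,7\}$ and $p\in\mathbb Q^\times$. If $p\equiv_2 k\bmod 8$, then $R_p^{[k]}=\bigcap_{l\in\mathbb P^{[k]}(p)}\mathbb Z_{(l)}$. Otherwise $R_p^{[k]}$ is $\bigcap_{l\in\mathbb P^{[k]}(p)}\mathbb Z_{(l)}$ or $\bigcap_{l\in\mathbb P^{[k]}(p)\cup\{2\}}\mathbb Z_{(l)}$. In particular, if $p$ is a prime with $p\equiv k\bmod 8$, then $\mathbb Z_{(p)}=R_p^{[k]}$. (c) Let $p,q\in\mathbb Q^\times$ with $p\equiv_2 1\bmod 8$ and $q\equiv_2 3\bmod 8$. Then $R_{p,q}^{[1]}=\bigcap_{l\in\mathbb P(p,q)}\mathbb Z_{(l)}$ (which is $\mathbb Q$ if $\mathbb P(p,q)=\emptyset$), where $\mathbb P(p,q)$ is the set of primes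 $l$ satisfying one of the following: - $l\in\mathbb P(p)\setminus\mathbb P(q)$ and $\left(\!\left(\frac{q}{l}\right)\!\right)=-1$; - $l\in\mathbb P(q)\setminus\mathbb P(p)$ and $\left(\!\left(\frac{2p}{l}\right)\!\right)=\left(\!\left(\frac{-2p}{l}\right)\!\right)=-1$; - $l\in\mathbb P(p)\cap\mathbb P(q)$ and $\left(\!\left(\frac{2pq}{l}\right)\!\right)=\left(\!\left(\frac{-2pq}{l}\right)\!\right)=-1$. In particular, if $p$ is a prime with $p\equiv 1\bmod 8$ and $q$ is a prime with $q\equiv 3\bmod 8$ whose Legendre symbol $\left(\frac pq\right)$ is $-1$, then $\mathbb Z_{(p)}=R_{p,q}^{[1]}$. -/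

import Mathlib

namespace LocalRings

open scoped Pointwise

/-- The traces `2 x₁` of the norm-one elements of the quaternion algebra over `ℚ` with
`α² = a`, `β² = b`, `αβ = -βα`. -/
def S (a b : ℚ) : Set ℚ :=
  {s | ∃ x₁ x₂ x₃ x₄ : ℚ,
    x₁ ^ 2 - a * x₂ ^ 2 - b * x₃ ^ 2 + a * b * x₄ ^ 2 = 1 ∧ s = 2 * x₁}

/-- `T a b = S a b + S a b` (sumset). -/
def T (a b : ℚ) : Set ℚ := S a b + S a b

/-- The ring `ℤ_(l)` of rationals that can be written with denominator prime to the prime `l`. -/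
def Zloc (l : ℕ) : Set ℚ :=
  {x | ∃ m n : ℤ, ¬ (l : ℤ) ∣ n ∧ x = (m : ℚ) / (n : ℚ)}

def R3 (p : ℚ) : Set ℚ := T (-p) (-p) + T (2 * p) (-p)

def R5 (p : ℚ) : Set ℚ := T (-2 * p) (-p) + T (2 * p) (-p)

def R7 (p : ℚ) : Set ℚ := T (-p) (-p) + T (2 * p) p

def R1 (p q : ℚ) : Set ℚ := T (2 * p * q) q + T (-2 * p * q) q

/-- The primes `l` at which `p` has odd valuation. -/
def oddPrimes (p : ℚ) : Set ℕ := {l | l.Prime ∧ Odd (padicValRat l p)}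

/-- The primes `l ≡ k mod 8` at which `p` has odd valuation. -/
def oddPrimesMod (k : ℕ) (p : ℚ) : Set ℕ := {l | l ∈ oddPrimes p ∧ l ≡ k [MOD 8]}

/-- `p ≡₂ k mod 8`, that is, `p ∈ k + 8 ℤ_(2)`. -/
def ModEqTwo (k : ℕ) (p : ℚ) : Prop := ∃ z ∈ Zloc 2, p = (k : ℚ) + 8 * z

open Classical in
/-- The generalized Legendre symbol of a nonzero rational `a` at a prime `l`: it is `1` if the
`l`-adic unit `a * l ^ (-v_l(a))` is a square modulo `l`, and `-1` otherwise. -/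
noncomputable def genLegendre (a : ℚ) (l : ℕ) : ℤ :=
  if ∃ y : ℤ, ∃ z ∈ Zloc l,
      a * (l : ℚ) ^ (-padicValRat l a) = (y : ℚ) ^ 2 + (l : ℚ) * z then 1 else -1

/-- The set `ℙ(p, q)` of primes. -/
def primesPQ (p q : ℚ) : Set ℕ :=
  {l | (l ∈ oddPrimes p \ oddPrimes q ∧ genLegendre q l = -1) ∨
    (l ∈ oddPrimes q \ oddPrimes p ∧
      genLegendre (2 * p) l = -1 ∧ genLegendre (-2 * p) l = -1) ∨
    (l ∈ oddPrimes p ∩ oddPrimes q ∧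
      genLegendre (2 * p * q) l = -1 ∧ genLegendre (-2 * p * q) l = -1)}

end LocalRings

open scoped Pointwise

namespace LocalRings

/-! The set `S a b` consists of the reduced traces of norm-one elements of the quaternion algebra
`(a,b)`. A rational `s` is such a trace when `(s²-4)/4` is the square of a pure quaternion, that is,
when `s²-4` is represented by the ternary form `ax²+by²-abz²`. By the Hasse principle this is a
local question: nothing is required at split places, and at a ramified place `s²-4` must not be a
nonzero square.

Upper bound. At a ramified prime the norm form is anisotropic, so norm-one elements have integral
trace and `T a b ⊆ Zloc l` (`Admissible.S_subset_Zloc`).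

Lower bound. Let `t` be integral at all ramified primes, with `|t| ≤ 1` if the algebra is ramified
at infinity. A count of points on a conic over `𝔽_l` shows that `t` is locally a sum of two
admissible traces; the Chinese remainder theorem glues the local choices, and the Hasse principle
makes them global (`Admissible.mem_T`).

Sum of two algebras. Splitting the denominator of `x` by partial fractions between the two algebras
shows that `T + T'` is the intersection of the `Zloc l` over the primes ramified in both, provided
they are not both ramified at infinity (`T_add_T_eq`). The proposition then reduces to computing
ramification after normalising the algebras up to isomorphism.

The Hasse principle is proved here for the forms `ABx²+ACy²-BCz²` and the discriminants needed.
Following Hasse's argument, one finds an auxiliary `w = eq`, with `q` a prime from Dirichlet's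
theorem, such that `Ax²-By²=wz²` and `ABx²+Cwy²=dz²` are both solvable by Legendre's theorem. The
prime `q` is prescribed modulo the bad primes; that `d` is also a square modulo `q` is exactly the
product formula, obtained from quadratic reciprocity (`Admissible.reciprocity`). -/

/-! ### Legendre's theorem on ternary quadratic forms -/

theorem exists_sq_modEq_of_squarefree (a : ℤ) (n : ℕ) (hn : Squarefree n)
    (h : ∀ l : ℕ, l.Prime → l ∣ n → IsSquare ((a : ℤ) : ZMod l)) :
    ∃ t : ℤ, (n : ℤ) ∣ t ^ 2 - a := by
  induction n using induction_on_primes with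
  | zero => exact absurd hn not_squarefree_zero
  | one => exact ⟨0, by simp⟩
  | prime_mul p m hp ih =>
    obtain ⟨t, ht⟩ := ih (hn.squarefree_of_dvd (dvd_mul_left _ _))
      fun l hl hd => h l hl (hd.mul_left _)
    obtain ⟨r, hr⟩ := h p hp (dvd_mul_right _ _)
    obtain ⟨r, rfl⟩ := ZMod.intCast_surjective r
    have hr' : (p : ℤ) ∣ r ^ 2 - a := by
      rw [← ZMod.intCast_eq_intCast_iff_dvd_sub]
      push_cast
      rw [hr, sq]
    have hc : IsCoprime (p : ℤ) (m : ℤ) :=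
      Nat.isCoprime_iff_coprime.2 (Nat.coprime_of_squarefree_mul hn)
    obtain ⟨u, v, huv⟩ := hc
    refine ⟨r * (v * m) + t * (u * p), ?_⟩
    push_cast
    refine IsCoprime.mul_dvd ⟨u, v, huv⟩ ?_ ?_
    · obtain ⟨k, hk⟩ := hr'
      have hv : v * m = 1 - u * p := by linear_combination huv
      rw [hv]
      exact ⟨k + u * (r * (-2 * r + 2 * t) + p * u * (t - r) ^ 2), by linear_combination hk⟩
    · obtain ⟨k, hk⟩ := ht
      have hv : u * p = 1 - v * m := by linear_combination huv
      rw [hv]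
      exact ⟨k + v * (t * (-2 * t + 2 * r) + m * v * (r - t) ^ 2), by linear_combination hk⟩

/-- Two distinct lattice points of a box agree in a product of three finite rings. -/
theorem exists_small_ne_zero_of_card_lt {G : Type*} [AddCommGroup G] [Fintype G]
    (f : ℤ × ℤ × ℤ →+ G) (X Y Z : ℕ)
    (h : Fintype.card G < (X + 1) * ((Y + 1) * (Z + 1))) :
    ∃ x y z : ℤ, ¬ (x = 0 ∧ y = 0 ∧ z = 0) ∧ |x| ≤ X ∧ |y| ≤ Y ∧ |z| ≤ Z ∧ f (x, y, z) = 0 := by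
  classical
  let s : Finset (ℕ × ℕ × ℕ) :=
    Finset.range (X + 1) ×ˢ Finset.range (Y + 1) ×ˢ Finset.range (Z + 1)
  let g : ℕ × ℕ × ℕ → G := fun v => f ((v.1 : ℤ), (v.2.1 : ℤ), (v.2.2 : ℤ))
  have hs : (Finset.univ : Finset G).card < s.card := by
    simpa [s, Finset.card_product] using h
  obtain ⟨⟨x, y, z⟩, hx, ⟨x', y', z'⟩, hx', hne, he⟩ :=
    Finset.exists_ne_map_eq_of_card_lt_of_maps_to hs
      (f := g) (fun _ _ => Finset.mem_coe.2 (Finset.mem_univ _))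
  simp only [s, Finset.mem_product, Finset.mem_range] at hx hx'
  refine ⟨x - x', y - y', z - z', ?_, ?_, ?_, ?_, ?_⟩
  · rintro ⟨h1, h2, h3⟩
    apply hne
    simp only [Prod.mk.injEq]
    omega
  · rw [abs_le]; omega
  · rw [abs_le]; omega
  · rw [abs_le]; omega
  · have : (((x : ℤ) - x', (y : ℤ) - y', (z : ℤ) - z') : ℤ × ℤ × ℤ) =
      ((x : ℤ), (y : ℤ), (z : ℤ)) - ((x' : ℤ), (y' : ℤ), (z' : ℤ)) := rfl
    rw [this, map_sub, sub_eq_zero]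
    exact he

/-- Legendre's theorem for `a x² + b y² = c z²` with positive coefficients. -/
theorem legendre_of_pos (a b c : ℕ) (ha : 0 < a) (hb : 0 < b) (hc : 0 < c)
    (hsq : Squarefree (a * b * c))
    (h1 : ∀ l : ℕ, l.Prime → l ∣ a → IsSquare (((b : ℤ) * c : ℤ) : ZMod l))
    (h2 : ∀ l : ℕ, l.Prime → l ∣ b → IsSquare (((c : ℤ) * a : ℤ) : ZMod l))
    (h3 : ∀ l : ℕ, l.Prime → l ∣ c → IsSquare ((-((a : ℤ) * b) : ℤ) : ZMod l)) :
    ∃ x y z : ℤ, ¬ (x = 0 ∧ y = 0 ∧ z = 0) ∧ a * x ^ 2 + b * y ^ 2 = c * z ^ 2 := by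
  have hab : a.Coprime b :=
    Nat.coprime_of_squarefree_mul (hsq.squarefree_of_dvd (dvd_mul_right _ _))
  have habc : (a * b).Coprime c := Nat.coprime_of_squarefree_mul hsq
  have hac : a.Coprime c := habc.coprime_mul_right
  have hbc : b.Coprime c := habc.coprime_mul_left
  have hsab : Squarefree (a * b) := hsq.squarefree_of_dvd (dvd_mul_right _ _)
  have hsa : Squarefree a := hsab.squarefree_of_dvd (dvd_mul_right _ _)
  have hsb : Squarefree b := hsab.squarefree_of_dvd (dvd_mul_left _ _)
  have hsc : Squarefree c := hsq.squarefree_of_dvd (dvd_mul_left _ _)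
  obtain ⟨ta, hta⟩ := exists_sq_modEq_of_squarefree _ a hsa h1
  obtain ⟨tb, htb⟩ := exists_sq_modEq_of_squarefree _ b hsb h2
  obtain ⟨tc, htc⟩ := exists_sq_modEq_of_squarefree _ c hsc h3
  -- The bound `z² < ab` used below is strict because `ab` is squarefree and not `1`; the remaining
  -- case is a sum of two squares.
  by_cases hab1 : a * b = 1
  · have ha1 : a = 1 := Nat.eq_one_of_mul_eq_one_right hab1
    have hb1 : b = 1 := Nat.eq_one_of_mul_eq_one_left hab1
    subst ha1 hb1
    have hs : IsSquare (-1 : ZMod c) := by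
      refine ⟨(tc : ZMod c), ?_⟩
      have := (ZMod.intCast_eq_intCast_iff_dvd_sub _ _ _).2 htc
      push_cast at this
      rw [← sq, ← this]
    obtain ⟨x, y, hxy⟩ := Nat.eq_sq_add_sq_of_isSquare_mod_neg_one hs
    refine ⟨x, y, 1, by simp, ?_⟩
    rw [hxy]; push_cast; ring
  have : NeZero a := ⟨ha.ne'⟩
  have : NeZero b := ⟨hb.ne'⟩
  have : NeZero c := ⟨hc.ne'⟩
  -- On the kernel the form vanishes modulo `abc`. Modulo `a`, for instance, `b` times the form is
  -- `(by)²-bcz² ≡ (by-ta·z)(by+ta·z)`.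
  let f : ℤ × ℤ × ℤ →+ ZMod a × ZMod b × ZMod c :=
    { toFun := fun v => (((b * v.2.1 - ta * v.2.2 : ℤ) : ZMod a),
        ((c * v.2.2 - tb * v.1 : ℤ) : ZMod b), ((a * v.1 - tc * v.2.1 : ℤ) : ZMod c))
      map_zero' := by simp
      map_add' := by
        intro v w
        simp only [Prod.fst_add, Prod.snd_add, Prod.mk_add_mk, Prod.mk.injEq]
        refine ⟨?_, ?_, ?_⟩ <;> push_cast <;> ring }
  have hcard : Fintype.card (ZMod a × ZMod b × ZMod c) <
      (Nat.sqrt (b * c) + 1) * ((Nat.sqrt (c * a) + 1) * (Nat.sqrt (a * b) + 1)) := by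
    simp only [Fintype.card_prod, ZMod.card]
    have e1 := Nat.lt_succ_sqrt' (b * c)
    have e2 := Nat.lt_succ_sqrt' (c * a)
    have e3 := Nat.lt_succ_sqrt' (a * b)
    simp only [Nat.succ_eq_add_one] at e1 e2 e3
    refine lt_of_pow_lt_pow_left₀ 2 (Nat.zero_le _) ?_
    calc (a * (b * c)) ^ 2 = (b * c) * ((c * a) * (a * b)) := by ring
      _ < (Nat.sqrt (b * c) + 1) ^ 2 * ((Nat.sqrt (c * a) + 1) ^ 2 * (Nat.sqrt (a * b) + 1) ^ 2) := by
        refine Nat.mul_lt_mul'' e1 (Nat.mul_lt_mul'' e2 e3)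
      _ = _ := by ring
  obtain ⟨x, y, z, hne, hx, hy, hz, hf⟩ := exists_small_ne_zero_of_card_lt f _ _ _ hcard
  simp only [f, AddMonoidHom.coe_mk, ZeroHom.coe_mk, Prod.mk_eq_zero,
    ZMod.intCast_zmod_eq_zero_iff_dvd, ZMod.intCast_zmod_eq_zero_iff_dvd] at hf
  obtain ⟨⟨ka, hka⟩, ⟨kb, hkb⟩, ⟨kc, hkc⟩⟩ := hf
  obtain ⟨sa, hsa'⟩ := hta
  obtain ⟨sb, hsb'⟩ := htb
  obtain ⟨sc, hsc'⟩ := htc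
  have da : (a : ℤ) ∣ a * x ^ 2 + b * y ^ 2 - c * z ^ 2 := by
    refine (Nat.isCoprime_iff_coprime.2 hab).dvd_of_dvd_mul_left (y := (b : ℤ)) ?_
    exact ⟨b * x ^ 2 + ka * (b * y + ta * z) + sa * z ^ 2,
      by linear_combination (b * y + ta * z) * hka + z ^ 2 * hsa'⟩
  have db : (b : ℤ) ∣ a * x ^ 2 + b * y ^ 2 - c * z ^ 2 := by
    refine (Nat.isCoprime_iff_coprime.2 hbc).dvd_of_dvd_mul_left (y := (c : ℤ)) ?_
    exact ⟨c * y ^ 2 - kb * (c * z + tb * x) - sb * x ^ 2,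
      by linear_combination -(c * z + tb * x) * hkb - x ^ 2 * hsb'⟩
  have dc : (c : ℤ) ∣ a * x ^ 2 + b * y ^ 2 - c * z ^ 2 := by
    refine (Nat.isCoprime_iff_coprime.2 hac.symm).dvd_of_dvd_mul_left (y := (a : ℤ)) ?_
    exact ⟨-a * z ^ 2 + kc * (a * x + tc * y) + sc * y ^ 2,
      by linear_combination (a * x + tc * y) * hkc + y ^ 2 * hsc'⟩
  have dabc : (a * b * c : ℤ) ∣ a * x ^ 2 + b * y ^ 2 - c * z ^ 2 := by
    refine IsCoprime.mul_dvd ?_ (IsCoprime.mul_dvd (Nat.isCoprime_iff_coprime.2 hab) da db) dc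
    exact_mod_cast Nat.isCoprime_iff_coprime.2 habc
  have bx : x ^ 2 ≤ b * c := by
    have := Nat.sqrt_le' (b * c)
    calc x ^ 2 = |x| ^ 2 := (sq_abs x).symm
      _ ≤ (Nat.sqrt (b * c) : ℤ) ^ 2 := by gcongr
      _ ≤ _ := by exact_mod_cast this
  have bY : y ^ 2 ≤ c * a := by
    have := Nat.sqrt_le' (c * a)
    calc y ^ 2 = |y| ^ 2 := (sq_abs y).symm
      _ ≤ (Nat.sqrt (c * a) : ℤ) ^ 2 := by gcongr
      _ ≤ _ := by exact_mod_cast this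
  have bz : z ^ 2 < a * b := by
    have h0 := Nat.sqrt_le' (a * b)
    have h1 : z ^ 2 ≤ a * b := by
      calc z ^ 2 = |z| ^ 2 := (sq_abs z).symm
        _ ≤ (Nat.sqrt (a * b) : ℤ) ^ 2 := by gcongr
        _ ≤ _ := by exact_mod_cast h0
    refine lt_of_le_of_ne h1 fun he => hab1 ?_
    have he' : z.natAbs * z.natAbs = a * b := by
      zify
      rw [← sq, sq_abs]
      exact he
    have hu := hsab z.natAbs ⟨1, by rw [he', mul_one]⟩
    rw [Nat.isUnit_iff] at hu
    rw [← he', hu]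
  have pa : (0 : ℤ) < a := by exact_mod_cast ha
  have pb : (0 : ℤ) < b := by exact_mod_cast hb
  have pc : (0 : ℤ) < c := by exact_mod_cast hc
  have pabc : (0 : ℤ) < a * b * c := by positivity
  obtain ⟨k, hk⟩ := dabc
  -- The size of the box leaves only the values `0`, `abc` and `2abc` for the form.
  have up : a * x ^ 2 + b * y ^ 2 - c * z ^ 2 ≤ 2 * (a * b * c) := by
    have := mul_le_mul_of_nonneg_left bx pa.le
    have := mul_le_mul_of_nonneg_left bY pb.le
    have := mul_nonneg pc.le (sq_nonneg z)
    linarith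
  have lo : -(a * b * c : ℤ) < a * x ^ 2 + b * y ^ 2 - c * z ^ 2 := by
    have := mul_lt_mul_of_pos_left bz pc
    have := mul_nonneg pa.le (sq_nonneg x)
    have := mul_nonneg pb.le (sq_nonneg y)
    linarith
  rw [hk] at up lo
  have k1 : -1 < k := lt_of_mul_lt_mul_left (by linarith) pabc.le
  have k2 : k ≤ 2 := le_of_mul_le_mul_left (by linarith) pabc
  interval_cases k
  · exact ⟨x, y, z, hne, by linarith⟩
  -- Here `ax²+by² = c(z²+ab)`; multiplying by `z²+ab` and composing the binary forms gives
  -- `a(xz+by)²+b(yz-ax)² = c(z²+ab)²`.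
  · refine ⟨x * z + b * y, y * z - a * x, z ^ 2 + a * b, ?_, ?_⟩
    · rintro ⟨-, -, h0⟩
      nlinarith [sq_nonneg z, mul_pos pa pb]
    · linear_combination (z ^ 2 + (a : ℤ) * b) * hk
  · -- all bounds are attained
    have qx := mul_nonneg pa.le (sub_nonneg.2 bx)
    have qy := mul_nonneg pb.le (sub_nonneg.2 bY)
    have qz := mul_nonneg pc.le (sq_nonneg z)
    have ex : x ^ 2 = b * c := le_antisymm bx (le_of_mul_le_mul_left (by linarith) pa)
    have ey : y ^ 2 = c * a := le_antisymm bY (le_of_mul_le_mul_left (by linarith) pb)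
    exfalso
    have aux : ∀ (w : ℤ) (m n : ℕ), Squarefree (m * n) → w ^ 2 = m * n → m * n = 1 := by
      intro w m n hs hw
      have he' : w.natAbs * w.natAbs = m * n := by
        zify
        rw [← sq, sq_abs]
        exact hw
      have hu := hs w.natAbs ⟨1, by rw [he', mul_one]⟩
      rw [Nat.isUnit_iff] at hu
      rw [← he', hu]
    have e1 := aux x b c (hsq.squarefree_of_dvd ⟨a, by ring⟩) ex
    have e2 := aux y c a (hsq.squarefree_of_dvd ⟨b, by ring⟩) ey
    have := Nat.eq_one_of_mul_eq_one_right e1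
    have := Nat.eq_one_of_mul_eq_one_left e2
    exact hab1 (by simp [*])

/-- Legendre's theorem: no condition at `2` is needed. -/
theorem legendre (a b c : ℤ) (hsq : Squarefree (a * b * c))
    (hs : ¬ (0 < a ∧ 0 < b ∧ 0 < c)) (hs' : ¬ (a < 0 ∧ b < 0 ∧ c < 0))
    (h1 : ∀ l : ℕ, l.Prime → l ≠ 2 → (l : ℤ) ∣ a → IsSquare ((-(b * c) : ℤ) : ZMod l))
    (h2 : ∀ l : ℕ, l.Prime → l ≠ 2 → (l : ℤ) ∣ b → IsSquare ((-(c * a) : ℤ) : ZMod l))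
    (h3 : ∀ l : ℕ, l.Prime → l ≠ 2 → (l : ℤ) ∣ c → IsSquare ((-(a * b) : ℤ) : ZMod l)) :
    ∃ x y z : ℤ, ¬ (x = 0 ∧ y = 0 ∧ z = 0) ∧ a * x ^ 2 + b * y ^ 2 + c * z ^ 2 = 0 := by
  have key : ∀ a b c : ℤ, Squarefree (a * b * c) → 0 < a → 0 < b → c < 0 →
      (∀ l : ℕ, l.Prime → l ≠ 2 → (l : ℤ) ∣ a → IsSquare ((-(b * c) : ℤ) : ZMod l)) →
      (∀ l : ℕ, l.Prime → l ≠ 2 → (l : ℤ) ∣ b → IsSquare ((-(c * a) : ℤ) : ZMod l)) →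
      (∀ l : ℕ, l.Prime → l ≠ 2 → (l : ℤ) ∣ c → IsSquare ((-(a * b) : ℤ) : ZMod l)) →
      ∃ x y z : ℤ, ¬ (x = 0 ∧ y = 0 ∧ z = 0) ∧ a * x ^ 2 + b * y ^ 2 + c * z ^ 2 = 0 := by
    intro a b c hsq ha hb hc h1 h2 h3
    lift a to ℕ using ha.le
    lift b to ℕ using hb.le
    obtain ⟨c, rfl⟩ : ∃ c' : ℤ, c = -c' := ⟨-c, by ring⟩
    lift c to ℕ using by omega
    -- Every residue modulo `2` is a square, so the condition there is empty.
    have two : ∀ (l : ℕ) (z : ℤ), (l ≠ 2 → IsSquare ((z : ℤ) : ZMod l)) →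
        IsSquare ((z : ℤ) : ZMod l) := by
      intro l z h
      by_cases hl : l = 2
      · subst hl
        generalize ((z : ℤ) : ZMod 2) = w
        revert w
        decide
      · exact h hl
    have hsq' : Squarefree (a * b * c) := by
      rw [← Int.squarefree_natAbs] at hsq
      simpa [Int.natAbs_mul] using hsq
    obtain ⟨x, y, z, hne, h⟩ := legendre_of_pos a b c (by omega) (by omega) (by omega) hsq'
      (fun l hl hd => two _ _ fun h2 => by
        simpa using h1 l hl h2 (by exact_mod_cast hd))
      (fun l hl hd => two _ _ fun h => by
        simpa using h2 l hl h (by exact_mod_cast hd))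
      (fun l hl hd => two _ _ fun h2 => h3 l hl h2
        (by simpa using (by exact_mod_cast hd : (l : ℤ) ∣ c)))
    exact ⟨x, y, z, hne, by linear_combination h⟩
  have h0 : a * b * c ≠ 0 := hsq.ne_zero
  have ha0 : a ≠ 0 := by rintro rfl; simp at h0
  have hb0 : b ≠ 0 := by rintro rfl; simp at h0
  have hc0 : c ≠ 0 := by rintro rfl; simp at h0
  -- Up to cyclic permutation two coefficients share a sign opposite to the third; an overall sign
  -- change reduces to `key`.
  have key2 : ∀ a b c : ℤ, Squarefree (a * b * c) → 0 < a * b → a * c < 0 →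
      (∀ l : ℕ, l.Prime → l ≠ 2 → (l : ℤ) ∣ a → IsSquare ((-(b * c) : ℤ) : ZMod l)) →
      (∀ l : ℕ, l.Prime → l ≠ 2 → (l : ℤ) ∣ b → IsSquare ((-(c * a) : ℤ) : ZMod l)) →
      (∀ l : ℕ, l.Prime → l ≠ 2 → (l : ℤ) ∣ c → IsSquare ((-(a * b) : ℤ) : ZMod l)) →
      ∃ x y z : ℤ, ¬ (x = 0 ∧ y = 0 ∧ z = 0) ∧ a * x ^ 2 + b * y ^ 2 + c * z ^ 2 = 0 := by
    intro a b c hsq hab hac h1 h2 h3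
    rcases lt_trichotomy a 0 with ha | ha | ha
    · have hb : b < 0 := by nlinarith
      have hc : 0 < c := by nlinarith
      obtain ⟨x, y, z, hne, h⟩ := key (-a) (-b) (-c)
        (by rw [← Int.squarefree_natAbs] at hsq ⊢; simpa [Int.natAbs_mul] using hsq) (by omega) (by omega)
        (by omega) (by simpa using h1) (by simpa using h2) (by simpa using h3)
      exact ⟨x, y, z, hne, by linear_combination -h⟩
    · simp [ha] at hac
    · exact key a b c hsq ha (by nlinarith) (by nlinarith) h1 h2 h3
  rcases lt_or_gt_of_ne (mul_ne_zero ha0 hb0) with hab | hab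
  · rcases lt_or_gt_of_ne (mul_ne_zero ha0 hc0) with hac | hac
    · have hbc : 0 < b * c := by nlinarith [sq_nonneg a, mul_pos_of_neg_of_neg hab hac]
      obtain ⟨x, y, z, hne, h⟩ := key2 b c a (by convert hsq using 1; ring) hbc (by linarith)
        h2 h3 h1
      exact ⟨z, x, y, by tauto, by linear_combination h⟩
    · have hbc : c * b < 0 := by nlinarith [sq_nonneg a, mul_neg_of_neg_of_pos hab hac]
      obtain ⟨x, y, z, hne, h⟩ := key2 c a b (by convert hsq using 1; ring) (by linarith) hbc
        h3 h1 h2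
      exact ⟨y, z, x, by tauto, by linear_combination h⟩
  · rcases lt_or_gt_of_ne (mul_ne_zero ha0 hc0) with hac | hac
    · exact key2 a b c hsq hab hac h1 h2 h3
    · exfalso
      rcases lt_or_gt_of_ne ha0 with ha | ha
      · exact hs' ⟨ha, by nlinarith, by nlinarith⟩
      · exact hs ⟨ha, by nlinarith, by nlinarith⟩

/-! ### Admissible algebras `(AB, AC)` and the product formula -/

/-- Coefficients of the ternary forms `AB x² + AC y² - BC z²` under consideration. -/
structure Admissible (A B C : ℤ) : Prop where
  pos : 0 < A
  sqf : Squarefree (A * B * C)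
  odd_left : Odd A
  odd_right : Odd C
  -- Up to 2-adic squares `AB` is `-1`, `2` or `-2`. For odd `u`, the symbols of these with `u` at
  -- `2` are `-1` for `u ≡ 3 mod 4`, for `u ≡ 3, 5 mod 8` and for `u ≡ 5, 7 mod 8` respectively,
  -- which gives `RamifiedTwo`.
  middle : A * B = -1 ∨ A * B % 16 = 2 ∨ A * B % 16 = 14

/-- The Hilbert symbol of the quaternion algebra `(AB, AC)` at an odd prime. -/
def localSymbol (A B C : ℤ) (l : ℕ) : ℤ :=
  if (l : ℤ) ∣ A then jacobiSym (-(B * C)) l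
  else if (l : ℤ) ∣ B then jacobiSym (A * C) l
  else if (l : ℤ) ∣ C then jacobiSym (A * B) l
  else 1

/-- The quaternion algebra `(AB, AC)` is ramified at `2`. -/
def RamifiedTwo (A B C : ℤ) : Prop :=
  (A * B = -1 ∧ A * C % 4 = 3) ∨
  (A * B % 16 = 2 ∧ (A * C % 8 = 3 ∨ A * C % 8 = 5)) ∨
  (A * B % 16 = 14 ∧ (A * C % 8 = 5 ∨ A * C % 8 = 7))

instance (A B C : ℤ) : Decidable (RamifiedTwo A B C) := by
  unfold RamifiedTwo; infer_instance

/-- The quaternion algebra `(AB, AC)` is ramified at the real place. -/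
def RamifiedReal (A B C : ℤ) : Prop := A * B < 0 ∧ A * C < 0

instance (A B C : ℤ) : Decidable (RamifiedReal A B C) := by
  unfold RamifiedReal; infer_instance

theorem jacobiSym_congr_of_prime (a b : ℤ) (n : ℕ) (hn : n ≠ 0)
    (h : ∀ l : ℕ, l.Prime → l ∣ n → jacobiSym a l = jacobiSym b l) :
    jacobiSym a n = jacobiSym b n := by
  induction n using induction_on_primes with
  | zero => exact absurd rfl hn
  | one => simp
  | prime_mul p m hp ih =>
    have hm : m ≠ 0 := right_ne_zero_of_mul hn
    rw [jacobiSym.mul_right' _ hp.ne_zero hm, jacobiSym.mul_right' _ hp.ne_zero hm,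
      h p hp (dvd_mul_right _ _), ih hm fun l hl hd => h l hl (hd.mul_left _)]

/-- Writing `n % 8 % 4` makes the value visibly a function of `n % 8`, as the finite check
`reciprocity_finite` needs. -/
theorem jacobiSym_neg_one_eq {n : ℕ} (hn : Odd n) :
    jacobiSym (-1) n = if n % 8 % 4 = 1 then 1 else -1 := by
  rw [jacobiSym.at_neg_one hn, ZMod.χ₄_nat_eq_if_mod_four]
  have := Nat.odd_iff.1 hn
  have e : n % 8 % 4 = n % 4 := by omega
  simp [this, e]

theorem jacobiSym_two_eq {n : ℕ} (hn : Odd n) :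
    jacobiSym 2 n = if n % 8 = 1 ∨ n % 8 = 7 then 1 else -1 := by
  rw [jacobiSym.at_two hn, ZMod.χ₈_nat_eq_if_mod_eight]
  have := Nat.odd_iff.1 hn
  simp [this]

theorem jacobiSym_swap {a b : ℕ} (ha : Odd a) (hb : Odd b) :
    jacobiSym a b = (if a % 8 % 4 = 3 ∧ b % 8 % 4 = 3 then -1 else 1) * jacobiSym b a := by
  have h1 := Nat.odd_iff.1 ha
  have h2 := Nat.odd_iff.1 hb
  have ea : a % 8 % 4 = a % 4 := by omega
  have eb : b % 8 % 4 = b % 4 := by omega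
  rw [ea, eb]
  split_ifs with h
  · rw [jacobiSym.quadratic_reciprocity_three_mod_four h.1 h.2]; ring
  · rcases Nat.odd_mod_four_iff.1 h1 with h3 | h3
    · rw [jacobiSym.quadratic_reciprocity_one_mod_four h3 hb]; ring
    · have h4 : b % 4 = 1 := by
        rcases Nat.odd_mod_four_iff.1 h2 with h5 | h5
        · exact h5
        · exact absurd ⟨h3, h5⟩ h
      rw [← jacobiSym.quadratic_reciprocity_one_mod_four h4 ha]; ring

theorem jacobiSym_sign_eq {n : ℕ} (hn : Odd n) (s : Bool) :
    jacobiSym (if s then -1 else 1) n = if s ∧ ¬ n % 8 % 4 = 1 then -1 else 1 := by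
  cases s
  · simp
  · simp only [if_true, jacobiSym_neg_one_eq hn]
    split_ifs <;> simp_all

set_option maxRecDepth 100000 in
-- The product formula after all genuine Jacobi symbols have cancelled: only signs and residues
-- modulo `8` remain. The Booleans `s` and `t` are the signs of `B` and `C`; the right side is the
-- symbol at `2` times the symbol at infinity.
theorem reciprocity_finite : ∀ a b c : Fin 8, a.1 % 2 = 1 → b.1 % 2 = 1 → c.1 % 2 = 1 →
    ∀ s t : Bool,
    ((if s then -1 else 1 : ℤ) * a.1 * b.1 % 8 = 1 ∨
      (if s then -1 else 1 : ℤ) * a.1 * b.1 % 8 = 7) →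
    ((if a.1 % 4 = 1 then 1 else -1) * (if a.1 = 1 ∨ a.1 = 7 then 1 else -1) *
      (if s ∧ ¬ a.1 % 4 = 1 then -1 else 1) * (if t ∧ ¬ a.1 % 4 = 1 then -1 else 1) *
      (if t ∧ ¬ b.1 % 4 = 1 then -1 else 1) * (if c.1 = 1 ∨ c.1 = 7 then 1 else -1) *
      (if s ∧ ¬ c.1 % 4 = 1 then -1 else 1) *
      (if a.1 % 4 = 3 ∧ b.1 % 4 = 3 then -1 else 1) *
      (if a.1 % 4 = 3 ∧ c.1 % 4 = 3 then -1 else 1) *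
      (if b.1 % 4 = 3 ∧ c.1 % 4 = 3 then -1 else 1) : ℤ) =
    (if ((if s then -1 else 1 : ℤ) * a.1 * b.1 % 8 = 1 ∧
          (a.1 * (if t then -1 else 1 : ℤ) * c.1 % 8 = 3 ∨
            a.1 * (if t then -1 else 1 : ℤ) * c.1 % 8 = 5)) ∨
        ((if s then -1 else 1 : ℤ) * a.1 * b.1 % 8 = 7 ∧
          (a.1 * (if t then -1 else 1 : ℤ) * c.1 % 8 = 5 ∨
            a.1 * (if t then -1 else 1 : ℤ) * c.1 % 8 = 7)) then -1 else 1) *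
    (if s ∧ t then -1 else 1) := by
  decide

/-- The sign of an integer, encoded by a Boolean. -/
def boolSign (s : Bool) : ℤ := if s then -1 else 1

theorem boolSign_mul_self (s : Bool) : boolSign s * boolSign s = 1 := by cases s <;> rfl

theorem exists_boolSign_mul_natAbs (z : ℤ) : ∃ s, z = boolSign s * z.natAbs := by
  rcases Int.natAbs_eq z with h | h
  · exact ⟨false, by simpa [boolSign] using h⟩
  · exact ⟨true, by simpa [boolSign] using h⟩

/-- Expanding multiplicatively, each pair among `a, b, c` contributes both of its Jacobi symbols.
Reciprocity turns the two into a square, which is `1` by coprimality, times a sign depending on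
residues modulo `8`. -/
theorem reciprocity_even {a b c : ℕ} (ha : Odd a) (hb : Odd b) (hc : Odd c)
    (hab : a.Coprime b) (hac : a.Coprime c) (hbc : b.Coprime c) (s t : Bool)
    (h : boolSign s * a * b % 8 = 1 ∨ boolSign s * a * b % 8 = 7) :
    jacobiSym (-(2 * boolSign s * b * (boolSign t * c))) a * jacobiSym (a * (boolSign t * c)) b *
      jacobiSym (a * (2 * boolSign s * b)) c =
    (if (boolSign s * a * b % 8 = 1 ∧
          (a * boolSign t * c % 8 = 3 ∨ a * boolSign t * c % 8 = 5)) ∨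
        (boolSign s * a * b % 8 = 7 ∧
          (a * boolSign t * c % 8 = 5 ∨ a * boolSign t * c % 8 = 7)) then -1 else 1) *
    (if s ∧ t then -1 else 1) := by
  have key := reciprocity_finite ⟨a % 8, Nat.mod_lt _ (by norm_num)⟩
    ⟨b % 8, Nat.mod_lt _ (by norm_num)⟩ ⟨c % 8, Nat.mod_lt _ (by norm_num)⟩
    (by have := Nat.odd_iff.1 ha; simp only; omega) (by have := Nat.odd_iff.1 hb; simp only; omega)
    (by have := Nat.odd_iff.1 hc; simp only; omega) s t
  have e1 : ∀ (u : ℤ) (x y : ℕ), u * ((x % 8 : ℕ) : ℤ) * ((y % 8 : ℕ) : ℤ) % 8 = u * x * y % 8 := by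
    intro u x y
    push_cast
    simp [Int.mul_emod, Int.emod_emod_of_dvd]
  have e2 : ∀ (u : ℤ) (x y : ℕ), ((x % 8 : ℕ) : ℤ) * u * ((y % 8 : ℕ) : ℤ) % 8 = x * u * y % 8 := by
    intro u x y
    push_cast
    simp [Int.mul_emod, Int.emod_emod_of_dvd]
  simp only [e1, e2] at key
  have key := key h
  change _ = (if (boolSign s * a * b % 8 = 1 ∧
          (a * boolSign t * c % 8 = 3 ∨ a * boolSign t * c % 8 = 5)) ∨
        (boolSign s * a * b % 8 = 7 ∧
          (a * boolSign t * c % 8 = 5 ∨ a * boolSign t * c % 8 = 7)) then -1 else 1) * _ at key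
  rw [← key]
  have r1 : jacobiSym (-(2 * boolSign s * b * (boolSign t * c))) a =
      jacobiSym (-1) a * jacobiSym 2 a * jacobiSym (boolSign s) a * jacobiSym b a *
        jacobiSym (boolSign t) a * jacobiSym c a := by
    simp only [← jacobiSym.mul_left]
    congr 1; ring
  have r2 : jacobiSym (a * (boolSign t * c)) b =
      jacobiSym a b * jacobiSym (boolSign t) b * jacobiSym c b := by
    simp only [← jacobiSym.mul_left]
    congr 1; ring
  have r3 : jacobiSym (a * (2 * boolSign s * b)) c =
      jacobiSym a c * jacobiSym 2 c * jacobiSym (boolSign s) c * jacobiSym b c := by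
    simp only [← jacobiSym.mul_left]
    congr 1; ring
  rw [r1, r2, r3, jacobiSym_swap ha hb, jacobiSym_swap ha hc, jacobiSym_swap hb hc,
    jacobiSym_neg_one_eq ha, jacobiSym_two_eq ha, jacobiSym_two_eq hc]
  simp only [boolSign, jacobiSym_sign_eq ha, jacobiSym_sign_eq hb, jacobiSym_sign_eq hc]
  have s1 : jacobiSym b a ^ 2 = 1 := jacobiSym.sq_one (by simpa using hab.symm)
  have s2 : jacobiSym c a ^ 2 = 1 := jacobiSym.sq_one (by simpa using hac.symm)
  have s3 : jacobiSym c b ^ 2 = 1 := jacobiSym.sq_one (by simpa using hbc.symm)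
  generalize jacobiSym b a = x at *
  generalize jacobiSym c a = y at *
  generalize jacobiSym c b = z at *
  generalize (if a % 8 % 4 = 3 ∧ b % 8 % 4 = 3 then (-1 : ℤ) else 1) = q1
  generalize (if a % 8 % 4 = 3 ∧ c % 8 % 4 = 3 then (-1 : ℤ) else 1) = q2
  generalize (if b % 8 % 4 = 3 ∧ c % 8 % 4 = 3 then (-1 : ℤ) else 1) = q3
  generalize (if a % 8 % 4 = 1 then (1 : ℤ) else -1) = q4
  generalize (if a % 8 = 1 ∨ a % 8 = 7 then (1 : ℤ) else -1) = q5
  generalize (if c % 8 = 1 ∨ c % 8 = 7 then (1 : ℤ) else -1) = q6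
  generalize (if s = true ∧ ¬a % 8 % 4 = 1 then (-1 : ℤ) else 1) = q7
  generalize (if t = true ∧ ¬a % 8 % 4 = 1 then (-1 : ℤ) else 1) = q8
  generalize (if t = true ∧ ¬b % 8 % 4 = 1 then (-1 : ℤ) else 1) = q9
  generalize (if s = true ∧ ¬c % 8 % 4 = 1 then (-1 : ℤ) else 1) = q10
  linear_combination q4 * q5 * q7 * q8 * q9 * q6 * q10 * q1 * q2 * q3 *
    (y ^ 2 * z ^ 2 * s1 + z ^ 2 * s2 + s3)

/-- The odd part of the middle coefficient and its sign. -/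
theorem Admissible.exists_factor {A B C : ℤ} (h : Admissible A B C) :
    ∃ (a b c : ℕ) (s t : Bool) (k : ℤ), Odd a ∧ Odd b ∧ Odd c ∧ a.Coprime b ∧ a.Coprime c ∧
      b.Coprime c ∧ A = a ∧ k * B = 2 * boolSign s * b ∧ C = boolSign t * c ∧
      ((k = 2 ∧ A = 1 ∧ B = -1 ∧ b = 1 ∧ s = true) ∨ k = 1) := by
  have hp := h.pos
  obtain ⟨a, rfl⟩ : ∃ a : ℕ, A = a := ⟨A.toNat, by omega⟩
  obtain ⟨t, ht⟩ := exists_boolSign_mul_natAbs C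
  have ha : Odd a := by exact_mod_cast h.odd_left
  have hc : Odd C.natAbs := Int.natAbs_odd.2 h.odd_right
  have hs := h.sqf
  rw [← Int.squarefree_natAbs, Int.natAbs_mul, Int.natAbs_mul, Int.natAbs_natCast] at hs
  have c1 := Nat.coprime_of_squarefree_mul hs
  have c2 := Nat.coprime_of_squarefree_mul (hs.squarefree_of_dvd (dvd_mul_right _ _))
  rcases h.middle with hm | hm
  · have ha1 : a = 1 := by
      have : a ∣ 1 := by
        have h1 : (a : ℤ) ∣ -1 := ⟨B, hm.symm⟩
        have := Int.natAbs_dvd_natAbs.2 h1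
        simpa using this
      exact Nat.dvd_one.1 this
    subst ha1
    -- When `AB = -1` the middle coefficient has no factor `2`; `k = 2` supplies it so that both
    -- cases have the shape `kB = ±2b`.
    refine ⟨1, 1, C.natAbs, true, t, 2, by simp, by simp, hc, by simp, by simp, by simp, rfl, ?_,
      ht, Or.inl ⟨rfl, by simp, by simpa using hm, rfl, rfl⟩⟩
    simp only [boolSign, if_true]
    push_cast at hm ⊢
    linarith
  · have ha2 := h.odd_left
    have hB : B % 4 = 2 := by
      have h4 : (a : ℤ) * B % 4 = 2 := by omega
      rw [Int.mul_emod] at h4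
      have : (a : ℤ) % 4 = 1 ∨ (a : ℤ) % 4 = 3 := by
        obtain ⟨k, hk⟩ := ha2
        omega
      have h5 : B % 4 = 0 ∨ B % 4 = 1 ∨ B % 4 = 2 ∨ B % 4 = 3 := by omega
      rcases this with h6 | h6 <;> rcases h5 with h7 | h7 | h7 | h7 <;>
        rw [h6, h7] at h4 <;> simp at h4 <;> exact h7
    obtain ⟨B', hB'⟩ : ∃ B', B = 2 * B' := ⟨B / 2, by omega⟩
    subst hB'
    obtain ⟨s, hs'⟩ := exists_boolSign_mul_natAbs B'
    rw [Int.natAbs_mul] at c1 c2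
    refine ⟨a, B'.natAbs, C.natAbs, s, t, 1, ha, ?_, hc, c2.coprime_mul_left_right,
      c1.coprime_mul_right, (c1.coprime_mul_left).coprime_mul_left, rfl, ?_, ht, Or.inr rfl⟩
    · rw [Int.natAbs_odd, Int.odd_iff]; omega
    · rw [one_mul]; nth_rewrite 1 [hs']; ring

/-- The product formula for the Hilbert symbols of `(AB, AC)`. -/
theorem Admissible.reciprocity {A B C : ℤ} (h : Admissible A B C) {a b c : ℕ} {s t : Bool} {k : ℤ}
    (ha : Odd a) (hb : Odd b) (hc : Odd c) (hab : a.Coprime b) (hac : a.Coprime c)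
    (hbc : b.Coprime c) (hA : A = a) (hB : k * B = 2 * boolSign s * b) (hC : C = boolSign t * c)
    (hk : (k = 2 ∧ A = 1 ∧ B = -1 ∧ b = 1 ∧ s = true) ∨ k = 1) :
    jacobiSym (-(B * C)) a * jacobiSym (A * C) b * jacobiSym (A * B) c =
      (if RamifiedTwo A B C then -1 else 1) * (if s ∧ t then -1 else 1) := by
  rcases hk with ⟨rfl, h1, rfl, rfl, rfl⟩ | rfl
  · have ha1 : a = 1 := by rw [h1] at hA; exact_mod_cast hA.symm
    subst ha1
    subst h1
    simp only [RamifiedTwo, jacobiSym.one_right, one_mul, jacobiSym_neg_one_eq hc, hC]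
    have := Nat.odd_iff.1 hc
    cases t
    · simp only [boolSign, Bool.false_eq_true, if_false, one_mul, and_false, mul_one]
      norm_num
      split_ifs <;> first | rfl | (exfalso; omega)
    · simp only [boolSign, if_true, and_self]
      norm_num
      split_ifs <;> first | rfl | (exfalso; omega)
  · rw [one_mul] at hB
    subst hA hB hC
    have hm : boolSign s * a * b % 8 = 1 ∨ boolSign s * a * b % 8 = 7 := by
      have e : (a : ℤ) * (2 * boolSign s * b) = 2 * (boolSign s * a * b) := by ring
      have := h.middle
      rw [e] at this
      omega
    rw [reciprocity_even ha hb hc hab hac hbc s t hm]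
    congr 2
    have e : (a : ℤ) * (2 * boolSign s * b) = 2 * (boolSign s * a * b) := by ring
    have e' : (a : ℤ) * (boolSign t * c) = a * boolSign t * c := by ring
    simp only [RamifiedTwo, e, e', eq_iff_iff]
    constructor
    · rintro (⟨h1, h2⟩ | ⟨h1, h2⟩)
      · exact Or.inr (Or.inl ⟨by omega, h2⟩)
      · exact Or.inr (Or.inr ⟨by omega, h2⟩)
    · rintro (⟨h1, h2⟩ | ⟨h1, h2⟩ | ⟨h1, h2⟩)
      · omega
      · exact Or.inl ⟨by omega, h2⟩
      · exact Or.inr ⟨by omega, h2⟩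

/-! ### Prescribed primes and reciprocity for discriminants -/

theorem exists_crt_isCoprime {m n : ℤ} (hmn : IsCoprime m n) (a b : ℤ) (ha : IsCoprime a m)
    (hb : IsCoprime b n) : ∃ x, m ∣ x - a ∧ n ∣ x - b ∧ IsCoprime x (m * n) := by
  obtain ⟨u, v, huv⟩ := hmn
  have h1 : m ∣ a * (v * n) + b * (u * m) - a := ⟨u * (b - a), by linear_combination a * huv⟩
  have h2 : n ∣ a * (v * n) + b * (u * m) - b := ⟨v * (a - b), by linear_combination b * huv⟩
  refine ⟨a * (v * n) + b * (u * m), h1, h2, IsCoprime.mul_right ?_ ?_⟩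
  · obtain ⟨k, hk⟩ := h1
    rw [eq_add_of_sub_eq hk, add_comm]
    exact ha.add_mul_left_left k
  · obtain ⟨k, hk⟩ := h2
    rw [eq_add_of_sub_eq hk, add_comm]
    exact hb.add_mul_left_left k

/-- Dirichlet's theorem with four simultaneous congruences. -/
theorem exists_prime_of_congruences (n₁ n₂ n₃ n₄ : ℕ) (a₁ a₂ a₃ a₄ : ℤ) (N : ℕ)
    (h₁ : n₁ ≠ 0) (h₂ : n₂ ≠ 0) (h₃ : n₃ ≠ 0) (h₄ : n₄ ≠ 0)
    (h₁₂ : n₁.Coprime n₂) (h₁₃ : n₁.Coprime n₃) (h₁₄ : n₁.Coprime n₄) (h₂₃ : n₂.Coprime n₃)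
    (h₂₄ : n₂.Coprime n₄) (h₃₄ : n₃.Coprime n₄)
    (c₁ : IsCoprime a₁ n₁) (c₂ : IsCoprime a₂ n₂) (c₃ : IsCoprime a₃ n₃) (c₄ : IsCoprime a₄ n₄) :
    ∃ q : ℕ, N < q ∧ q.Prime ∧ (n₁ : ℤ) ∣ q - a₁ ∧ (n₂ : ℤ) ∣ q - a₂ ∧ (n₃ : ℤ) ∣ q - a₃ ∧
      (n₄ : ℤ) ∣ q - a₄ := by
  have i := fun {m n : ℕ} (h : m.Coprime n) => Nat.isCoprime_iff_coprime.2 h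
  obtain ⟨x, x1, x2, x3⟩ := exists_crt_isCoprime (i h₁₂) a₁ a₂ c₁ c₂
  obtain ⟨y, y1, y2, y3⟩ := exists_crt_isCoprime (i h₃₄) a₃ a₄ c₃ c₄
  have hc : IsCoprime ((n₁ : ℤ) * n₂) ((n₃ : ℤ) * n₄) :=
    IsCoprime.mul_left (IsCoprime.mul_right (i h₁₃) (i h₁₄))
      (IsCoprime.mul_right (i h₂₃) (i h₂₄))
  obtain ⟨z, z1, z2, z3⟩ := exists_crt_isCoprime hc x y x3 y3
  have : NeZero (n₁ * n₂ * (n₃ * n₄)) :=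
    ⟨mul_ne_zero (mul_ne_zero h₁ h₂) (mul_ne_zero h₃ h₄)⟩
  have hu : IsUnit ((z : ℤ) : ZMod (n₁ * n₂ * (n₃ * n₄))) := by
    rw [ZMod.coe_int_isUnit_iff_isCoprime]
    push_cast
    exact z3.symm
  obtain ⟨q, hq, hqp, hqz⟩ := Nat.forall_exists_prime_gt_and_eq_mod hu N
  have hd : ((n₁ * n₂ * (n₃ * n₄) : ℕ) : ℤ) ∣ q - z := by
    rw [← ZMod.intCast_eq_intCast_iff_dvd_sub]
    simpa using hqz.symm
  push_cast at hd
  have e : ∀ a b : ℤ, (q : ℤ) - b = (q - z) + (z - a) + (a - b) := by intros; ring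
  refine ⟨q, hq, hqp, ?_, ?_, ?_, ?_⟩
  · rw [e x]
    exact dvd_add (dvd_add ((Dvd.intro _ rfl).trans ((Dvd.intro _ rfl).trans hd))
      ((Dvd.intro _ rfl).trans z1)) x1
  · rw [e x]
    exact dvd_add (dvd_add ((Dvd.intro_left _ rfl).trans ((Dvd.intro _ rfl).trans hd))
      ((Dvd.intro_left _ rfl).trans z1)) x2
  · rw [e y]
    exact dvd_add (dvd_add ((Dvd.intro _ rfl).trans ((Dvd.intro_left _ rfl).trans hd))
      ((Dvd.intro _ rfl).trans z2)) y1
  · rw [e y]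
    exact dvd_add (dvd_add ((Dvd.intro_left _ rfl).trans ((Dvd.intro_left _ rfl).trans hd))
      ((Dvd.intro_left _ rfl).trans z2)) y2

/-- Quadratic reciprocity for a discriminant `d ≡ 1 mod 4`. -/
theorem jacobiSym_natAbs_right {d : ℤ} (hd : d % 4 = 1) {n : ℕ} (hn : Odd n) :
    jacobiSym n d.natAbs = jacobiSym d n := by
  have hD : Odd d.natAbs := by rw [Int.natAbs_odd, Int.odd_iff]; omega
  rcases le_or_gt 0 d with h | h
  · have e : (d.natAbs : ℤ) = d := Int.natAbs_of_nonneg h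
    have h1 : d.natAbs % 4 = 1 := by omega
    rw [← jacobiSym.quadratic_reciprocity_one_mod_four h1 hn, e]
  · have e : d = -1 * (d.natAbs : ℤ) := by omega
    have h1 : d.natAbs % 4 = 3 := by omega
    conv_rhs => rw [e, jacobiSym.mul_left]
    rw [jacobiSym_neg_one_eq hn, jacobiSym_swap hn hD]
    have := Nat.odd_iff.1 hn
    split_ifs <;> first | rfl | (exfalso; omega)

theorem jacobiSym_natAbs_left {d : ℤ} {q : ℕ} (hq : q % 4 = 1) :
    jacobiSym d q = jacobiSym d.natAbs q := by
  have ho : Odd q := Nat.odd_iff.2 (by omega)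
  obtain ⟨s, hs⟩ := exists_boolSign_mul_natAbs d
  conv_lhs => rw [hs, jacobiSym.mul_left]
  have e : q % 8 % 4 = 1 := by omega
  simp [boolSign, jacobiSym_sign_eq ho, e]

theorem jacobiSym_congr {a b : ℤ} {n : ℕ} (h : (n : ℤ) ∣ a - b) :
    jacobiSym a n = jacobiSym b n :=
  jacobiSym.mod_left' (Int.emod_eq_emod_iff_emod_sub_eq_zero.2 (Int.emod_eq_zero_of_dvd h))

/-! ### Local symbols at the primes dividing `ABC` -/

section LocalSymbol

variable {A B C : ℤ} {l : ℕ}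

theorem not_dvd_of_squarefree_mul {x y : ℤ} (h : Squarefree (x * y)) (hl : l.Prime)
    (hx : (l : ℤ) ∣ x) : ¬ (l : ℤ) ∣ y := by
  intro hy
  have hu := h l (mul_dvd_mul hx hy)
  rw [Int.isUnit_iff] at hu
  have := hl.two_le
  omega

theorem Admissible.not_dvd_left (h : Admissible A B C) (hl : l.Prime) (hA : (l : ℤ) ∣ A) :
    ¬ (l : ℤ) ∣ B * C :=
  not_dvd_of_squarefree_mul (by rw [← mul_assoc]; exact h.sqf) hl hA

theorem Admissible.not_dvd_middle (h : Admissible A B C) (hl : l.Prime) (hB : (l : ℤ) ∣ B) :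
    ¬ (l : ℤ) ∣ A * C :=
  not_dvd_of_squarefree_mul (by convert h.sqf using 1; ring) hl hB

theorem Admissible.not_dvd_right (h : Admissible A B C) (hl : l.Prime) (hC : (l : ℤ) ∣ C) :
    ¬ (l : ℤ) ∣ A * B :=
  not_dvd_of_squarefree_mul (by convert h.sqf using 1; ring) hl hC

theorem Admissible.localSymbol_left (hA : (l : ℤ) ∣ A) :
    localSymbol A B C l = jacobiSym (-(B * C)) l := if_pos hA

theorem Admissible.localSymbol_middle (h : Admissible A B C) (hl : l.Prime) (hB : (l : ℤ) ∣ B) :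
    localSymbol A B C l = jacobiSym (A * C) l := by
  have h1 : ¬ (l : ℤ) ∣ A := fun h1 => h.not_dvd_middle hl hB (h1.mul_right _)
  rw [localSymbol, if_neg h1, if_pos hB]

theorem Admissible.localSymbol_right (h : Admissible A B C) (hl : l.Prime) (hC : (l : ℤ) ∣ C) :
    localSymbol A B C l = jacobiSym (A * B) l := by
  have h1 : ¬ (l : ℤ) ∣ A := fun h1 => h.not_dvd_right hl hC (h1.mul_right _)
  have h2 : ¬ (l : ℤ) ∣ B := fun h1 => h.not_dvd_right hl hC (h1.mul_left _)
  rw [localSymbol, if_neg h1, if_neg h2, if_pos hC]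

theorem jacobiSym_sq_of_not_dvd {a : ℤ} (hl : l.Prime) (ha : ¬ (l : ℤ) ∣ a) :
    jacobiSym a l ^ 2 = 1 := by
  refine jacobiSym.sq_one ?_
  rw [Int.gcd_comm, Int.gcd_eq_natAbs, Int.natAbs_natCast]
  refine (Nat.Prime.coprime_iff_not_dvd hl).2 fun hd => ha ?_
  exact Int.natCast_dvd.2 hd

theorem not_dvd_of_jacobiSym_sq {a : ℤ} (hl : l.Prime) (ha : jacobiSym a l ^ 2 = 1) :
    ¬ (l : ℤ) ∣ a := by
  intro hd
  have h0 : jacobiSym a l = 0 := by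
    have : Fact l.Prime := ⟨hl⟩
    rw [← jacobiSym.legendreSym.to_jacobiSym]
    exact (legendreSym.eq_zero_iff _ _).2 ((ZMod.intCast_zmod_eq_zero_iff_dvd _ _).2 hd)
  rw [h0] at ha
  norm_num at ha

theorem isSquare_of_jacobiSym_eq_one {a : ℤ} (hl : l.Prime) (ha : jacobiSym a l = 1) :
    IsSquare ((a : ℤ) : ZMod l) :=
  have : Fact l.Prime := ⟨hl⟩
  ZMod.isSquare_of_jacobiSym_eq_one ha

theorem isSquare_of_dvd_sub {a b : ℤ} (h : (l : ℤ) ∣ a - b ^ 2) : IsSquare ((a : ℤ) : ZMod l) := by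
  refine ⟨(b : ZMod l), ?_⟩
  have := (ZMod.intCast_eq_intCast_iff_dvd_sub _ _ _).2 h
  rw [← this]
  push_cast
  ring

theorem Admissible.localSymbol_sq (h : Admissible A B C) (hl : l.Prime)
    (hd : (l : ℤ) ∣ A * B * C) : localSymbol A B C l ^ 2 = 1 := by
  have hlp := Nat.prime_iff_prime_int.1 hl
  rcases hlp.dvd_or_dvd hd with hd | hC
  · rcases hlp.dvd_or_dvd hd with hA | hB
    · rw [Admissible.localSymbol_left hA]
      exact jacobiSym_sq_of_not_dvd hl (by rw [dvd_neg]; exact h.not_dvd_left hl hA)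
    · rw [h.localSymbol_middle hl hB]
      exact jacobiSym_sq_of_not_dvd hl (h.not_dvd_middle hl hB)
  · rw [h.localSymbol_right hl hC]
    exact jacobiSym_sq_of_not_dvd hl (h.not_dvd_right hl hC)

theorem Admissible.localSymbol_eq_one_of_ne (h : Admissible A B C) (hl : l.Prime)
    (hd : (l : ℤ) ∣ A * B * C) (hne : localSymbol A B C l ≠ -1) : localSymbol A B C l = 1 :=
  (mul_self_eq_one_iff.1 (by rw [← sq]; exact h.localSymbol_sq hl hd)).resolve_right hne

end LocalSymbol

/-! ### Representation of squarefree discriminants -/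

/-- A ternary form `m x² + n y² - (mn/A²) z²` represents `d` as soon as two conics have points. -/
theorem represents_of_conics {A B C w d : ℤ} (h : Admissible A B C) (hw : w ≠ 0)
    (h1 : ∃ x y z : ℤ, ¬ (x = 0 ∧ y = 0 ∧ z = 0) ∧ A * x ^ 2 - B * y ^ 2 = w * z ^ 2)
    (h2 : ∃ x y z : ℤ, ¬ (x = 0 ∧ y = 0 ∧ z = 0) ∧ A * B * x ^ 2 + C * w * y ^ 2 = d * z ^ 2) :
    ∃ x y z : ℚ, A * B * x ^ 2 + A * C * y ^ 2 - B * C * z ^ 2 = d := by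
  have h0 := h.sqf.ne_zero
  have hA : (A : ℚ) ≠ 0 := by exact_mod_cast left_ne_zero_of_mul (left_ne_zero_of_mul h0)
  have hB : (B : ℚ) ≠ 0 := by exact_mod_cast right_ne_zero_of_mul (left_ne_zero_of_mul h0)
  have hC : (C : ℚ) ≠ 0 := by exact_mod_cast right_ne_zero_of_mul h0
  obtain ⟨x, y, z, hne, h1⟩ := h1
  -- A solution with `z = 0` would make `AB` a square, whereas `AB` is `-1` or `2` modulo `4`.
  have hz : z ≠ 0 := by
    rintro rfl
    have hy : y ≠ 0 := by
      rintro rfl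
      have : A * x ^ 2 = 0 := by linarith
      have hx : x = 0 := by
        have hA' : A ≠ 0 := by exact_mod_cast hA
        simpa [hA'] using this
      exact hne ⟨hx, rfl, rfl⟩
    have hsq : IsSquare (A * B) := by
      rw [← Rat.isSquare_intCast_iff]
      refine ⟨A * x / y, ?_⟩
      have h1' : (A : ℚ) * x ^ 2 - B * y ^ 2 = 0 := by exact_mod_cast (by simpa using h1)
      field_simp
      push_cast
      linear_combination -A * h1'
    obtain ⟨r, hr⟩ := hsq
    have hm := h.middle
    rw [hr] at hm
    rcases hm with hm | hm
    · nlinarith [mul_self_nonneg r]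
    · have h4 : r * r % 4 = 2 := by omega
      rcases Int.even_or_odd' r with ⟨k, rfl | rfl⟩
      · have : 2 * k * (2 * k) = 4 * (k * k) := by ring
        omega
      · have : (2 * k + 1) * (2 * k + 1) = 4 * (k * k + k) + 1 := by ring
        omega
  have h1' : (A : ℚ) * x ^ 2 - B * y ^ 2 = w * z ^ 2 := by exact_mod_cast h1
  have h3 : ∃ X Y : ℚ, A * B * X ^ 2 + C * w * Y ^ 2 = d := by
    obtain ⟨u, v, t, hne', h2⟩ := h2
    have h2' : (A : ℚ) * B * u ^ 2 + C * w * v ^ 2 = d * t ^ 2 := by exact_mod_cast h2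
    by_cases ht : t = 0
    · subst ht
      have hu : u ≠ 0 := by
        rintro rfl
        have : C * w * v ^ 2 = 0 := by linarith
        have hC' : C ≠ 0 := by exact_mod_cast hC
        have hv : v = 0 := by simpa [hC', hw] using this
        exact hne' ⟨rfl, hv, rfl⟩
      have huq : (u : ℚ) ≠ 0 := by exact_mod_cast hu
      have hvq : (v : ℚ) ≠ 0 := by
        rintro hv
        rw [hv] at h2'
        have : (A : ℚ) * B * u ^ 2 = 0 := by push_cast at h2'; linarith
        simp [hA, hB, huq] at this
      -- The binary form is isotropic, hence hyperbolic. With `Cw·(v/u)² = -AB` the value is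
      -- `((ABd+1)²-(ABd-1)²)/(4AB) = d`.
      refine ⟨(A * B * d + 1) / (2 * (A * B)), (A * B * d - 1) * v / (2 * (A * B) * u), ?_⟩
      have h2'' : (A : ℚ) * B * u ^ 2 + C * w * v ^ 2 = 0 := by push_cast at h2'; linarith
      field_simp
      linear_combination (A * B * d - 1) ^ 2 * h2''
    · have htq : (t : ℚ) ≠ 0 := by exact_mod_cast ht
      refine ⟨u / t, v / t, ?_⟩
      field_simp
      linear_combination h2'
  obtain ⟨X, Y, h3⟩ := h3
  -- The first conic expresses `w` as `A(x/z)²-B(y/z)²`, so `CwY²` becomes the last two terms of the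
  -- ternary form.
  refine ⟨X, Y * x / z, Y * y / z, ?_⟩
  rw [← h3]
  field_simp
  linear_combination C * Y ^ 2 * h1'

set_option maxHeartbeats 1000000 in
/-- The auxiliary prime `q` and small factor `e` such that `eq` is represented by the conics used
for representing `d`. -/
theorem Admissible.exists_auxiliary_prime {A B C d : ℤ} (h : Admissible A B C) (hd : Squarefree d)
    (hd8 : d % 8 = if RamifiedTwo A B C then 5 else 1) (hreal : RamifiedReal A B C → d < 0)
    (hodd : ∀ l : ℕ, l.Prime → l ≠ 2 → (l : ℤ) ∣ A * B * C →
      jacobiSym d l = localSymbol A B C l) :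
    ∃ (e : ℤ) (q : ℕ), q.Prime ∧ Squarefree (A * B * e * C * d * q) ∧
      (B < 0 → 0 < e) ∧ (0 < B → C * e < 0) ∧
      (∀ l : ℕ, l.Prime → l ≠ 2 → ¬ (l : ℤ) ∣ e) ∧
      (∀ l : ℕ, (l : ℤ) ∣ A → (l : ℤ) ∣ q + e * B) ∧
      (∀ l : ℕ, l.Prime → l ≠ 2 → (l : ℤ) ∣ B → (l : ℤ) ∣ q - e * A) ∧
      (∀ l : ℕ, (l : ℤ) ∣ d → (l : ℤ) ∣ q + e * (A * B * C)) ∧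
      jacobiSym (A * B) q = 1 ∧ jacobiSym d q = 1 := by
  obtain ⟨a, b, c, s, t, k, ha, hb, hc, hab, hac, hbc, hA, hB, hC, hk⟩ := h.exists_factor
  have hrec := h.reciprocity ha hb hc hab hac hbc hA hB hC hk
  have hd4 : d % 4 = 1 := by split_ifs at hd8 <;> omega
  set D := d.natAbs with hD
  have hDo : Odd D := by rw [hD, Int.natAbs_odd, Int.odd_iff]; omega
  have hd0 : d ≠ 0 := by rintro rfl; simp at hd4
  have hD0 : D ≠ 0 := by simpa [hD] using hd0
  have ha0 : a ≠ 0 := by rintro rfl; simp at ha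
  have hb0 : b ≠ 0 := by rintro rfl; simp at hb
  have hc0 : c ≠ 0 := by rintro rfl; simp at hc
  have hApos := h.pos
  have ne_two : ∀ {l n : ℕ}, Odd n → l ∣ n → l ≠ 2 := by
    rintro l n hn hl rfl
    exact (Nat.not_even_iff_odd.2 hn) (even_iff_two_dvd.2 hl)
  -- primes dividing the three coefficients
  have dA : ∀ {l : ℕ}, l ∣ a → (l : ℤ) ∣ A := fun hl => by rw [hA]; exact_mod_cast hl
  have dC : ∀ {l : ℕ}, l ∣ c → (l : ℤ) ∣ C := fun hl => by
    rw [hC]; exact Dvd.dvd.mul_left (by exact_mod_cast hl) _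
  have dB : ∀ {l : ℕ}, l.Prime → l ∣ b → (l : ℤ) ∣ B := by
    intro l hlp hl
    rcases hk with ⟨-, -, -, rfl, -⟩ | rfl
    · exact absurd (Nat.dvd_one.1 hl) hlp.ne_one
    · rw [one_mul] at hB
      rw [hB]
      exact Dvd.dvd.mul_left (by exact_mod_cast hl) _
  have bd : ∀ {l : ℕ}, l.Prime → l ≠ 2 → (l : ℤ) ∣ B → l ∣ b := by
    intro l hlp h2 hl
    have h1 : (l : ℤ) ∣ 2 * boolSign s * b := by rw [← hB]; exact hl.mul_left _
    have h3 := Int.natAbs_dvd_natAbs.2 h1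
    have h4 : (boolSign s).natAbs = 1 := by cases s <;> rfl
    simp only [Int.natAbs_mul, h4, Int.natAbs_natCast, mul_one] at h3
    rcases hlp.dvd_mul.1 h3 with h5 | h5
    · exact absurd ((Nat.prime_dvd_prime_iff_eq hlp Nat.prime_two).1 h5) h2
    · exact h5
  have ad : ∀ {l : ℕ}, (l : ℤ) ∣ A → l ∣ a := fun hl => by
    rw [hA] at hl; exact_mod_cast hl
  have cd : ∀ {l : ℕ}, (l : ℤ) ∣ C → l ∣ c := fun {l} hl => by
    have h3 := Int.natAbs_dvd_natAbs.2 hl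
    have h4 : (boolSign t).natAbs = 1 := by cases t <;> rfl
    simpa [hC, Int.natAbs_mul, h4] using h3
  -- the symbols of `d`
  have symA : ∀ l : ℕ, l.Prime → l ∣ a → jacobiSym d l = jacobiSym (-(B * C)) l := by
    intro l hl hd
    rw [hodd l hl (ne_two ha hd) (((dA hd).mul_right _).mul_right _),
      Admissible.localSymbol_left (dA hd)]
  have symB : ∀ l : ℕ, l.Prime → l ∣ b → jacobiSym d l = jacobiSym (A * C) l := by
    intro l hl hd
    rw [hodd l hl (ne_two hb hd) (((dB hl hd).mul_left _).mul_right _),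
      h.localSymbol_middle hl (dB hl hd)]
  have symC : ∀ l : ℕ, l.Prime → l ∣ c → jacobiSym d l = jacobiSym (A * B) l := by
    intro l hl hd
    rw [hodd l hl (ne_two hc hd) ((dC hd).mul_left _), h.localSymbol_right hl (dC hd)]
  have ndvd : ∀ l : ℕ, l.Prime → l ≠ 2 → (l : ℤ) ∣ A * B * C → ¬ (l : ℤ) ∣ d := by
    intro l hl h2 hd
    apply not_dvd_of_jacobiSym_sq hl
    rw [hodd l hl h2 hd]
    exact h.localSymbol_sq hl hd
  have cop : ∀ n : ℕ, Odd n → (∀ l : ℕ, l.Prime → l ∣ n → (l : ℤ) ∣ A * B * C) → n.Coprime D := by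
    intro n hn hl
    refine Nat.Coprime.symm (Nat.coprime_of_dvd fun l hlp h1 h2 => ?_)
    exact ndvd l hlp (ne_two hn h2) (hl l hlp h2) (Int.natCast_dvd.2 h1)
  have haD : a.Coprime D := cop a ha fun l _ hd => ((dA hd).mul_right _).mul_right _
  have hbD : b.Coprime D := cop b hb fun l hl hd => ((dB hl hd).mul_left _).mul_right _
  have hcD : c.Coprime D := cop c hc fun l _ hd => (dC hd).mul_left _
  have h8 : ∀ {n : ℕ}, Odd n → Nat.Coprime 8 n := fun hn => by
    rw [show 8 = 2 ^ 3 by norm_num]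
    exact Nat.Coprime.pow_left _ (Nat.coprime_two_left.2 hn)
  -- the auxiliary factor
  set σ : ℤ := if s then 1 else -boolSign t with hσ
  have hσ2 : σ * σ = 1 := by cases s <;> cases t <;> rfl
  -- The sign makes both conics solvable over the reals: `e > 0` when `B < 0`, and `Ce < 0` when `B
  -- > 0`. The factor `k` gives `eABC = ±2abc` in all cases, so that `(2/D)` appears in the symbol
  -- of `d` and accounts for ramification at `2`.
  set e : ℤ := σ * k with he
  have hkn : ∀ n : ℕ, Odd n → IsCoprime e n := by
    intro n hn
    have h1 : IsCoprime (2 : ℤ) n := by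
      exact_mod_cast Nat.isCoprime_iff_coprime.2 (Nat.coprime_two_left.2 hn)
    have h2 : IsCoprime k (n : ℤ) := by
      rcases hk with ⟨rfl, -⟩ | rfl
      · exact h1
      · exact isCoprime_one_left
    exact IsCoprime.mul_left ⟨σ, 0, by rw [hσ2]; ring⟩ h2
  have icop : ∀ {m n : ℕ}, m.Coprime n → IsCoprime (m : ℤ) (n : ℤ) :=
    fun h => Nat.isCoprime_iff_coprime.2 h
  have sgncop : ∀ (u : Bool) (n : ℤ), IsCoprime (boolSign u) n :=
    fun u n => ⟨boolSign u, 0, by rw [boolSign_mul_self]; ring⟩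
  have two_cop : ∀ {n : ℕ}, Odd n → IsCoprime (2 : ℤ) n := fun hn => by
    exact_mod_cast Nat.isCoprime_iff_coprime.2 (Nat.coprime_two_left.2 hn)
  have copB : ∀ n : ℕ, Odd n → b.Coprime n → IsCoprime B (n : ℤ) := by
    intro n hn hbn
    have : IsCoprime (k * B) (n : ℤ) := by
      rw [hB]
      exact ((two_cop hn).mul_left (sgncop s n)).mul_left (icop hbn)
    exact this.of_mul_left_right
  have copA : ∀ n : ℕ, a.Coprime n → IsCoprime A (n : ℤ) := fun n hn => by rw [hA]; exact icop hn
  have copC : ∀ n : ℕ, c.Coprime n → IsCoprime C (n : ℤ) := fun n hn => by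
    rw [hC]; exact (sgncop t n).mul_left (icop hn)
  -- Both choices are `1` modulo `4`, so reciprocity with `q` costs no sign; the choice modulo `8`
  -- fixes `(2/q)` so that `(AB/q) = 1`.
  set r8 : ℤ := if jacobiSym (-(e * B)) a * jacobiSym (e * A) b = 1 then 1 else 5 with hr8
  have c8 : IsCoprime r8 ((8 : ℕ) : ℤ) := by
    rw [hr8]
    split_ifs
    · exact isCoprime_one_left
    · exact ⟨5, -3, by norm_num⟩
  -- The residues modulo `a` and `b` solve the first conic locally there, and the residue modulo `D`
  -- solves the second. The lower bound keeps `q` away from all coefficients.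
  obtain ⟨q, hqN, hqp, q8, qa, qb, qD⟩ := exists_prime_of_congruences 8 a b D r8 (-(e * B)) (e * A)
    (-(e * (A * B * C))) (8 * a * b * c * D) (by norm_num) ha0 hb0 hD0 (h8 ha) (h8 hb) (h8 hDo)
    hab haD hbD c8 ((hkn a ha).mul_left (copB a ha hab.symm)).neg_left
    ((hkn b hb).mul_left (copA b hab))
    ((hkn D hDo).mul_left (((copA D haD).mul_left (copB D hDo hbD)).mul_left (copC D hcD))).neg_left
  have hq4 : q % 4 = 1 := by
    have : (q : ℤ) % 4 = 1 := by
      rw [hr8] at q8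
      split_ifs at q8 <;> omega
    omega
  have hqo : Odd q := Nat.odd_iff.2 (by omega)
  have hq2 : q ≠ 2 := by omega
  have hqbig : ∀ n : ℕ, n ∣ 8 * a * b * c * D → ¬ q ∣ n := by
    intro n hn hq
    have h1 := Nat.le_of_dvd (Nat.pos_of_ne_zero
      (by simp [ha0, hb0, hc0, hD0])) (hq.trans hn)
    omega
  have hqa : ¬ q ∣ a := hqbig a ⟨8 * b * c * D, by ring⟩
  have hqb : ¬ q ∣ b := hqbig b ⟨8 * a * c * D, by ring⟩
  have hqc : ¬ q ∣ c := hqbig c ⟨8 * a * b * D, by ring⟩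
  have hqD : ¬ q ∣ D := hqbig D ⟨8 * a * b * c, by ring⟩
  have hJq1 : jacobiSym (-1) q = 1 := by
    rw [jacobiSym_neg_one_eq hqo, if_pos (by omega)]
  have hJsgn : ∀ u : Bool, jacobiSym (boolSign u) q = 1 := by
    intro u; cases u
    · simp [boolSign]
    · simpa [boolSign] using hJq1
  -- `AB` is a square modulo `q`
  have hJm : jacobiSym (A * B) q = 1 := by
    have e1 : jacobiSym a q * jacobiSym b q = jacobiSym (-(e * B)) a * jacobiSym (e * A) b := by
      rw [jacobiSym.quadratic_reciprocity_one_mod_four' ha hq4,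
        jacobiSym.quadratic_reciprocity_one_mod_four' hb hq4, jacobiSym_congr qa,
        jacobiSym_congr qb]
    rcases hk with ⟨-, h1, h2, -, -⟩ | hk1
    · rw [h1, h2, one_mul, hJq1]
    · have e2 : A * B = 2 * boolSign s * a * b := by
        rw [hk1, one_mul] at hB
        rw [hA, hB]; ring
      rw [e2, jacobiSym.mul_left, jacobiSym.mul_left, jacobiSym.mul_left, hJsgn, mul_one,
        mul_assoc, e1, jacobiSym_two_eq hqo]
      have h1 : jacobiSym (-(e * B)) a ^ 2 = 1 := by
        refine jacobiSym.sq_one ?_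
        exact Int.isCoprime_iff_gcd_eq_one.1 ((hkn a ha).mul_left (copB a ha hab.symm)).neg_left
      have h2 : jacobiSym (e * A) b ^ 2 = 1 := by
        refine jacobiSym.sq_one ?_
        exact Int.isCoprime_iff_gcd_eq_one.1 ((hkn b hb).mul_left (copA b hab))
      have h3 : (jacobiSym (-(e * B)) a * jacobiSym (e * A) b) *
          (jacobiSym (-(e * B)) a * jacobiSym (e * A) b) = 1 := by
        linear_combination jacobiSym (e * A) b ^ 2 * h1 + h2
      rw [hr8] at q8
      rcases mul_self_eq_one_iff.1 h3 with h4 | h4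
      · rw [h4, if_pos rfl] at q8
        rw [h4, if_pos (by omega)]; rfl
      · rw [h4, if_neg (by norm_num)] at q8
        rw [h4, if_neg (by omega)]; rfl
  -- `d` is a square modulo `q`
  have hJd : jacobiSym d q = 1 := by
    rw [jacobiSym_natAbs_left hq4, ← hD, jacobiSym.quadratic_reciprocity_one_mod_four' hDo hq4,
      jacobiSym_congr qD]
    have e1 : -(e * (A * B * C)) = (-(σ * boolSign s * boolSign t)) * 2 * a * b * c := by
      rw [he]
      calc -(σ * k * (A * B * C)) = -(σ * (A * (k * B) * C)) := by ring
        _ = _ := by rw [hA, hB, hC]; ring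
    -- The sign is `-1` only when `B` and `C` are negative, i.e. at real ramification. Then `d < 0`
    -- and `d ≡ 1 mod 4`, so `D ≡ 3 mod 4`.
    have e2 : jacobiSym (-(σ * boolSign s * boolSign t)) D = if s ∧ t then -1 else 1 := by
      have e3 : -(σ * boolSign s * boolSign t) = boolSign (s && t) := by
        cases s <;> cases t <;> rfl
      rw [e3]
      cases hs : s <;> cases ht : t <;> simp only [boolSign, Bool.and_true, Bool.and_false,
        Bool.false_eq_true, if_false, if_true, jacobiSym.one_left, and_self, and_false, and_true]
      rw [jacobiSym_neg_one_eq hDo, if_neg]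
      have hr : RamifiedReal A B C := by
        constructor
        · have : k * B < 0 := by
            rw [hB, hs]; simp only [boolSign, if_true]
            have : 0 < b := Nat.pos_of_ne_zero hb0
            push_cast; omega
          have hB' : B < 0 := by rcases hk with ⟨rfl, -⟩ | rfl <;> omega
          exact mul_neg_of_pos_of_neg hApos hB'
        · refine mul_neg_of_pos_of_neg hApos ?_
          rw [hC, ht]; simp only [boolSign, if_true]
          have : 0 < c := Nat.pos_of_ne_zero hc0
          omega
      have := hreal hr
      omega
    have e4 : jacobiSym 2 D = if RamifiedTwo A B C then -1 else 1 := by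
      rw [jacobiSym_two_eq hDo]
      split_ifs at hd8 ⊢ <;> first | rfl | (exfalso; omega)
    -- The symbol is now the product of the local symbols of the algebra at `2`, at infinity and
    -- along `a`, `b`, `c`; it equals `1` by the product formula `hrec`.
    rw [e1, jacobiSym.mul_left, jacobiSym.mul_left, jacobiSym.mul_left, jacobiSym.mul_left, e2, e4,
      jacobiSym_natAbs_right hd4 ha, jacobiSym_natAbs_right hd4 hb, jacobiSym_natAbs_right hd4 hc,
      jacobiSym_congr_of_prime _ _ a ha0 symA, jacobiSym_congr_of_prime _ _ b hb0 symB,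
      jacobiSym_congr_of_prime _ _ c hc0 symC]
    calc _ = (if RamifiedTwo A B C then (-1 : ℤ) else 1) * (if s ∧ t then -1 else 1) *
        (jacobiSym (-(B * C)) a * jacobiSym (A * C) b * jacobiSym (A * B) c) := by ring
      _ = 1 := by rw [hrec]; split_ifs <;> norm_num
  -- squarefreeness
  have hqi := Nat.prime_iff_prime_int.1 hqp
  have hsq1 : Squarefree (A * B * e) := by
    rcases hk with ⟨hk2, h1, h2, -, -⟩ | hk1
    · have h3 : A * B * e = -(σ * 2) := by rw [he, h1, h2, hk2]; ring
      rw [h3]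
      have h4 : Squarefree (2 : ℤ) := Int.prime_two.squarefree
      rw [← Int.squarefree_natAbs] at h4 ⊢
      have h5 : σ.natAbs = 1 := by rw [hσ]; cases s <;> cases t <;> rfl
      simpa [Int.natAbs_mul, h5] using h4
    · have h4 : Squarefree (A * B) := h.sqf.squarefree_of_dvd (dvd_mul_right _ _)
      rw [he, hk1, mul_one]
      rw [← Int.squarefree_natAbs] at h4 ⊢
      have h5 : σ.natAbs = 1 := by rw [hσ]; cases s <;> cases t <;> rfl
      simpa [Int.natAbs_mul, h5] using h4
  have hqABC : ¬ (q : ℤ) ∣ A * B * C := by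
    intro h5
    rcases hqi.dvd_or_dvd h5 with h5 | h5
    · rcases hqi.dvd_or_dvd h5 with h5 | h5
      · exact hqa (ad h5)
      · exact hqb (bd hqp hq2 h5)
    · exact hqc (cd h5)
  have hnde : ∀ l : ℕ, l.Prime → l ≠ 2 → ¬ (l : ℤ) ∣ e := by
    intro l hl hl2 h1
    exact (Nat.prime_iff_prime_int.1 hl).not_isUnit
      ((hkn l (hl.odd_of_ne_two hl2)).isUnit_of_dvd' h1 dvd_rfl)
  have hqe : ¬ (q : ℤ) ∣ e := hnde q hqp hq2
  have sqf_mul : ∀ x y : ℤ, IsCoprime x y → Squarefree x → Squarefree y → Squarefree (x * y) :=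
    fun x y h1 h2 h3 => squarefree_mul_iff.2 ⟨h1.isRelPrime, h2, h3⟩
  have hC' : Squarefree C := h.sqf.squarefree_of_dvd (dvd_mul_left _ _)
  obtain ⟨u, hu⟩ := exists_boolSign_mul_natAbs d
  have hcd : ∀ x : ℤ, IsCoprime x D → IsCoprime x d := by
    intro x hx
    rw [hu]
    exact (sgncop u x).symm.mul_right hx
  have hABeC : Squarefree (A * B * e * C) := by
    refine sqf_mul _ _ ?_ hsq1 hC'
    have hx : IsCoprime (A * B * e) c :=
      ((copA c hac).mul_left (copB c hc hbc)).mul_left (hkn c hc)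
    rw [hC]
    exact (sgncop t _).symm.mul_right hx
  have hABeCd : Squarefree (A * B * e * C * d) :=
    sqf_mul _ _ (hcd _ ((((copA D haD).mul_left (copB D hDo hbD)).mul_left (hkn D hDo)).mul_left
      (copC D hcD))) hABeC hd
  have hqd : ¬ (q : ℤ) ∣ d := fun h1 => hqD (Int.natCast_dvd.1 h1)
  refine ⟨e, q, hqp, sqf_mul _ _ (IsCoprime.symm ?_) hABeCd hqi.squarefree, ?_, ?_, hnde, ?_, ?_,
    ?_, hJm, hJd⟩
  · refine (Prime.coprime_iff_not_dvd hqi).2 fun h1 => ?_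
    rcases hqi.dvd_or_dvd h1 with h1 | h1
    · have e1 : A * B * e * C = A * B * C * e := by ring
      rw [e1] at h1
      rcases hqi.dvd_or_dvd h1 with h1 | h1
      · exact hqABC h1
      · exact hqe h1
    · exact hqd h1
  · intro hB0
    have hs : s = true := by
      by_contra hs
      have hs' : s = false := by simpa using hs
      have : 0 < k * B := by
        rw [hB, hs']; simp only [boolSign]
        have : 0 < b := Nat.pos_of_ne_zero hb0
        simpa using this
      rcases hk with ⟨rfl, -⟩ | rfl <;> omega
    rw [he, hσ, if_pos hs]
    rcases hk with ⟨rfl, -⟩ | rfl <;> norm_num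
  · intro hB0
    have hs : s = false := by
      by_contra hs
      have hs' : s = true := by simpa using hs
      have : k * B < 0 := by
        rw [hB, hs']; simp only [boolSign]
        have : 0 < b := Nat.pos_of_ne_zero hb0
        simpa using this
      rcases hk with ⟨rfl, -⟩ | rfl <;> omega
    have hk1 : k = 1 := by
      rcases hk with ⟨-, -, h2, -⟩ | h2
      · omega
      · exact h2
    have e1 : C * e = -(c : ℤ) := by
      rw [he, hσ, hs, hk1, hC]
      simp only [Bool.false_eq_true, if_false, mul_one]
      calc boolSign t * c * -boolSign t = -(boolSign t * boolSign t * c) := by ring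
        _ = _ := by rw [boolSign_mul_self, one_mul]
    rw [e1]
    have : 0 < c := Nat.pos_of_ne_zero hc0
    omega
  · intro l hl
    rw [hA] at hl
    have := hl.trans qa
    rwa [sub_neg_eq_add] at this
  · intro l hlp hl2 hl
    have h1 : (l : ℤ) ∣ b := by exact_mod_cast bd hlp hl2 hl
    exact h1.trans qb
  · intro l hl
    have h1 : (l : ℤ) ∣ D := by rw [hD]; exact Int.dvd_natAbs.2 hl
    have := h1.trans qD
    rwa [sub_neg_eq_add] at this

/-- A discriminant `d` with the local behaviour of a splitting field of `(AB, AC)` is represented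
by the form `AB x² + AC y² - BC z²`. -/
theorem Admissible.represents {A B C d : ℤ} (h : Admissible A B C) (hd : Squarefree d)
    (hd8 : d % 8 = if RamifiedTwo A B C then 5 else 1) (hreal : RamifiedReal A B C → d < 0)
    (hodd : ∀ l : ℕ, l.Prime → l ≠ 2 → (l : ℤ) ∣ A * B * C →
      jacobiSym d l = localSymbol A B C l) :
    ∃ x y z : ℚ, A * B * x ^ 2 + A * C * y ^ 2 - B * C * z ^ 2 = d := by
  obtain ⟨e, q, hqp, hsq, hBneg, hBpos, hnde, qA, qB, qd, hJm, hJd⟩ :=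
    h.exists_auxiliary_prime hd hd8 hreal hodd
  have h0 := hsq.ne_zero
  have hq0 : (0 : ℤ) < q := by exact_mod_cast hqp.pos
  have hApos := h.pos
  have dvd_w : ∀ l : ℕ, l.Prime → l ≠ 2 → (l : ℤ) ∣ e * q → l = q := by
    intro l hl hl2 hd
    rcases (Nat.prime_iff_prime_int.1 hl).dvd_or_dvd hd with h1 | h1
    · exact absurd h1 (hnde l hl hl2)
    · exact (Nat.prime_dvd_prime_iff_eq hl hqp).1 (by exact_mod_cast h1)
  have sq_e : ∀ l : ℕ, l.Prime → l ≠ 2 → jacobiSym e l * jacobiSym e l = 1 := by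
    intro l hl hl2
    rw [← sq]
    exact jacobiSym_sq_of_not_dvd hl (hnde l hl hl2)
  have hw0 : e * q ≠ 0 := by
    refine mul_ne_zero ?_ hq0.ne'
    rintro rfl
    simp at h0
  refine represents_of_conics h hw0 ?_ ?_
  · suffices hL : ∃ x y z : ℤ, ¬ (x = 0 ∧ y = 0 ∧ z = 0) ∧
        A * x ^ 2 + -B * y ^ 2 + -(e * q) * z ^ 2 = 0 by
      obtain ⟨x, y, z, hne, hxyz⟩ := hL
      exact ⟨x, y, z, hne, by linear_combination hxyz⟩
    refine legendre _ _ _ ?_ ?_ ?_ ?_ ?_ ?_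
    · have e1 : A * -B * -(e * q) = A * B * e * q := by ring
      rw [e1]
      exact hsq.squarefree_of_dvd ⟨C * d, by ring⟩
    · rintro ⟨-, h1, h2⟩
      have := hBneg (by omega)
      have := mul_pos this hq0
      omega
    · rintro ⟨h1, -, -⟩
      omega
    · intro l hl hl2 hd
      obtain ⟨v, hv⟩ := qA l hd
      exact isSquare_of_dvd_sub (b := e * B) ⟨-(e * B) * v, by linear_combination -(e * B) * hv⟩
    · intro l hl hl2 hd
      obtain ⟨v, hv⟩ := qB l hl hl2 (by simpa using hd)
      exact isSquare_of_dvd_sub (b := e * A) ⟨e * A * v, by linear_combination e * A * hv⟩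
    · intro l hl hl2 hd
      obtain rfl := dvd_w l hl hl2 (by simpa using hd)
      exact isSquare_of_jacobiSym_eq_one hl (by rw [mul_neg, neg_neg]; exact hJm)
  · suffices hL : ∃ x y z : ℤ, ¬ (x = 0 ∧ y = 0 ∧ z = 0) ∧
        A * B * x ^ 2 + C * (e * q) * y ^ 2 + -d * z ^ 2 = 0 by
      obtain ⟨x, y, z, hne, hxyz⟩ := hL
      exact ⟨x, y, z, hne, by linear_combination hxyz⟩
    refine legendre _ _ _ ?_ ?_ ?_ ?_ ?_ ?_
    · have e1 : A * B * (C * (e * q)) * -d = -(A * B * e * C * d * q) := by ring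
      rw [e1]
      rw [← Int.squarefree_natAbs] at hsq ⊢
      rwa [Int.natAbs_neg]
    · rintro ⟨h1, h2, -⟩
      have h3 := hBpos (pos_of_mul_pos_right h1 hApos.le)
      have h4 := mul_neg_of_neg_of_pos h3 hq0
      have e1 : C * (e * q) = C * e * q := by ring
      omega
    · rintro ⟨h1, h2, h3⟩
      have hB1 : B < 0 := by
        by_contra hB1
        have := mul_nonneg hApos.le (not_lt.1 hB1)
        omega
      have h4 := mul_pos (hBneg hB1) hq0
      have h5 : C < 0 := by
        by_contra hC1
        have := mul_nonneg (not_lt.1 hC1) h4.le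
        omega
      have := hreal ⟨h1, mul_neg_of_pos_of_neg hApos h5⟩
      omega
    · intro l hl hl2 hd
      refine isSquare_of_jacobiSym_eq_one hl ?_
      have hsy := hodd l hl hl2 (hd.mul_right _)
      have hsq' := h.localSymbol_sq hl (hd.mul_right C)
      -- The residue of `q` turns this into `e²d` times the entry of the local symbol at `l`; as `d`
      -- has that same symbol, the product is a square.
      have e1 : -(C * (e * q) * -d) = C * e * q * d := by ring
      rw [e1]
      rcases (Nat.prime_iff_prime_int.1 hl).dvd_or_dvd hd with h1 | h1
      · obtain ⟨v, hv⟩ := qA l h1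
        have e2 : (l : ℤ) ∣ C * e * q * d - e * e * (-(B * C)) * d :=
          ⟨C * e * d * v, by linear_combination C * e * d * hv⟩
        rw [jacobiSym_congr e2, jacobiSym.mul_left, jacobiSym.mul_left, jacobiSym.mul_left,
          ← Admissible.localSymbol_left (B := B) (C := C) h1, hsy, sq_e l hl hl2]
        linear_combination hsq'
      · obtain ⟨v, hv⟩ := qB l hl hl2 h1
        have e2 : (l : ℤ) ∣ C * e * q * d - e * e * (A * C) * d :=
          ⟨C * e * d * v, by linear_combination C * e * d * hv⟩
        rw [jacobiSym_congr e2, jacobiSym.mul_left, jacobiSym.mul_left, jacobiSym.mul_left,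
          ← h.localSymbol_middle hl h1, hsy, sq_e l hl hl2]
        linear_combination hsq'
    · intro l hl hl2 hd
      refine isSquare_of_jacobiSym_eq_one hl ?_
      have e1 : -(-d * (A * B)) = d * (A * B) := by ring
      rw [e1, jacobiSym.mul_left]
      rcases (Nat.prime_iff_prime_int.1 hl).dvd_or_dvd hd with h1 | h1
      · have hsq' := h.localSymbol_sq hl (h1.mul_left (A * B))
        rw [← h.localSymbol_right hl h1, hodd l hl hl2 (h1.mul_left _), ← sq, hsq']
      · obtain rfl := dvd_w l hl hl2 h1
        rw [hJm, hJd, one_mul]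
    · intro l hl hl2 hd
      obtain ⟨v, hv⟩ := qd l (by simpa using hd)
      exact isSquare_of_dvd_sub (b := e * (A * B * C))
        ⟨-(e * (A * B * C)) * v, by linear_combination -(e * (A * B * C)) * hv⟩

/-! ### From squarefree to arbitrary discriminants -/

theorem exists_squarefree_mul_sq (D : ℤ) (hD : D ≠ 0) :
    ∃ d f : ℤ, D = d * f ^ 2 ∧ Squarefree d ∧ f ≠ 0 := by
  obtain ⟨a, b, hab, ha⟩ := Nat.sq_mul_squarefree D.natAbs
  obtain ⟨s, hs⟩ := exists_boolSign_mul_natAbs D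
  refine ⟨boolSign s * a, b, ?_, ?_, ?_⟩
  · rw [hs, ← hab]; push_cast; ring
  · rw [← Int.squarefree_natAbs, Int.natAbs_mul]
    have : (boolSign s).natAbs = 1 := by cases s <;> rfl
    simpa [this] using ha
  · rintro h
    have : b = 0 := by exact_mod_cast h
    subst this
    simp at hab
    omega

/-- The part prime to `l` of a number of even valuation, compared with its squarefree kernel. -/
theorem exists_sq_mul_eq_of_pow_sq_mul {l : ℕ} (hl : l.Prime) {d f w : ℤ} {k : ℕ}
    (hd : Squarefree d) (hf : f ≠ 0) (hw : ¬ (l : ℤ) ∣ w) (h : d * f ^ 2 = ((l : ℤ) ^ k) ^ 2 * w) :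
    ∃ g : ℤ, d * g ^ 2 = w := by
  have hli := Nat.prime_iff_prime_int.1 hl
  have hl0 : (l : ℤ) ≠ 0 := hli.ne_zero
  obtain ⟨j, g, hg, rfl⟩ : ∃ (j : ℕ) (g : ℤ), ¬ (l : ℤ) ∣ g ∧ f = (l : ℤ) ^ j * g := by
    have hfin : FiniteMultiplicity (l : ℤ) f := Int.finiteMultiplicity_iff.2
      ⟨by simpa using hl.ne_one, hf⟩
    obtain ⟨g, h1, h2⟩ := hfin.exists_eq_pow_mul_and_not_dvd
    exact ⟨_, g, h2, h1⟩
  have hlg : IsCoprime (l : ℤ) g := (Prime.coprime_iff_not_dvd hli).2 hg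
  rcases lt_trichotomy j k with hjk | rfl | hjk
  · exfalso
    obtain ⟨i, rfl⟩ := Nat.exists_eq_add_of_lt hjk
    have h1 : d * g ^ 2 = (l : ℤ) * l * (((l : ℤ) ^ i) ^ 2 * w) := by
      have h2 : ((l : ℤ) ^ j) ^ 2 * (d * g ^ 2) =
          ((l : ℤ) ^ j) ^ 2 * ((l : ℤ) * l * (((l : ℤ) ^ i) ^ 2 * w)) := by
        rw [show ((l : ℤ) ^ j) ^ 2 * (d * g ^ 2) = d * ((l : ℤ) ^ j * g) ^ 2 by ring, h]
        ring
      exact mul_left_cancel₀ (pow_ne_zero _ (pow_ne_zero _ hl0)) h2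
    have h2 : (l : ℤ) * l ∣ d :=
      ((hlg.pow_right (n := 2)).mul_left (hlg.pow_right (n := 2))).dvd_of_dvd_mul_right
        ⟨_, h1⟩
    exact hli.not_isUnit (hd _ h2)
  · refine ⟨g, mul_left_cancel₀ (pow_ne_zero 2 (pow_ne_zero j hl0)) ?_⟩
    rw [← h]; ring
  · exfalso
    obtain ⟨i, rfl⟩ := Nat.exists_eq_add_of_lt hjk
    apply hw
    refine ⟨l * (((l : ℤ) ^ i) ^ 2 * (d * g ^ 2)), ?_⟩
    refine mul_left_cancel₀ (pow_ne_zero 2 (pow_ne_zero k hl0)) ?_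
    rw [← h]; ring

theorem sq_emod_eight {g : ℤ} (hg : g % 2 = 1) : g ^ 2 % 8 = 1 := by
  have : g % 8 = 1 ∨ g % 8 = 3 ∨ g % 8 = 5 ∨ g % 8 = 7 := by omega
  rcases this with h | h | h | h <;> simp [sq, Int.mul_emod, h]

theorem jacobiSym_eq_neg_one_iff {l : ℕ} (hl : l.Prime) (a : ℤ) :
    jacobiSym a l = -1 ↔ ¬ IsSquare ((a : ℤ) : ZMod l) := by
  have : Fact l.Prime := ⟨hl⟩
  rw [← jacobiSym.legendreSym.to_jacobiSym]
  exact legendreSym.eq_neg_one_iff l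

/-- Local conditions for an arbitrary nonzero integer to be represented. -/
theorem Admissible.represents_of_local {A B C D : ℤ} (h : Admissible A B C)
    (h2 : ∃ (k : ℕ) (w : ℤ), D = ((2 : ℕ) ^ k : ℤ) ^ 2 * w ∧
      w % 8 = if RamifiedTwo A B C then 5 else 1)
    (hreal : RamifiedReal A B C → D < 0)
    (hodd : ∀ l : ℕ, l.Prime → l ≠ 2 → (l : ℤ) ∣ A * B * C →
      ∃ (k : ℕ) (w : ℤ), D = ((l : ℤ) ^ k) ^ 2 * w ∧ jacobiSym w l = localSymbol A B C l) :
    ∃ x y z : ℚ, A * B * x ^ 2 + A * C * y ^ 2 - B * C * z ^ 2 = D := by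
  have hD0 : D ≠ 0 := by
    rintro rfl
    obtain ⟨k, w, h1, h3⟩ := h2
    have : w = 0 := by simpa using h1.symm
    rw [this] at h3
    split_ifs at h3 <;> simp at h3
  obtain ⟨d, f, rfl, hd, hf⟩ := exists_squarefree_mul_sq D hD0
  suffices hR : ∃ x y z : ℚ, A * B * x ^ 2 + A * C * y ^ 2 - B * C * z ^ 2 = d by
    obtain ⟨x, y, z, hxyz⟩ := hR
    exact ⟨f * x, f * y, f * z, by push_cast; rw [← hxyz]; ring⟩
  refine h.represents hd ?_ ?_ ?_
  · obtain ⟨k, w, h1, h3⟩ := h2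
    have hwo : ¬ ((2 : ℕ) : ℤ) ∣ w := by split_ifs at h3 <;> omega
    obtain ⟨g, hg⟩ := exists_sq_mul_eq_of_pow_sq_mul Nat.prime_two hd hf hwo h1
    rw [← h3, ← hg]
    have hgo : g % 2 = 1 := by
      by_contra hg2
      obtain ⟨j, rfl⟩ : ∃ j, g = 2 * j := ⟨g / 2, by omega⟩
      exact hwo ⟨d * (2 * j ^ 2), by rw [← hg]; push_cast; ring⟩
    have h5 : g ^ 2 % 8 = 1 := sq_emod_eight hgo
    rw [Int.mul_emod, h5, mul_one, Int.emod_emod_of_dvd _ dvd_rfl]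
  · intro hr
    have := hreal hr
    by_contra hd'
    nlinarith [mul_nonneg (not_lt.1 hd') (sq_nonneg f)]
  · intro l hl hl2 hdv
    obtain ⟨k, w, h1, h3⟩ := hodd l hl hl2 hdv
    have hwl : ¬ (l : ℤ) ∣ w :=
      not_dvd_of_jacobiSym_sq hl (by rw [h3]; exact h.localSymbol_sq hl hdv)
    obtain ⟨g, hg⟩ := exists_sq_mul_eq_of_pow_sq_mul hl hd hf hwl h1
    have hgl : ¬ (l : ℤ) ∣ g := fun h4 => hwl (by
      rw [← hg]; exact (h4.pow two_ne_zero).mul_left _)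
    rw [← h3, ← hg, jacobiSym.mul_left, jacobiSym.pow_left, jacobiSym_sq_of_not_dvd hl hgl, mul_one]

/-! ### Counting points on a conic over a finite field -/

section Counting

variable {F : Type*} [Field F] [Fintype F] [DecidableEq F]

open Classical in
-- The hyperbola `v²-w²=c²` is parametrised by `u = v+w`, with `v = (u+c²/u)/2`. A value `v ≠ ±c`
-- counted here has the two preimages `v ± w`, none of them in `{0, c, -c}`, so `2(|Q|-2) ≤ |F|-3`.
theorem card_isSquare_sq_sub_sq_le (h2 : (2 : F) ≠ 0) {c : F} (hc : c ≠ 0) :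
    2 * (Finset.univ.filter fun v : F => IsSquare (v ^ 2 - c ^ 2)).card ≤ Fintype.card F + 1 := by
  set Q := Finset.univ.filter fun v : F => IsSquare (v ^ 2 - c ^ 2) with hQ
  have hcc : c ≠ -c := by
    intro h
    have : 2 * c = 0 := by linear_combination h
    rcases mul_eq_zero.1 this with h | h
    · exact h2 h
    · exact hc h
  set E : Finset F := {0, c, -c} with hE
  have hEc : E.card = 3 := by
    rw [hE, Finset.card_insert_of_notMem, Finset.card_pair hcc]
    simp [hc.symm, hc]
  set f : F → F := fun u => (u + c ^ 2 / u) / 2 with hf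
  set T := Q \ {c, -c} with hT
  have h1 : 2 * T.card ≤ ((Finset.univ \ E).filter fun u => f u ∈ T).card := by
    refine Finset.mul_card_image_le_card_of_maps_to (f := f) ?_ 2 ?_
    · intro u hu
      exact (Finset.mem_filter.1 hu).2
    · intro v hv
      have hv' := hv
      rw [hT, Finset.mem_sdiff, hQ, Finset.mem_filter] at hv
      obtain ⟨⟨-, w, hw⟩, hvc⟩ := hv
      simp only [Finset.mem_insert, Finset.mem_singleton, not_or] at hvc
      have hw0 : w ≠ 0 := by
        rintro rfl
        have : (v - c) * (v + c) = 0 := by linear_combination hw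
        rcases mul_eq_zero.1 this with h | h
        · exact hvc.1 (sub_eq_zero.1 h)
        · exact hvc.2 (eq_neg_of_add_eq_zero_left h)
      have key : ∀ w : F, w ≠ 0 → v ^ 2 - c ^ 2 = w * w →
          v + w ∈ ((Finset.univ \ E).filter fun u => f u ∈ T).filter fun u => f u = v := by
        intro w hw0 hw
        have hprod : (v + w) * (v - w) = c ^ 2 := by linear_combination hw
        have hne : v + w ≠ 0 := by
          intro h
          rw [h, zero_mul] at hprod
          exact pow_ne_zero 2 hc hprod.symm
        have hfv : f (v + w) = v := by
          simp only [hf]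
          rw [← hprod]
          field_simp
          ring
        have hE' : v + w ∉ E := by
          simp only [hE, Finset.mem_insert, Finset.mem_singleton, not_or]
          refine ⟨hne, fun h => ?_, fun h => ?_⟩
          · rw [h] at hprod
            have h3 : v - w = c := mul_left_cancel₀ hc (by rw [hprod, sq])
            have : 2 * w = 0 := by linear_combination h - h3
            rcases mul_eq_zero.1 this with h | h
            · exact h2 h
            · exact hw0 h
          · rw [h] at hprod
            have h3 : v - w = -c := mul_left_cancel₀ (neg_ne_zero.2 hc) (by rw [hprod]; ring)
            have : 2 * w = 0 := by linear_combination h - h3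
            rcases mul_eq_zero.1 this with h | h
            · exact h2 h
            · exact hw0 h
        simp only [Finset.mem_filter, Finset.mem_sdiff, Finset.mem_univ, true_and]
        exact ⟨⟨hE', by rw [hfv]; exact hv'⟩, hfv⟩
      have hpair : ({v + w, v + -w} : Finset F).card = 2 := by
        refine Finset.card_pair fun h => ?_
        have : 2 * w = 0 := by linear_combination h
        rcases mul_eq_zero.1 this with h | h
        · exact h2 h
        · exact hw0 h
      rw [← hpair]
      refine Finset.card_le_card fun u hu => ?_
      simp only [Finset.mem_insert, Finset.mem_singleton] at hu
      rcases hu with rfl | rfl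
      · exact key w hw0 hw
      · exact key (-w) (neg_ne_zero.2 hw0) (by rw [hw]; ring)
  have h3 : ((Finset.univ \ E).filter fun u => f u ∈ T).card ≤ Fintype.card F - 3 := by
    refine (Finset.card_filter_le _ _).trans ?_
    rw [Finset.card_sdiff_of_subset (Finset.subset_univ _), hEc, Finset.card_univ]
  have h4 : Q.card ≤ T.card + 2 := by
    have := Finset.card_le_card_sdiff_add_card (s := Q) (t := {c, -c})
    rwa [Finset.card_pair hcc] at this
  have h5 : 3 ≤ Fintype.card F := by
    rw [← hEc, ← Finset.card_univ]
    exact Finset.card_le_card (Finset.subset_univ _)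
  omega

/-- Every element is a sum of two elements `v` that are `c` or have `v² - c²` a nonsquare. -/
theorem exists_add_eq_of_not_isSquare (h2 : (2 : F) ≠ 0) {c : F} (hc : c ≠ 0) (t : F) :
    ∃ v, (v = c ∨ ¬ IsSquare (v ^ 2 - c ^ 2)) ∧ (t - v = c ∨ ¬ IsSquare ((t - v) ^ 2 - c ^ 2)) := by
  classical
  set Q := Finset.univ.filter fun v : F => IsSquare (v ^ 2 - c ^ 2) with hQ
  have hcard := card_isSquare_sq_sub_sq_le h2 hc
  -- Adding `c` to the nonsquare values gives `2|V| ≥ |F|+1`, just enough for `V` and `t-V` to meet.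
  set V := insert c Qᶜ with hV
  have hcQ : c ∉ Qᶜ := by simp [hQ]
  have hVc : V.card = Fintype.card F - Q.card + 1 := by
    rw [hV, Finset.card_insert_of_notMem hcQ, Finset.card_compl]
  have himg : (V.image fun v => t - v).card = V.card :=
    Finset.card_image_of_injective _ sub_right_injective
  have hnd : ¬ Disjoint V (V.image fun v => t - v) := by
    intro hd
    have := Finset.card_union_of_disjoint hd
    have h3 := Finset.card_le_univ (V ∪ V.image fun v => t - v)
    rw [this, himg, hVc] at h3
    have hcard' : 2 * Q.card ≤ Fintype.card F + 1 := by convert hcard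
    omega
  rw [Finset.not_disjoint_iff] at hnd
  obtain ⟨v, hv, hv'⟩ := hnd
  rw [Finset.mem_image] at hv'
  obtain ⟨u, hu, rfl⟩ := hv'
  have mem : ∀ x, x ∈ V → x = c ∨ ¬ IsSquare (x ^ 2 - c ^ 2) := by
    intro x hx
    simpa [hV, hQ] using hx
  exact ⟨t - u, mem _ hv, by rw [sub_sub_cancel]; exact mem _ hu⟩

end Counting

/-! ### Local choices for the two traces -/

/-- `D` is a square times an `l`-adic unit of quadratic character `ε`. -/
def HasSymbol (l : ℕ) (ε D : ℤ) : Prop :=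
  ∃ (k : ℕ) (w : ℤ), D = ((l : ℤ) ^ k) ^ 2 * w ∧ jacobiSym w l = ε

/-- `D` is an even power of `2` times an integer that is `r` modulo `8`. -/
def HasResidueTwo (r D : ℤ) : Prop :=
  ∃ (k : ℕ) (w : ℤ), D = ((2 : ℕ) ^ k : ℤ) ^ 2 * w ∧ w % 8 = r

section OddPrime

variable {l : ℕ}

theorem intCast_congr {r r₀ : ℤ} (h : (l : ℤ) ∣ r - r₀) : (r : ZMod l) = r₀ :=
  ((ZMod.intCast_eq_intCast_iff_dvd_sub _ _ _).2 h).symm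

theorem hasSymbol_of_not_isSquare (hl : l.Prime) {D : ℤ} (h : ¬ IsSquare ((D : ℤ) : ZMod l)) :
    HasSymbol l (-1) D :=
  ⟨0, D, by simp, (jacobiSym_eq_neg_one_iff hl D).2 h⟩

/-- With `x = 2n+l²ω` one has `x²-4n² = l²ω(4n+l²ω)`, a square times a unit of the class of `nω`.
Thus the residue `2n`, where the discriminant vanishes modulo `l`, is usable after a refinement
modulo `l³`. -/
theorem hasSymbol_near_two_mul (hl : l.Prime) {n ω x : ℤ}
    (h2 : l ≠ 2) (hω : jacobiSym (n * ω) l = -1)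
    (hx : (l : ℤ) ^ 3 ∣ x - (2 * n + l ^ 2 * ω)) : HasSymbol l (-1) (x ^ 2 - 4 * n ^ 2) := by
  obtain ⟨j, hj⟩ := hx
  have hx : x = 2 * n + l ^ 2 * (ω + l * j) := by linear_combination hj
  refine ⟨1, (ω + l * j) * (4 * n + l ^ 2 * (ω + l * j)), by rw [hx]; ring, ?_⟩
  have h1 : (l : ℤ) ∣ (ω + l * j) * (4 * n + l ^ 2 * (ω + l * j)) - 2 ^ 2 * (n * ω) :=
    ⟨4 * n * j + l * (ω + l * j) ^ 2, by ring⟩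
  have h3 : ¬ (l : ℤ) ∣ 2 := by
    intro h
    exact h2 ((Nat.prime_dvd_prime_iff_eq hl Nat.prime_two).1 (by exact_mod_cast h))
  rw [jacobiSym_congr h1, jacobiSym.mul_left, jacobiSym.pow_left, jacobiSym_sq_of_not_dvd hl h3,
    one_mul, hω]

theorem exists_jacobiSym_mul_eq_neg_one (hl : l.Prime) (h2 : l ≠ 2) {n : ℤ}
    (hn : ¬ (l : ℤ) ∣ n) : ∃ ω : ℤ, jacobiSym (n * ω) l = -1 := by
  have : Fact l.Prime := ⟨hl⟩
  obtain ⟨a, ha⟩ := FiniteField.exists_nonsquare (F := ZMod l) (by rwa [ZMod.ringChar_zmod_n])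
  obtain ⟨a, rfl⟩ := ZMod.intCast_surjective a
  refine ⟨n * a, ?_⟩
  rw [← mul_assoc, jacobiSym.mul_left, jacobiSym.mul_left, ← sq, jacobiSym_sq_of_not_dvd hl hn,
    one_mul]
  exact (jacobiSym_eq_neg_one_iff hl a).2 ha

/-- The count gives `v` and `t-v`, each `2n` or of nonsquare discriminant. Only `v = t-v = 2n` is
troublesome, as `r` and `t-r` cannot both be refined independently. It forces `t ≡ 4n`; since only
`n²` matters one may pass to `-n`, and `t` is not congruent to both `4n` and `-4n`. -/
theorem exists_residue_inert (hl : l.Prime) (h2 : l ≠ 2) {n : ℤ} (hn : ¬ (l : ℤ) ∣ n) (t : ℤ) :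
    ∃ r₀ : ℤ, ∀ r : ℤ, (l : ℤ) ^ 3 ∣ r - r₀ →
      HasSymbol l (-1) (r ^ 2 - 4 * n ^ 2) ∧ HasSymbol l (-1) ((t - r) ^ 2 - 4 * n ^ 2) := by
  have : Fact l.Prime := ⟨hl⟩
  have hli := Nat.prime_iff_prime_int.1 hl
  have hl2 : ¬ (l : ℤ) ∣ 2 := by
    intro h
    exact h2 ((Nat.prime_dvd_prime_iff_eq hl Nat.prime_two).1 (by exact_mod_cast h))
  have key : ∀ n : ℤ, ¬ (l : ℤ) ∣ n → ¬ (l : ℤ) ∣ t - 4 * n → ∃ r₀ : ℤ, ∀ r : ℤ,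
      (l : ℤ) ^ 3 ∣ r - r₀ →
      HasSymbol l (-1) (r ^ 2 - 4 * n ^ 2) ∧ HasSymbol l (-1) ((t - r) ^ 2 - 4 * n ^ 2) := by
    intro n hn ht
    obtain ⟨ω, hω⟩ := exists_jacobiSym_mul_eq_neg_one hl h2 hn
    have h2' : (2 : ZMod l) ≠ 0 := by
      intro h
      exact hl2 ((ZMod.intCast_zmod_eq_zero_iff_dvd _ _).1 (by exact_mod_cast h))
    have hc : ((2 * n : ℤ) : ZMod l) ≠ 0 := by
      intro h
      rcases hli.dvd_or_dvd ((ZMod.intCast_zmod_eq_zero_iff_dvd _ _).1 h) with h | h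
      · exact hl2 h
      · exact hn h
    have hl3 : ∀ {y : ℤ}, (l : ℤ) ^ 3 ∣ y → (l : ℤ) ∣ y := fun h =>
      (dvd_pow_self _ three_ne_zero).trans h
    have nonsq : ∀ x : ℤ, ∀ v : ZMod l, (x : ZMod l) = v →
        ¬ IsSquare (v ^ 2 - ((2 * n : ℤ) : ZMod l) ^ 2) → HasSymbol l (-1) (x ^ 2 - 4 * n ^ 2) := by
      rintro x v rfl hv
      apply hasSymbol_of_not_isSquare hl
      convert hv using 1
      push_cast
      ring_nf
    obtain ⟨v, hv1, hv2⟩ := exists_add_eq_of_not_isSquare h2' hc (t : ZMod l)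
    obtain ⟨v, rfl⟩ := ZMod.intCast_surjective v
    rcases hv1 with hv1 | hv1
    · rcases hv2 with hv2 | hv2
      · exfalso
        apply ht
        rw [← ZMod.intCast_zmod_eq_zero_iff_dvd]
        push_cast at hv1 hv2 ⊢
        linear_combination hv2 + hv1
      · refine ⟨2 * n + l ^ 2 * ω, fun r hr => ⟨hasSymbol_near_two_mul hl h2 hω hr, ?_⟩⟩
        refine nonsq _ _ ?_ hv2
        have := intCast_congr (hl3 hr)
        push_cast at this ⊢
        rw [this, hv1]
        simp
    · rcases hv2 with hv2 | hv2
      · refine ⟨t - (2 * n + l ^ 2 * ω), fun r hr => ⟨nonsq _ _ ?_ hv1,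
          hasSymbol_near_two_mul hl h2 hω ?_⟩⟩
        · have := intCast_congr (hl3 hr)
          push_cast at this hv2 ⊢
          rw [this, ← hv2]
          simp
        · obtain ⟨j, hj⟩ := hr
          exact ⟨-j, by linear_combination -hj⟩
      · refine ⟨v, fun r hr => ⟨nonsq _ _ (intCast_congr (hl3 hr)) hv1, nonsq _ _ ?_ hv2⟩⟩
        have := intCast_congr (hl3 hr)
        push_cast
        rw [this]
  by_cases ht : (l : ℤ) ∣ t - 4 * n
  · obtain ⟨r₀, hr₀⟩ := key (-n) (by rwa [dvd_neg]) (by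
      intro h
      have h1 : (l : ℤ) ∣ 2 ^ 3 * n := by
        obtain ⟨i, hi⟩ := h
        obtain ⟨j, hj⟩ := ht
        exact ⟨i - j, by linear_combination hi - hj⟩
      rcases hli.dvd_or_dvd h1 with h1 | h1
      · exact hl2 (hli.dvd_of_dvd_pow h1)
      · exact hn h1)
    exact ⟨r₀, fun r hr => by simpa using hr₀ r hr⟩
  · exact key n hn ht

theorem hasSymbol_split {n r : ℤ} (hn : (l : ℤ) ∣ n)
    (hr : (l : ℤ) ∣ r ^ 2 - 1) : HasSymbol l 1 (r ^ 2 - 4 * n ^ 2) := by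
  refine ⟨0, r ^ 2 - 4 * n ^ 2, by simp, ?_⟩
  have h : (l : ℤ) ∣ r ^ 2 - 4 * n ^ 2 - 1 := by
    obtain ⟨a, ha⟩ := hn
    obtain ⟨b, hb⟩ := hr
    exact ⟨b - 4 * a * n, by linear_combination hb - 4 * n * ha⟩
  rw [jacobiSym_congr h, jacobiSym.one_left]

end OddPrime

theorem hasResidueTwo_five_of_odd {n r : ℤ} (hn : n % 2 = 1) (hr : r % 2 = 1) :
    HasResidueTwo 5 (r ^ 2 - 4 * n ^ 2) := by
  refine ⟨0, r ^ 2 - 4 * n ^ 2, by simp, ?_⟩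
  have h1 := sq_emod_eight hn
  have h2 := sq_emod_eight hr
  omega

/-- From `18²-4 = 8²·5`: an even numerator `r` can also give a discriminant in the unramified class
of `5`. -/
theorem hasResidueTwo_five_of_near {n r : ℤ} (hn : n % 2 = 1) (hr : (2 : ℤ) ^ 7 ∣ r - 18 * n) :
    HasResidueTwo 5 (r ^ 2 - 4 * n ^ 2) := by
  obtain ⟨j, hj⟩ := hr
  have hr : r = 18 * n + 128 * j := by linear_combination hj
  refine ⟨3, 5 * n ^ 2 + 8 * (9 * n * j + 32 * j ^ 2), by rw [hr]; push_cast; ring, ?_⟩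
  have h1 := sq_emod_eight hn
  omega

theorem hasResidueTwo_one {n r : ℤ} (hn : n % 2 = 0) (hr : r % 2 = 1) :
    HasResidueTwo 1 (r ^ 2 - 4 * n ^ 2) := by
  refine ⟨0, r ^ 2 - 4 * n ^ 2, by simp, ?_⟩
  obtain ⟨m, rfl⟩ : ∃ m, n = 2 * m := ⟨n / 2, by omega⟩
  have h2 := sq_emod_eight hr
  have e : (2 * m) ^ 2 = 4 * m ^ 2 := by ring
  omega

/-- For even `t` both `r` and `t-r` are taken odd; for odd `t` one of them is even and uses the
residue `18n`. -/
theorem exists_residue_inert_two {n : ℤ} (hn : n % 2 = 1) (t : ℤ) :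
    ∃ r₀ : ℤ, ∀ r : ℤ, (2 : ℤ) ^ 7 ∣ r - r₀ →
      HasResidueTwo 5 (r ^ 2 - 4 * n ^ 2) ∧ HasResidueTwo 5 ((t - r) ^ 2 - 4 * n ^ 2) := by
  by_cases ht : t % 2 = 0
  · refine ⟨1, fun r hr => ⟨hasResidueTwo_five_of_odd hn ?_, hasResidueTwo_five_of_odd hn ?_⟩⟩ <;>
    omega
  · refine ⟨18 * n, fun r hr => ⟨hasResidueTwo_five_of_near hn hr,
      hasResidueTwo_five_of_odd hn ?_⟩⟩
    omega

/-! ### The sets `T` are large -/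

theorem mem_Zloc_iff {l : ℕ} {x : ℚ} : x ∈ Zloc l ↔ ¬ l ∣ x.den := by
  constructor
  · rintro ⟨m, n, hn, hx⟩ hd
    apply hn
    have h1 : (x.den : ℤ) ∣ n := by
      rw [hx, ← Rat.divInt_eq_div]; exact Rat.den_dvd _ _
    exact (by exact_mod_cast hd : (l : ℤ) ∣ x.den).trans h1
  · intro h
    exact ⟨x.num, x.den, by exact_mod_cast h, by exact_mod_cast (Rat.num_div_den x).symm⟩

/-- The quaternion algebra `(AB, AC)` is ramified at the prime `l`. -/
def Ramified (A B C : ℤ) (l : ℕ) : Prop :=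
  l.Prime ∧ if l = 2 then RamifiedTwo A B C else localSymbol A B C l = -1

theorem Ramified.dvd {A B C : ℤ} {l : ℕ} (h : Ramified A B C l) :
    l ∣ (2 * (A * B * C)).natAbs := by
  rw [← Int.natCast_dvd]
  by_cases h2 : l = 2
  · rw [h2]; exact Dvd.intro _ rfl
  · have h1 := h.2
    rw [if_neg h2] at h1
    refine Dvd.dvd.mul_left ?_ _
    unfold localSymbol at h1
    split_ifs at h1 with h3 h4 h5
    · exact (h3.mul_right _).mul_right _
    · exact (h4.mul_left _).mul_right _
    · exact h5.mul_left _

/-- A pure quaternion of square `r²-4n²`, divided by `2n` and added to `r/(2n)`, has norm `1` and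
trace `r/n`. Rescaling the last coordinate by `A` replaces `AB·AC` by `BC`. -/
theorem mem_S_of_represents {A B C r n : ℤ} (hA : A ≠ 0) (hn : n ≠ 0)
    (h : ∃ x y z : ℚ, A * B * x ^ 2 + A * C * y ^ 2 - B * C * z ^ 2 =
      ((r ^ 2 - 4 * n ^ 2 : ℤ) : ℚ)) :
    (r / n : ℚ) ∈ S (A * B) (A * C) := by
  obtain ⟨x, y, z, h⟩ := h
  have hA' : (A : ℚ) ≠ 0 := by exact_mod_cast hA
  have hn' : (n : ℚ) ≠ 0 := by exact_mod_cast hn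
  refine ⟨r / (2 * n), x / (2 * n), y / (2 * n), z / (2 * n * A), ?_, by field_simp⟩
  push_cast at h
  field_simp
  linear_combination -h

/-- Sufficient size of `T`: local integrality at the ramified primes and a real bound. -/
theorem Admissible.mem_T {A B C : ℤ} (h : Admissible A B C) {t : ℚ}
    (ht : ∀ l, Ramified A B C l → t ∈ Zloc l) (hreal : RamifiedReal A B C → |t| ≤ 1) :
    t ∈ T (A * B) (A * C) := by
  classical
  have hABC := h.sqf.ne_zero
  have hA : A ≠ 0 := h.pos.ne'
  set bad := (2 * (A * B * C)).natAbs.primeFactors with hbad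
  have bad_prime : ∀ l ∈ bad, l.Prime := fun l hl => Nat.prime_of_mem_primeFactors hl
  have mem_bad : ∀ l : ℕ, l.Prime → (l = 2 ∨ (l : ℤ) ∣ A * B * C) → l ∈ bad := by
    intro l hl h1
    rw [hbad, Nat.mem_primeFactors]
    refine ⟨hl, ?_, by simpa [mul_assoc] using hABC⟩
    rw [← Int.natCast_dvd]
    rcases h1 with rfl | h1
    · exact Dvd.intro _ rfl
    · exact h1.mul_left _
  -- Enlarging numerator and denominator by the bad unramified primes allows `r ≡ 1` there: both
  -- discriminants become `1` modulo `l`, or modulo `8` if `l = 2`.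
  set N := ∏ l ∈ bad.filter (fun l => ¬ Ramified A B C l), l with hN
  -- The exponent `7` covers the precision needed at `2` and exceeds the exponent `3` needed at odd
  -- primes.
  set L := ∏ l ∈ bad, l ^ 7 with hL
  have dvdL : ∀ l ∈ bad, l ^ 7 ∣ L := fun l hl => Finset.dvd_prod_of_mem (fun l => l ^ 7) hl
  have hLpos : 0 < L := Finset.prod_pos fun l hl => pow_pos (bad_prime l hl).pos _
  have hNpos : 0 < N := Finset.prod_pos fun l hl =>
    (bad_prime l (Finset.mem_filter.1 hl).1).pos
  -- The factor `1+L` is prime to all bad primes and makes `n ≥ L > r`. Hence `r²-4n² < 0`, and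
  -- likewise for `t₀-r` when `|t₀| ≤ n`, as real ramification demands.
  set n : ℕ := t.den * N * (1 + L) with hn
  have hnL : L ≤ n := by
    have : 1 ≤ t.den * N := Nat.mul_pos t.den_pos hNpos
    nlinarith
  have hnpos : 0 < n := lt_of_lt_of_le hLpos hnL
  set t₀ : ℤ := t.num * N * (1 + L) with ht₀
  have htn : t = t₀ / n := by
    have h1 : ((t.den : ℚ)) ≠ 0 := by exact_mod_cast t.den_nz
    have h2 : (N : ℚ) ≠ 0 := by exact_mod_cast hNpos.ne'
    have h3 : (1 + L : ℚ) ≠ 0 := by positivity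
    rw [ht₀, hn]
    push_cast
    nth_rewrite 1 [← Rat.num_div_den t]
    field_simp
  have hram : ∀ l, Ramified A B C l → ¬ (l : ℤ) ∣ n := by
    intro l hl hd
    have hd : l ∣ n := by exact_mod_cast hd
    have hlb : l ∈ bad := by
      rw [hbad, Nat.mem_primeFactors]
      exact ⟨hl.1, hl.dvd, by simpa [mul_assoc] using hABC⟩
    rcases (Nat.Prime.dvd_mul hl.1).1 hd with hd | hd
    · rcases (Nat.Prime.dvd_mul hl.1).1 hd with hd | hd
      · exact (mem_Zloc_iff).1 (ht l hl) hd
      · obtain ⟨p, hp, hlp⟩ := (Prime.dvd_finsetProd_iff hl.1.prime _).1 hd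
        rw [Finset.mem_filter] at hp
        rw [Nat.prime_dvd_prime_iff_eq hl.1 (bad_prime p hp.1)] at hlp
        exact hp.2 (hlp ▸ hl)
    · have h1 : l ∣ L := (dvd_pow_self _ (by norm_num)).trans (dvdL l hlb)
      have := (Nat.dvd_add_left h1).1 hd
      exact hl.1.one_lt.ne' (Nat.dvd_one.1 this)
  have hunr : ∀ l ∈ bad, ¬ Ramified A B C l → (l : ℤ) ∣ n ∧ (l : ℤ) ∣ t₀ := by
    intro l hl hr
    have h1 : l ∣ N := Finset.dvd_prod_of_mem (fun l => l) (Finset.mem_filter.2 ⟨hl, hr⟩)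
    have h2 : (l : ℤ) ∣ N := by exact_mod_cast h1
    constructor
    · have : l ∣ n := (h1.mul_left _).mul_right _
      exact_mod_cast this
    · exact (h2.mul_left _).mul_right _
  -- the local requirement
  let Good : ℕ → ℤ → Prop := fun l D =>
    if l = 2 then HasResidueTwo (if RamifiedTwo A B C then 5 else 1) D
    else HasSymbol l (localSymbol A B C l) D
  have hloc : ∀ l ∈ bad, ∃ r₀ : ℤ, ∀ r : ℤ, (l : ℤ) ^ 7 ∣ r - r₀ →
      Good l (r ^ 2 - 4 * (n : ℤ) ^ 2) ∧ Good l ((t₀ - r) ^ 2 - 4 * (n : ℤ) ^ 2) := by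
    intro l hl
    have hlp := bad_prime l hl
    by_cases hr : Ramified A B C l
    · have hln := hram l hr
      by_cases h2 : l = 2
      · subst h2
        have hr2 : RamifiedTwo A B C := by simpa using hr.2
        obtain ⟨r₀, h0⟩ := exists_residue_inert_two (n := n) (by push_cast at hln; omega) t₀
        refine ⟨r₀, fun r hr => ?_⟩
        simp only [Good, if_true, if_pos hr2]
        exact h0 r (by exact_mod_cast hr)
      · have hrl : localSymbol A B C l = -1 := by simpa [h2] using hr.2
        obtain ⟨r₀, h0⟩ := exists_residue_inert hlp h2 hln t₀
        refine ⟨r₀, fun r hr => ?_⟩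
        simp only [Good, if_neg h2, hrl]
        exact h0 r ((pow_dvd_pow _ (by norm_num)).trans hr)
    · obtain ⟨hln, hlt⟩ := hunr l hl hr
      refine ⟨1, fun r hr1 => ?_⟩
      have hr1 : (l : ℤ) ∣ r - 1 := (dvd_pow_self _ (by norm_num)).trans hr1
      by_cases h2 : l = 2
      · subst h2
        have hr2 : ¬ RamifiedTwo A B C := fun h => hr ⟨hlp, by simpa using h⟩
        simp only [Good, if_true, if_neg hr2]
        push_cast at hln hlt hr1
        exact ⟨hasResidueTwo_one (by omega) (by omega), hasResidueTwo_one (by omega) (by omega)⟩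
      · have hne : localSymbol A B C l ≠ -1 := fun h => hr ⟨hlp, by simpa [h2] using h⟩
        have hd : (l : ℤ) ∣ A * B * C := by
          have h3 := (Nat.mem_primeFactors.1 hl).2.1
          rw [← Int.natCast_dvd] at h3
          rcases (Nat.prime_iff_prime_int.1 hlp).dvd_or_dvd h3 with h3 | h3
          · exact absurd ((Nat.prime_dvd_prime_iff_eq hlp Nat.prime_two).1 (by exact_mod_cast h3)) h2
          · exact h3
        have h1 := h.localSymbol_eq_one_of_ne hlp hd hne
        simp only [Good, if_neg h2, h1]
        obtain ⟨i, hi⟩ := hr1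
        obtain ⟨j, hj⟩ := hlt
        exact ⟨hasSymbol_split hln ⟨i * (r + 1), by linear_combination (r + 1) * hi⟩,
          hasSymbol_split hln ⟨i * (r + 1) + j * (t₀ - 2 * r),
            by linear_combination (r + 1) * hi + (t₀ - 2 * r) * hj⟩⟩
  choose! r₀ hr₀ using hloc
  have hcop : (↑bad : Set ℕ).Pairwise (Function.onFun Nat.Coprime fun l => l ^ 7) := by
    intro p hp q hq hpq
    exact Nat.Coprime.pow _ _ ((Nat.coprime_primes (bad_prime p hp) (bad_prime q hq)).2 hpq)
  have hs0 : ∀ l ∈ bad, l ^ 7 ≠ 0 := fun l hl => pow_ne_zero _ (bad_prime l hl).ne_zero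
  obtain ⟨r, hr⟩ : ∃ r : ℕ, r < L ∧ ∀ l ∈ bad, (l : ℤ) ^ 7 ∣ r - r₀ l := by
    refine ⟨Nat.chineseRemainderOfFinset (fun l => (r₀ l % (l ^ 7 : ℕ)).toNat) (fun l => l ^ 7) bad
      hs0 hcop, Nat.chineseRemainderOfFinset_lt_prod _ _ hs0 hcop, fun l hl => ?_⟩
    have h1 := (Nat.chineseRemainderOfFinset (fun l => (r₀ l % (l ^ 7 : ℕ)).toNat)
      (fun l => l ^ 7) bad hs0 hcop).2 l hl
    generalize ((Nat.chineseRemainderOfFinset (fun l => (r₀ l % (l ^ 7 : ℕ)).toNat)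
      (fun l => l ^ 7) bad hs0 hcop) : ℕ) = k at h1
    have h2 := (Nat.modEq_iff_dvd.1 h1)
    have h3 : (((r₀ l % (l ^ 7 : ℕ)).toNat : ℕ) : ℤ) = r₀ l % (l ^ 7 : ℕ) :=
      Int.toNat_of_nonneg (Int.emod_nonneg _ (by exact_mod_cast hs0 l hl))
    rw [h3] at h2
    have h4 : ((l ^ 7 : ℕ) : ℤ) ∣ r₀ l - k := by
      have := Int.mul_ediv_add_emod (r₀ l) (l ^ 7 : ℕ)
      have e : r₀ l - k = ((l ^ 7 : ℕ) : ℤ) * (r₀ l / (l ^ 7 : ℕ)) + (r₀ l % (l ^ 7 : ℕ) - k) := by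
        linear_combination -this
      rw [e]
      exact dvd_add (Dvd.intro _ rfl) h2
    rw [← dvd_neg, neg_sub]
    exact_mod_cast h4
  obtain ⟨hrL, hr⟩ := hr
  have hgood := fun l hl => hr₀ l hl r (hr l hl)
  have bound : RamifiedReal A B C → |t₀| ≤ n := by
    intro hR
    have h1 := hreal hR
    have hnq : (0 : ℚ) < n := by exact_mod_cast hnpos
    rw [htn, abs_div, abs_of_pos hnq, div_le_one hnq] at h1
    exact_mod_cast h1
  have h2b : 2 ∈ bad := mem_bad 2 Nat.prime_two (Or.inl rfl)
  have hn0 : (n : ℤ) ≠ 0 := by exact_mod_cast hnpos.ne'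
  have hrn : (r : ℤ) < n := by exact_mod_cast lt_of_lt_of_le hrL hnL
  have m1 : ((r : ℤ) / (n : ℤ) : ℚ) ∈ S (A * B) (A * C) := by
    refine mem_S_of_represents hA hn0 (h.represents_of_local ?_ ?_ ?_)
    · have := (hgood 2 h2b).1
      simp only [Good, if_true] at this
      exact this
    · intro _
      nlinarith
    · intro l hl hl2 hd
      have := (hgood l (mem_bad l hl (Or.inr hd))).1
      simp only [Good, if_neg hl2] at this
      exact this
  have m2 : (((t₀ - r : ℤ) : ℚ) / (n : ℤ) : ℚ) ∈ S (A * B) (A * C) := by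
    refine mem_S_of_represents hA hn0 (h.represents_of_local ?_ ?_ ?_)
    · have := (hgood 2 h2b).2
      simp only [Good, if_true] at this
      exact this
    · intro hR
      have := abs_le.1 (bound hR)
      nlinarith
    · intro l hl hl2 hd
      have := (hgood l (mem_bad l hl (Or.inr hd))).2
      simp only [Good, if_neg hl2] at this
      exact this
  rw [T, Set.mem_add]
  refine ⟨_, m1, _, m2, ?_⟩
  have hnq : (n : ℚ) ≠ 0 := by exact_mod_cast hnpos.ne'
  rw [htn]
  push_cast
  field_simp
  ring

/-! ### Integrality of traces at ramified primes -/

theorem exists_common_denominator (x₁ x₂ x₃ x₄ : ℚ) {l : ℕ} (hl : l.Prime) :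
    ∃ X₁ X₂ X₃ X₄ W : ℤ, W ≠ 0 ∧ x₁ = X₁ / W ∧ x₂ = X₂ / W ∧ x₃ = X₃ / W ∧ x₄ = X₄ / W ∧
      ¬ ((l : ℤ) ∣ X₁ ∧ (l : ℤ) ∣ X₂ ∧ (l : ℤ) ∣ X₃ ∧ (l : ℤ) ∣ X₄ ∧ (l : ℤ) ∣ W) := by
  classical
  let P : ℕ → Prop := fun W => W ≠ 0 ∧ ∃ X₁ X₂ X₃ X₄ : ℤ,
    x₁ = X₁ / W ∧ x₂ = X₂ / W ∧ x₃ = X₃ / W ∧ x₄ = X₄ / W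
  have hP : ∃ W, P W := by
    have h1 : (x₁.den : ℚ) ≠ 0 := by exact_mod_cast x₁.den_nz
    have h2 : (x₂.den : ℚ) ≠ 0 := by exact_mod_cast x₂.den_nz
    have h3 : (x₃.den : ℚ) ≠ 0 := by exact_mod_cast x₃.den_nz
    have h4 : (x₄.den : ℚ) ≠ 0 := by exact_mod_cast x₄.den_nz
    refine ⟨x₁.den * x₂.den * x₃.den * x₄.den, by simp, x₁.num * x₂.den * x₃.den * x₄.den,
      x₂.num * x₁.den * x₃.den * x₄.den, x₃.num * x₁.den * x₂.den * x₄.den,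
      x₄.num * x₁.den * x₂.den * x₃.den, ?_, ?_, ?_, ?_⟩
    · nth_rewrite 1 [← Rat.num_div_den x₁]; push_cast; field_simp
    · nth_rewrite 1 [← Rat.num_div_den x₂]; push_cast; field_simp
    · nth_rewrite 1 [← Rat.num_div_den x₃]; push_cast; field_simp
    · nth_rewrite 1 [← Rat.num_div_den x₄]; push_cast; field_simp
  obtain ⟨hW, X₁, X₂, X₃, X₄, h1, h2, h3, h4⟩ := Nat.find_spec hP
  refine ⟨X₁, X₂, X₃, X₄, (Nat.find hP : ℕ), by exact_mod_cast hW, by simpa using h1,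
    by simpa using h2, by simpa using h3, by simpa using h4, ?_⟩
  rintro ⟨⟨Y₁, rfl⟩, ⟨Y₂, rfl⟩, ⟨Y₃, rfl⟩, ⟨Y₄, rfl⟩, hd⟩
  obtain ⟨V, hV⟩ : l ∣ Nat.find hP := by exact_mod_cast hd
  have hV0 : V ≠ 0 := by rintro rfl; simp at hV; exact hW (by omega)
  have hl0 : (l : ℚ) ≠ 0 := by exact_mod_cast hl.ne_zero
  have hlt : V < Nat.find hP := by
    rw [hV]
    exact lt_mul_of_one_lt_left (Nat.pos_of_ne_zero hV0) hl.one_lt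
  refine Nat.find_min hP hlt ⟨hV0, Y₁, Y₂, Y₃, Y₄, ?_, ?_, ?_, ?_⟩
  · rw [h1, hV]; push_cast; exact mul_div_mul_left _ _ hl0
  · rw [h2, hV]; push_cast; exact mul_div_mul_left _ _ hl0
  · rw [h3, hV]; push_cast; exact mul_div_mul_left _ _ hl0
  · rw [h4, hV]; push_cast; exact mul_div_mul_left _ _ hl0

theorem dvd_of_sq_eq_nonsquare_mul {l : ℕ} (hl : l.Prime) {m : ℤ} (hm : jacobiSym m l = -1)
    {X Y : ℤ} (h : (l : ℤ) ∣ X ^ 2 - m * Y ^ 2) : (l : ℤ) ∣ X ∧ (l : ℤ) ∣ Y := by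
  have : Fact l.Prime := ⟨hl⟩
  have hns := (jacobiSym_eq_neg_one_iff hl m).1 hm
  rw [← ZMod.intCast_zmod_eq_zero_iff_dvd] at h
  push_cast at h
  have hY : (l : ℤ) ∣ Y := by
    by_contra hY
    rw [← ZMod.intCast_zmod_eq_zero_iff_dvd] at hY
    apply hns
    refine ⟨X / Y, ?_⟩
    field_simp
    linear_combination -h
  refine ⟨?_, hY⟩
  rw [← ZMod.intCast_zmod_eq_zero_iff_dvd] at hY
  rw [hY] at h
  have h1 : (X : ZMod l) ^ 2 = 0 := by linear_combination h
  rw [← ZMod.intCast_zmod_eq_zero_iff_dvd]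
  exact pow_eq_zero_iff two_ne_zero |>.1 h1

/-- Anisotropy of a norm form at an odd ramified prime. -/
theorem dvd_of_norm_form {l : ℕ} (hl : l.Prime) {m p q e : ℤ} (hm : jacobiSym m l = -1)
    (hpq : m = -(p * q)) (he : (l : ℤ) ∣ e) (he2 : ¬ (l : ℤ) * l ∣ e) {X Y Z V W : ℤ}
    (h : X ^ 2 - m * Y ^ 2 - e * (p * Z ^ 2 + q * V ^ 2) = W ^ 2) (hW : (l : ℤ) ∣ W) :
    (l : ℤ) ∣ X ∧ (l : ℤ) ∣ Y ∧ (l : ℤ) ∣ Z ∧ (l : ℤ) ∣ V := by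
  have hli := Nat.prime_iff_prime_int.1 hl
  obtain ⟨e, rfl⟩ := he
  obtain ⟨W, rfl⟩ := hW
  obtain ⟨hX, hY⟩ := dvd_of_sq_eq_nonsquare_mul hl hm (X := X) (Y := Y)
    ⟨e * (p * Z ^ 2 + q * V ^ 2) + l * W ^ 2, by linear_combination h⟩
  obtain ⟨X, rfl⟩ := hX
  obtain ⟨Y, rfl⟩ := hY
  have h1 : e * (p * Z ^ 2 + q * V ^ 2) = l * (X ^ 2 - m * Y ^ 2 - W ^ 2) := by
    refine mul_left_cancel₀ hli.ne_zero ?_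
    linear_combination -h
  have h2 : (l : ℤ) ∣ p * Z ^ 2 + q * V ^ 2 := by
    rcases hli.dvd_or_dvd (Dvd.intro _ h1.symm) with h2 | h2
    · exact absurd (mul_dvd_mul_left _ h2) he2
    · exact h2
  have hp : ¬ (l : ℤ) ∣ p := by
    intro hp
    refine not_dvd_of_jacobiSym_sq hl (a := m) (by rw [hm]; norm_num) ?_
    rw [hpq, dvd_neg]
    exact hp.mul_right _
  -- Multiplying `pZ²+qV²` by `p` gives `(pZ)²-mV²`.
  obtain ⟨hZ, hV⟩ := dvd_of_sq_eq_nonsquare_mul hl hm (X := p * Z) (Y := V) (by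
    obtain ⟨k, hk⟩ := h2
    exact ⟨p * k, by rw [hpq]; linear_combination p * hk⟩)
  exact ⟨Dvd.intro _ rfl, Dvd.intro _ rfl, (hli.dvd_or_dvd hZ).resolve_left hp, hV⟩

set_option maxRecDepth 100000 in
-- The pairs are the residues modulo `16` of `(AB, AC)` in the cases ramified at `2`, and `0, 1, 4,
-- 9` are the squares modulo `16`: anisotropy at `2` becomes a finite check.
theorem even_squares_finite : ∀ p ∈ ([(15, 3), (15, 7), (15, 11), (15, 15), (2, 3), (2, 5), (2, 11),
    (2, 13), (14, 5), (14, 7), (14, 13), (14, 15)] : List (ZMod 16 × ZMod 16)),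
    ∀ q₁ ∈ ([0, 1, 4, 9] : List (ZMod 16)), ∀ q₂ ∈ ([0, 1, 4, 9] : List (ZMod 16)),
    ∀ q₃ ∈ ([0, 1, 4, 9] : List (ZMod 16)), ∀ q₄ ∈ ([0, 1, 4, 9] : List (ZMod 16)),
      q₁ - p.1 * q₂ - p.2 * q₃ + p.1 * p.2 * q₄ = 0 →
      (q₁ = 0 ∨ q₁ = 4) ∧ (q₂ = 0 ∨ q₂ = 4) ∧ (q₃ = 0 ∨ q₃ = 4) ∧ (q₄ = 0 ∨ q₄ = 4) := by
  decide

/-- Here `c` plays the role of `BC`, which agrees with `AB·AC = A²BC` modulo `16`. The condition `4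
∣ W` makes the right side vanish modulo `16`. -/
theorem even_of_norm_form {m b c : ℤ}
    (h : (m % 16 = 15 ∧ b % 4 = 3) ∨ (m % 16 = 2 ∧ (b % 8 = 3 ∨ b % 8 = 5)) ∨
      (m % 16 = 14 ∧ (b % 8 = 5 ∨ b % 8 = 7)))
    (hc : (16 : ℤ) ∣ m * b - c) {X Y Z V W : ℤ}
    (hX : X ^ 2 - m * Y ^ 2 - b * Z ^ 2 + c * V ^ 2 = W ^ 2) (hW : (4 : ℤ) ∣ W) :
    (2 : ℤ) ∣ X ∧ (2 : ℤ) ∣ Y ∧ (2 : ℤ) ∣ Z ∧ (2 : ℤ) ∣ V := by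
  have sqs : ∀ x : ZMod 16, x ^ 2 ∈ ([0, 1, 4, 9] : List (ZMod 16)) := by decide
  have cast : ∀ (x : ℤ) (r : ℤ), x % 16 = r → (x : ZMod 16) = (r : ZMod 16) := by
    rintro x r rfl
    exact intCast_congr (l := 16) ⟨x / 16, by push_cast; linarith [Int.mul_ediv_add_emod x 16]⟩
  have h16 : ((c : ℤ) : ZMod 16) = m * b := by
    have := intCast_congr (l := 16) (r := m * b) (r₀ := c) (by exact_mod_cast hc)
    push_cast at this
    exact this.symm
  have hW0 : (W : ZMod 16) ^ 2 = 0 := by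
    obtain ⟨k, rfl⟩ := hW
    have h1 := (ZMod.intCast_zmod_eq_zero_iff_dvd ((4 * k) ^ 2) 16).2 ⟨k ^ 2, by push_cast; ring⟩
    exact_mod_cast h1
  have heq : (X : ZMod 16) ^ 2 - m * (Y : ZMod 16) ^ 2 - b * (Z : ZMod 16) ^ 2 +
      m * b * (V : ZMod 16) ^ 2 = 0 := by
    rw [← hW0, ← h16, ← Int.cast_pow W, ← hX]
    push_cast
    ring
  have hmb : ((m : ZMod 16), (b : ZMod 16)) ∈ ([(15, 3), (15, 7), (15, 11), (15, 15), (2, 3),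
      (2, 5), (2, 11), (2, 13), (14, 5), (14, 7), (14, 13), (14, 15)] :
        List (ZMod 16 × ZMod 16)) := by
    rcases h with ⟨h1, h2⟩ | ⟨h1, h2⟩ | ⟨h1, h2⟩
    · have : b % 16 = 3 ∨ b % 16 = 7 ∨ b % 16 = 11 ∨ b % 16 = 15 := by omega
      rcases this with h | h | h | h <;> rw [cast m _ h1, cast b _ h] <;> decide
    · have : b % 16 = 3 ∨ b % 16 = 5 ∨ b % 16 = 11 ∨ b % 16 = 13 := by omega
      rcases this with h | h | h | h <;> rw [cast m _ h1, cast b _ h] <;> decide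
    · have : b % 16 = 5 ∨ b % 16 = 7 ∨ b % 16 = 13 ∨ b % 16 = 15 := by omega
      rcases this with h | h | h | h <;> rw [cast m _ h1, cast b _ h] <;> decide
  obtain ⟨e1, e2, e3, e4⟩ := even_squares_finite _ hmb _ (sqs X) _ (sqs Y) _ (sqs Z) _ (sqs V) heq
  have even : ∀ x : ℤ, ((x : ZMod 16) ^ 2 = 0 ∨ (x : ZMod 16) ^ 2 = 4) → (2 : ℤ) ∣ x := by
    intro x hx
    have h4 : (2 : ℤ) ∣ x ^ 2 := by
      rcases hx with hx | hx
      · have h5 := (ZMod.intCast_zmod_eq_zero_iff_dvd (x ^ 2) 16).1 (by exact_mod_cast hx)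
        push_cast at h5
        omega
      · have h5 := (ZMod.intCast_eq_intCast_iff_dvd_sub 4 (x ^ 2) 16).1
          (by push_cast; exact hx.symm)
        push_cast at h5
        omega
    exact Int.prime_two.dvd_of_dvd_pow h4
  exact ⟨even X e1, even Y e2, even Z e3, even V e4⟩

/-- If `l` divided the primitive common denominator `W`, anisotropy would make `l` divide all
coordinates. At `2` the argument only excludes `4 ∣ W`, which suffices because the trace `2x₁`
absorbs one factor `2`. -/
theorem Admissible.S_subset_Zloc {A B C : ℤ} (h : Admissible A B C) {l : ℕ}
    (hl : Ramified A B C l) : S (A * B) (A * C) ⊆ Zloc l := by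
  rintro s ⟨x₁, x₂, x₃, x₄, hx, rfl⟩
  have hlp := hl.1
  have hli := Nat.prime_iff_prime_int.1 hlp
  obtain ⟨X₁, X₂, X₃, X₄, W, hW, h1, h2, h3, h4, hprim⟩ :=
    exists_common_denominator x₁ x₂ x₃ (A * x₄) hlp
  have hWq : (W : ℚ) ≠ 0 := by exact_mod_cast hW
  have heq : X₁ ^ 2 - A * B * X₂ ^ 2 - A * C * X₃ ^ 2 + B * C * X₄ ^ 2 = W ^ 2 := by
    have hx' : x₁ ^ 2 - A * B * x₂ ^ 2 - A * C * x₃ ^ 2 + B * C * (A * x₄) ^ 2 = 1 := by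
      rw [← hx]; ring
    rw [h1, h2, h3, h4] at hx'
    field_simp at hx'
    exact_mod_cast hx'
  have hsq := h.sqf
  by_cases hl2 : l = 2
  · subst hl2
    have hr : RamifiedTwo A B C := by simpa using hl.2
    have hW4 : ¬ (4 : ℤ) ∣ W := by
      intro hW4
      have hm : (A * B % 16 = 15 ∧ A * C % 4 = 3) ∨
          (A * B % 16 = 2 ∧ (A * C % 8 = 3 ∨ A * C % 8 = 5)) ∨
          (A * B % 16 = 14 ∧ (A * C % 8 = 5 ∨ A * C % 8 = 7)) := by
        rcases hr with ⟨h5, h6⟩ | h5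
        · exact Or.inl ⟨by rw [h5]; rfl, h6⟩
        · exact Or.inr h5
      have hc : (16 : ℤ) ∣ A * B * (A * C) - B * C := by
        have hA8 := sq_emod_eight (Int.odd_iff.1 h.odd_left)
        rcases h.middle with h5 | h5
        · have hA1 : A = 1 := by
            have h6 : A ∣ 1 := ⟨-B, by linear_combination h5⟩
            have := Int.le_of_dvd one_pos h6
            have := h.pos
            omega
          rw [hA1]; exact ⟨0, by ring⟩
        · have hB : (2 : ℤ) ∣ B := by
            have h6 : (2 : ℤ) ∣ A * B := by omega
            refine (Int.prime_two.dvd_or_dvd h6).resolve_left ?_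
            have := Int.odd_iff.1 h.odd_left
            omega
          obtain ⟨i, hi⟩ := hB
          obtain ⟨j, hj⟩ : (8 : ℤ) ∣ A ^ 2 - 1 := by omega
          exact ⟨i * j * C, by linear_combination (A ^ 2 - 1) * C * hi + 2 * i * C * hj⟩
      obtain ⟨e1, e2, e3, e4⟩ := even_of_norm_form hm hc heq hW4
      exact hprim ⟨e1, e2, e3, e4, by push_cast; omega⟩
    by_cases hW2 : (2 : ℤ) ∣ W
    · obtain ⟨V, rfl⟩ := hW2
      refine ⟨X₁, V, by push_cast; omega, ?_⟩
      rw [h1]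
      push_cast
      have : (V : ℚ) ≠ 0 := by
        rintro h0
        push_cast at hWq
        exact hWq (by rw [h0, mul_zero])
      field_simp
    · exact ⟨2 * X₁, W, by exact_mod_cast hW2, by rw [h1]; push_cast; ring⟩
  · have hr : localSymbol A B C l = -1 := by simpa [hl2] using hl.2
    have hWl : ¬ (l : ℤ) ∣ W := by
      intro hWl
      have hll : ∀ x y : ℤ, Squarefree (x * y) → ¬ (l : ℤ) * l ∣ x := by
        intro x y hxy hd
        exact hli.not_isUnit (hxy _ (hd.mul_right y))
      have hd : (l : ℤ) ∣ A * B * C := by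
        have h3 := hl.dvd
        rw [← Int.natCast_dvd] at h3
        rcases hli.dvd_or_dvd h3 with h3 | h3
        · exact absurd ((Nat.prime_dvd_prime_iff_eq hlp Nat.prime_two).1 (by exact_mod_cast h3)) hl2
        · exact h3
      rcases hli.dvd_or_dvd hd with hd | hC
      · rcases hli.dvd_or_dvd hd with hA | hB
        · rw [Admissible.localSymbol_left hA] at hr
          obtain ⟨e1, e2, e3, e4⟩ := dvd_of_norm_form hlp hr rfl hA
            (hll A (B * C) (by rwa [← mul_assoc])) (X := X₁) (Y := X₄) (Z := X₂) (V := X₃) (W := W)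
            (by linear_combination heq) hWl
          exact hprim ⟨e1, e3, e4, e2, hWl⟩
        · rw [h.localSymbol_middle hlp hB] at hr
          obtain ⟨e1, e2, e3, e4⟩ := dvd_of_norm_form hlp hr (p := A) (q := -C) (by ring) hB
            (hll B (A * C) (by convert hsq using 1; ring)) (X := X₁) (Y := X₃) (Z := X₂) (V := X₄)
            (W := W) (by linear_combination heq) hWl
          exact hprim ⟨e1, e3, e2, e4, hWl⟩
      · rw [h.localSymbol_right hlp hC] at hr
        obtain ⟨e1, e2, e3, e4⟩ := dvd_of_norm_form hlp hr (p := A) (q := -B) (by ring) hC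
          (hll C (A * B) (by convert hsq using 1; ring)) (X := X₁) (Y := X₂) (Z := X₃) (V := X₄)
          (W := W) (by linear_combination heq) hWl
        exact hprim ⟨e1, e2, e3, e4, hWl⟩
    exact ⟨2 * X₁, W, hWl, by rw [h1]; push_cast; ring⟩

theorem Zloc_add {l : ℕ} (hl : l.Prime) {x y : ℚ} (hx : x ∈ Zloc l) (hy : y ∈ Zloc l) :
    x + y ∈ Zloc l := by
  obtain ⟨m, n, hn, rfl⟩ := hx
  obtain ⟨m', n', hn', rfl⟩ := hy
  have hn0 : (n : ℚ) ≠ 0 := by rintro h; exact hn (by simp [Int.cast_eq_zero.1 h])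
  have hn0' : (n' : ℚ) ≠ 0 := by rintro h; exact hn' (by simp [Int.cast_eq_zero.1 h])
  refine ⟨m * n' + m' * n, n * n', ?_, by push_cast; field_simp⟩
  intro h
  rcases (Nat.prime_iff_prime_int.1 hl).dvd_or_dvd h with h | h
  · exact hn h
  · exact hn' h

theorem Admissible.T_subset_Zloc {A B C : ℤ} (h : Admissible A B C) {l : ℕ}
    (hl : Ramified A B C l) : T (A * B) (A * C) ⊆ Zloc l := by
  rintro t ht
  obtain ⟨x, hx, y, hy, rfl⟩ := Set.mem_add.1 ht
  exact Zloc_add hl.1 (h.S_subset_Zloc hl hx) (h.S_subset_Zloc hl hy)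

/-! ### Sums of two sets `T` as semilocal rings -/

theorem exists_mul_eq_of_prime_pred (P : ℕ → Prop) (n : ℕ) (hn : n ≠ 0) :
    ∃ α β : ℕ, n = α * β ∧ (∀ l, l.Prime → l ∣ α → P l) ∧ (∀ l, l.Prime → l ∣ β → ¬ P l) := by
  induction n using induction_on_primes with
  | zero => exact absurd rfl hn
  | one =>
    exact ⟨1, 1, rfl, fun l hl h => absurd (Nat.dvd_one.1 h) hl.ne_one,
      fun l hl h => absurd (Nat.dvd_one.1 h) hl.ne_one⟩
  | prime_mul p m hp ih =>
    obtain ⟨α, β, rfl, h1, h2⟩ := ih (right_ne_zero_of_mul hn)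
    by_cases hP : P p
    · refine ⟨p * α, β, by ring, fun l hl h => ?_, h2⟩
      rcases hl.dvd_mul.1 h with h | h
      · rwa [(Nat.prime_dvd_prime_iff_eq hl hp).1 h]
      · exact h1 l hl h
    · refine ⟨α, p * β, by ring, h1, fun l hl h => ?_⟩
      rcases hl.dvd_mul.1 h with h | h
      · rwa [(Nat.prime_dvd_prime_iff_eq hl hp).1 h]
      · exact h2 l hl h

theorem intCast_mem_Zloc {l : ℕ} (hl : l.Prime) (n : ℤ) : (n : ℚ) ∈ Zloc l :=
  ⟨n, 1, fun h => (Nat.prime_iff_prime_int.1 hl).not_isUnit (isUnit_of_dvd_one h), by simp⟩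

/-- Partial fractions: the part of the denominator ramified in the first algebra goes to the second
summand, the rest to the first. Moving the integer part of `y` to `z` puts the first summand in
`[0,1)`, which meets its possible real condition; the second algebra has none. -/
theorem exists_add_eq_of_mem_Zloc {A B C A' B' C' : ℤ} (h : Admissible A B C)
    (h' : Admissible A' B' C') (hreal : ¬ RamifiedReal A' B' C') {x : ℚ}
    (hx : ∀ l, Ramified A B C l → Ramified A' B' C' l → x ∈ Zloc l) :
    ∃ y ∈ T (A * B) (A * C), ∃ z ∈ T (A' * B') (A' * C'), y + z = x := by
  obtain ⟨α, β, hαβ, hα, hβ⟩ := exists_mul_eq_of_prime_pred (Ramified A B C) x.den x.den_nz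
  have hcop : α.Coprime β := Nat.coprime_of_dvd fun l hl h1 h2 => hβ l hl h2 (hα l hl h1)
  obtain ⟨i, j, hij⟩ := Nat.isCoprime_iff_coprime.2 hcop
  have hn0 := x.den_nz
  rw [hαβ] at hn0
  have hα0 : (α : ℚ) ≠ 0 := by exact_mod_cast left_ne_zero_of_mul hn0
  have hβ0 : (β : ℚ) ≠ 0 := by exact_mod_cast right_ne_zero_of_mul hn0
  set y : ℚ := ((x.num * i : ℤ) : ℚ) / (β : ℤ) with hy
  set z : ℚ := ((x.num * j : ℤ) : ℚ) / (α : ℤ) with hz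
  have hyz : y + z = x := by
    have hij' : (i : ℚ) * α + j * β = 1 := by exact_mod_cast hij
    rw [hy, hz]
    nth_rewrite 3 [← Rat.num_div_den x]
    rw [hαβ]
    push_cast
    field_simp
    linear_combination (x.num : ℚ) * hij'
  refine ⟨Int.fract y, h.mem_T ?_ ?_, z + ⌊y⌋, h'.mem_T ?_ ?_, ?_⟩
  · intro l hl
    have h1 : y ∈ Zloc l :=
      ⟨_, _, fun hd => hβ l hl.1 (by exact_mod_cast hd) hl, rfl⟩
    have h2 := Zloc_add hl.1 h1 (intCast_mem_Zloc hl.1 (-⌊y⌋))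
    rw [Int.fract, sub_eq_add_neg]
    exact_mod_cast h2
  · intro _
    rw [abs_of_nonneg (Int.fract_nonneg _)]
    exact (Int.fract_lt_one _).le
  · intro l hl
    refine Zloc_add hl.1 ⟨_, _, fun hd => ?_, rfl⟩ (intCast_mem_Zloc hl.1 _)
    have hd : l ∣ α := by exact_mod_cast hd
    have h1 := hx l (hα l hl.1 hd) hl
    rw [mem_Zloc_iff, hαβ] at h1
    exact h1 (hd.mul_right _)
  · intro h1
    exact absurd h1 hreal
  · have := Int.fract_add_floor y
    linear_combination hyz + this

/-- A sum of two sets `T` is a semilocal ring. -/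
theorem T_add_T_eq {A B C A' B' C' : ℤ} (h : Admissible A B C) (h' : Admissible A' B' C')
    (hreal : ¬ (RamifiedReal A B C ∧ RamifiedReal A' B' C')) :
    T (A * B) (A * C) + T (A' * B') (A' * C') =
      ⋂ l ∈ {l | Ramified A B C l ∧ Ramified A' B' C' l}, Zloc l := by
  ext x
  simp only [Set.mem_iInter, Set.mem_ofPred_eq]
  constructor
  · rintro hx l ⟨hl, hl'⟩
    obtain ⟨y, hy, z, hz, rfl⟩ := Set.mem_add.1 hx
    exact Zloc_add hl.1 (h.T_subset_Zloc hl hy) (h'.T_subset_Zloc hl' hz)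
  · intro hx
    by_cases hr : RamifiedReal A' B' C'
    · obtain ⟨y, hy, z, hz, hyz⟩ := exists_add_eq_of_mem_Zloc h' h (fun h0 => hreal ⟨h0, hr⟩)
        fun l h1 h2 => hx l ⟨h2, h1⟩
      exact Set.mem_add.2 ⟨z, hz, y, hy, by rw [add_comm, hyz]⟩
    · obtain ⟨y, hy, z, hz, hyz⟩ := exists_add_eq_of_mem_Zloc h h' hr
        fun l h1 h2 => hx l ⟨h1, h2⟩
      exact Set.mem_add.2 ⟨y, hy, z, hz, hyz⟩

/-! ### Isomorphisms of quaternion algebras and squarefree kernels -/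

/-- The generator `α` is replaced by `αβ`, whose square is `-ab`. -/
theorem S_comm_scale (a : ℚ) {b : ℚ} (hb : b ≠ 0) : S a b = S (-(a * b)) b := by
  ext s
  constructor
  · rintro ⟨x₁, x₂, x₃, x₄, h, rfl⟩
    refine ⟨x₁, x₄, x₃, x₂ / b, ?_, rfl⟩
    rw [← h]; field_simp; ring
  · rintro ⟨x₁, x₂, x₃, x₄, h, rfl⟩
    refine ⟨x₁, b * x₄, x₃, x₂, ?_, rfl⟩
    rw [← h]; ring

theorem S_mul_sq_left (a b : ℚ) {c : ℚ} (hc : c ≠ 0) : S (a * c ^ 2) b = S a b := by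
  ext s
  constructor
  · rintro ⟨x₁, x₂, x₃, x₄, h, rfl⟩
    refine ⟨x₁, c * x₂, x₃, c * x₄, ?_, rfl⟩
    rw [← h]; ring
  · rintro ⟨x₁, x₂, x₃, x₄, h, rfl⟩
    refine ⟨x₁, x₂ / c, x₃, x₄ / c, ?_, rfl⟩
    rw [← h]; field_simp

/-- Multiplying `β` by an element `u+vα` of the quadratic subalgebra multiplies `β²` by its norm. -/
theorem S_mul_norm_right (a b : ℚ) {u v : ℚ} (h : u ^ 2 - a * v ^ 2 ≠ 0) :
    S a (b * (u ^ 2 - a * v ^ 2)) = S a b := by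
  have key : ∀ b u v : ℚ, S a (b * (u ^ 2 - a * v ^ 2)) ⊆ S a b := by
    rintro b u v s ⟨x₁, x₂, x₃, x₄, h, rfl⟩
    refine ⟨x₁, x₂, u * x₃ + a * v * x₄, u * x₄ + v * x₃, ?_, rfl⟩
    rw [← h]; ring
  refine (key b u v).antisymm ?_
  set N := u ^ 2 - a * v ^ 2 with hN
  have h1 : b = b * N * ((u / N) ^ 2 - a * (v / N) ^ 2) := by
    have : (u / N) ^ 2 - a * (v / N) ^ 2 = 1 / N := by
      field_simp
      exact hN.symm
    rw [this]; field_simp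
  intro s hs
  rw [h1] at hs
  exact key _ _ _ hs

theorem S_mul_sq_right (a b : ℚ) {c : ℚ} (hc : c ≠ 0) : S a (b * c ^ 2) = S a b := by
  have := S_mul_norm_right a b (u := c) (v := 0) (by simpa using hc)
  simpa using this

/-- Squarefree kernel of a rational number. -/
theorem exists_squarefree_mul_sq_rat (p : ℚ) (hp : p ≠ 0) :
    ∃ (c : ℤ) (f : ℚ), p = c * f ^ 2 ∧ Squarefree c ∧ f ≠ 0 := by
  have hd : (p.den : ℚ) ≠ 0 := by exact_mod_cast p.den_nz
  obtain ⟨c, f, h, hc, hf⟩ := exists_squarefree_mul_sq (p.num * p.den)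
    (mul_ne_zero (Rat.num_ne_zero.2 hp) (by exact_mod_cast p.den_nz))
  have hf' : (f : ℚ) ≠ 0 := by exact_mod_cast hf
  refine ⟨c, f / p.den, ?_, hc, div_ne_zero hf' hd⟩
  have h' : (p.num : ℚ) * p.den = c * f ^ 2 := by exact_mod_cast h
  nth_rewrite 1 [← Rat.num_div_den p]
  field_simp
  linear_combination h'

theorem odd_padicValRat_iff {l : ℕ} (hl : l.Prime) {p f : ℚ} {c : ℤ} (h : p = c * f ^ 2)
    (hc : Squarefree c) (hf : f ≠ 0) : Odd (padicValRat l p) ↔ (l : ℤ) ∣ c := by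
  have : Fact l.Prime := ⟨hl⟩
  have hc0 : (c : ℚ) ≠ 0 := by exact_mod_cast hc.ne_zero
  rw [h, padicValRat.mul hc0 (pow_ne_zero 2 hf), padicValRat.pow, padicValRat.of_int]
  by_cases hd : (l : ℤ) ∣ c
  · obtain ⟨c', rfl⟩ := hd
    have hc' : ¬ (l : ℤ) ∣ c' := not_dvd_of_squarefree_mul hc hl dvd_rfl
    have hv : padicValInt l ((l : ℤ) * c') = 1 := by
      rw [padicValInt.mul (by exact_mod_cast hl.ne_zero) (by rintro rfl; simp at hc'),
        padicValInt.self hl.one_lt, padicValInt.eq_zero_of_not_dvd hc']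
    rw [hv]
    simp [parity_simps]
  · rw [padicValInt.eq_zero_of_not_dvd hd]
    simp [hd]

theorem emod_eight_of_modEqTwo {k : ℕ} (hk : k % 2 = 1) (hk8 : k < 8) {p f : ℚ} {c : ℤ}
    (h : p = c * f ^ 2) (hc : Squarefree c) (hf : f ≠ 0) (hp : ModEqTwo k p) : c % 8 = k := by
  obtain ⟨z, ⟨m, n, hn, rfl⟩, hz⟩ := hp
  have hn2 : n % 2 = 1 := by push_cast at hn; omega
  have hnq : (n : ℚ) ≠ 0 := by
    have : n ≠ 0 := by omega
    exact_mod_cast this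
  have hfd' : (f.den : ℤ) ≠ 0 := by exact_mod_cast f.den_nz
  have heq : c * (n * f.num) ^ 2 = (k * n ^ 2 + 8 * (m * n)) * (f.den : ℤ) ^ 2 := by
    have h1 : (c : ℚ) * f ^ 2 = k + 8 * (m / n) := by rw [← h, hz]
    rw [← Rat.num_div_den f] at h1
    field_simp at h1
    have h2 : (c : ℚ) * (n * f.num) ^ 2 = (k * n ^ 2 + 8 * (m * n)) * (f.den : ℚ) ^ 2 := by
      linear_combination n * h1
    exact_mod_cast h2
  -- Removing the power of `2` from the denominator of `f` leaves `cg² = w` with `w ≡ k mod 8` odd;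
  -- then `g` is odd and `g² ≡ 1 mod 8`.
  have hfin : FiniteMultiplicity (2 : ℤ) f.den := Int.finiteMultiplicity_iff.2 ⟨by norm_num, hfd'⟩
  obtain ⟨e, he, he2⟩ := hfin.exists_eq_pow_mul_and_not_dvd
  generalize multiplicity (2 : ℤ) (f.den : ℤ) = j at he
  have hn8 := sq_emod_eight hn2
  have he8 := sq_emod_eight (g := e) (by omega)
  have hw8 : (k * n ^ 2 + 8 * (m * n)) * e ^ 2 % 8 = k := by
    rw [Int.mul_emod, he8, mul_one, Int.emod_emod_of_dvd _ dvd_rfl, Int.add_mul_emod_self_left,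
      Int.mul_emod, hn8, mul_one, Int.emod_emod_of_dvd _ dvd_rfl]
    omega
  obtain ⟨g, hg⟩ := exists_sq_mul_eq_of_pow_sq_mul Nat.prime_two (d := c) (f := n * f.num)
    (w := (k * n ^ 2 + 8 * (m * n)) * e ^ 2) (k := j) hc
    (mul_ne_zero (by omega) (Rat.num_ne_zero.2 hf)) (by push_cast; omega)
    (by rw [heq, he]; push_cast; ring)
  have hg2 : g % 2 = 1 := by
    by_contra hg2
    obtain ⟨i, rfl⟩ : ∃ i, g = 2 * i := ⟨g / 2, by omega⟩
    have : c * (2 * i) ^ 2 = 4 * (c * i ^ 2) := by ring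
    omega
  have hg8 := sq_emod_eight hg2
  rw [← hg, Int.mul_emod, hg8, mul_one, Int.emod_emod_of_dvd _ dvd_rfl] at hw8
  exact hw8

/-! ### The generalized Legendre symbol -/

section Legendre

theorem exists_unit_part {l : ℕ} (hl : l.Prime) {h : ℚ} (hh : h ≠ 0) :
    ∃ c d : ℤ, ¬ (l : ℤ) ∣ c ∧ ¬ (l : ℤ) ∣ d ∧
      h * (l : ℚ) ^ (-padicValRat l h) = c / d := by
  have : Fact l.Prime := ⟨hl⟩
  have hl0 : (l : ℚ) ≠ 0 := by exact_mod_cast hl.ne_zero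
  set u := h * (l : ℚ) ^ (-padicValRat l h) with hu
  have hu0 : u ≠ 0 := mul_ne_zero hh (zpow_ne_zero _ hl0)
  have hv : padicValRat l u = 0 := by
    rw [hu, padicValRat.mul hh (zpow_ne_zero _ hl0), padicValRat.zpow, padicValRat.self hl.one_lt]
    ring
  have hcop := u.reduced
  have hv' : (padicValInt l u.num : ℤ) - padicValNat l u.den = 0 := by
    rw [← hv]; rfl
  have hnum0 : u.num ≠ 0 := Rat.num_ne_zero.2 hu0
  have hnd : ¬ (l ∣ u.num.natAbs ∧ l ∣ u.den) := fun ⟨h1, h2⟩ =>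
    hl.one_lt.ne' (Nat.dvd_one.1 (hcop ▸ Nat.dvd_gcd h1 h2))
  have key : ¬ l ∣ u.num.natAbs ∧ ¬ l ∣ u.den := by
    constructor
    · intro h1
      have h2 : ¬ l ∣ u.den := fun h2 => hnd ⟨h1, h2⟩
      have h3 := one_le_padicValNat_of_dvd (Int.natAbs_ne_zero.2 hnum0) h1
      rw [padicValNat.eq_zero_of_not_dvd h2] at hv'
      simp only [padicValInt] at hv'
      omega
    · intro h2
      have h1 : ¬ l ∣ u.num.natAbs := fun h1 => hnd ⟨h1, h2⟩
      have h3 := one_le_padicValNat_of_dvd u.den_nz h2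
      simp only [padicValInt, padicValNat.eq_zero_of_not_dvd h1] at hv'
      omega
  refine ⟨u.num, u.den, fun h1 => key.1 (Int.natCast_dvd.1 h1), fun h1 => key.2
    (by exact_mod_cast h1), ?_⟩
  exact_mod_cast (Rat.num_div_den u).symm

/-- The `l`-adic unit part of `a = nh²` is `n` times the square of the unit part of `h`. -/
theorem genLegendre_eq_neg_one_iff {l : ℕ} (hl : l.Prime) {a h : ℚ} {n : ℤ} (ha : a = n * h ^ 2)
    (hh : h ≠ 0) (hn : ¬ (l : ℤ) ∣ n) : genLegendre a l = -1 ↔ jacobiSym n l = -1 := by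
  have : Fact l.Prime := ⟨hl⟩
  have hli := Nat.prime_iff_prime_int.1 hl
  have hl0 : (l : ℚ) ≠ 0 := by exact_mod_cast hl.ne_zero
  obtain ⟨c, d, hc, hd, hcd⟩ := exists_unit_part hl hh
  have hd0 : (d : ℚ) ≠ 0 := by
    have : d ≠ 0 := by rintro rfl; simp at hd
    exact_mod_cast this
  have hn0 : (n : ℚ) ≠ 0 := by
    have : n ≠ 0 := by rintro rfl; simp at hn
    exact_mod_cast this
  have hv : padicValRat l a = padicValRat l h + padicValRat l h := by
    rw [ha, padicValRat.mul hn0 (pow_ne_zero 2 hh), padicValRat.pow, padicValRat.of_int,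
      padicValInt.eq_zero_of_not_dvd hn]
    push_cast
    ring
  have hunit : a * (l : ℚ) ^ (-padicValRat l a) = n * (c / d) ^ 2 := by
    rw [hv, neg_add, zpow_add₀ hl0, ha, ← hcd]
    ring
  rw [jacobiSym_eq_neg_one_iff hl, genLegendre, hunit]
  have hiff : (∃ y : ℤ, ∃ z ∈ Zloc l, (n : ℚ) * (c / d) ^ 2 = (y : ℚ) ^ 2 + (l : ℚ) * z) ↔
      IsSquare ((n : ℤ) : ZMod l) := by
    have hcl : ((c : ℤ) : ZMod l) ≠ 0 := fun h => hc ((ZMod.intCast_zmod_eq_zero_iff_dvd _ _).1 h)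
    have hdl : ((d : ℤ) : ZMod l) ≠ 0 := fun h => hd ((ZMod.intCast_zmod_eq_zero_iff_dvd _ _).1 h)
    constructor
    · rintro ⟨y, z, ⟨m, m', hm', rfl⟩, hz⟩
      have hm0 : (m' : ℚ) ≠ 0 := by
        have : m' ≠ 0 := by rintro rfl; simp at hm'
        exact_mod_cast this
      have hml : ((m' : ℤ) : ZMod l) ≠ 0 :=
        fun h => hm' ((ZMod.intCast_zmod_eq_zero_iff_dvd _ _).1 h)
      have h1 : n * c ^ 2 * m' = (y * d) ^ 2 * m' + l * (m * d ^ 2) := by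
        have h2 : (n : ℚ) * c ^ 2 * m' = (y * d) ^ 2 * m' + l * (m * d ^ 2) := by
          field_simp at hz
          linear_combination hz
        exact_mod_cast h2
      have h3 := congrArg (Int.cast : ℤ → ZMod l) h1
      push_cast at h3
      rw [ZMod.natCast_self, zero_mul, add_zero] at h3
      have h4 := mul_right_cancel₀ hml h3
      refine ⟨y * d / c, ?_⟩
      field_simp
      linear_combination h4
    · rintro ⟨r, hr⟩
      obtain ⟨y, hy⟩ := ZMod.intCast_surjective (r * (c : ZMod l) / (d : ZMod l))
      have h1 : (l : ℤ) ∣ n * c ^ 2 - (y * d) ^ 2 := by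
        rw [← ZMod.intCast_zmod_eq_zero_iff_dvd]
        push_cast
        rw [hy, hr]
        field_simp
        ring
      obtain ⟨k, hk⟩ := h1
      refine ⟨y, (k : ℚ) / ((d ^ 2 : ℤ) : ℚ), ⟨k, d ^ 2, fun h => hd (hli.dvd_of_dvd_pow h), rfl⟩, ?_⟩
      have hk' : (n : ℚ) * c ^ 2 - (y * d) ^ 2 = l * k := by exact_mod_cast hk
      push_cast
      field_simp
      linear_combination hk'
  rw [← hiff]
  split_ifs with h1
  · simp [h1]
  · simp [h1]

end Legendre

/-! ### Parts (a) and (b): algebras `(m, ±p)` with `m = -1, 2, -2` -/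

theorem iInter_insert_two {X Y : Set ℕ} (h : ∀ l, l ≠ 2 → (l ∈ X ↔ l ∈ Y)) (hY : 2 ∉ Y) :
    (2 ∉ X → X = Y) ∧ (2 ∈ X → X = Y ∪ {2}) := by
  constructor
  · intro hX
    ext l
    by_cases hl : l = 2
    · subst hl; simp [hX, hY]
    · exact h l hl
  · intro hX
    ext l
    by_cases hl : l = 2
    · subst hl; simp [hX]
    · simp [h l hl, hl]

theorem admissible_one {m : ℤ} (hm : m = -1 ∨ m = 2 ∨ m = -2) {C : ℤ} (hC : Squarefree C)
    (hC2 : C % 2 = 1) : Admissible 1 m C := by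
  refine ⟨one_pos, ?_, odd_one, Int.odd_iff.2 hC2, by rcases hm with rfl | rfl | rfl <;> simp⟩
  rw [one_mul]
  refine squarefree_mul_iff.2 ⟨IsCoprime.isRelPrime ?_, ?_, hC⟩
  · have h2 : IsCoprime (2 : ℤ) C :=
      (Prime.coprime_iff_not_dvd Int.prime_two).2 (by omega)
    rcases hm with rfl | rfl | rfl
    · exact isCoprime_one_left.neg_left
    · exact h2
    · exact h2.neg_left
  · rw [← Int.squarefree_natAbs]
    rcases hm with rfl | rfl | rfl
    · exact squarefree_one
    · exact Nat.prime_two.squarefree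
    · exact Nat.prime_two.squarefree

theorem ramified_one_iff {m : ℤ} (hm : m = -1 ∨ m = 2 ∨ m = -2) {C : ℤ} {l : ℕ}
    (hl : l.Prime) (hl2 : l ≠ 2) :
    Ramified 1 m C l ↔ (l : ℤ) ∣ C ∧ jacobiSym m l = -1 := by
  have h1 : ¬ (l : ℤ) ∣ 1 := fun h =>
    (Nat.prime_iff_prime_int.1 hl).not_isUnit (isUnit_of_dvd_one h)
  have h2 : ¬ (l : ℤ) ∣ 2 := fun h =>
    hl2 ((Nat.prime_dvd_prime_iff_eq hl Nat.prime_two).1 (by exact_mod_cast h))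
  have h3 : ¬ (l : ℤ) ∣ m := by
    rcases hm with rfl | rfl | rfl
    · rwa [dvd_neg]
    · exact h2
    · rwa [dvd_neg]
  simp only [Ramified, hl, hl2, localSymbol, h1, h3, if_false, true_and, one_mul]
  split_ifs with h4 <;> simp [h4]

/-- Removing squares and a factor `2`, which is a norm from `ℚ(√m)`. -/
theorem T_eq_of_odd_part {m : ℤ} (hm : m = -1 ∨ m = 2 ∨ m = -2)
    (c f : ℚ) (hf : f ≠ 0) (N : ℚ) (hN : N = 1 ∨ N = 2) :
    T m (c * N * f ^ 2) = T m c := by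
  have hS : S m (c * N * f ^ 2) = S m c := by
    rw [S_mul_sq_right _ _ hf]
    rcases hN with rfl | rfl
    · rw [mul_one]
    -- The factor `2` is a norm in each case: `2 = 1²+1² = 2²-2·1² = 0²+2·1²`.
    · rcases hm with rfl | rfl | rfl
      · have := S_mul_norm_right (-1 : ℚ) c (u := 1) (v := 1) (by norm_num)
        norm_num at this ⊢
        exact this
      · have := S_mul_norm_right (2 : ℚ) c (u := 2) (v := 1) (by norm_num)
        norm_num at this ⊢
        exact this
      · have := S_mul_norm_right (-2 : ℚ) c (u := 0) (v := 1) (by norm_num)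
        norm_num at this ⊢
        exact this
  rw [T, hS, T]

/-- A rational number is an odd squarefree integer up to squares and a factor `2`. -/
theorem exists_odd_squarefree_mul (p : ℚ) (hp : p ≠ 0) :
    ∃ (c : ℤ) (N f : ℚ), p = c * N * f ^ 2 ∧ Squarefree c ∧ c % 2 = 1 ∧ f ≠ 0 ∧
      (N = 1 ∨ N = 2) ∧ (∀ l : ℕ, l.Prime → l ≠ 2 → (Odd (padicValRat l p) ↔ (l : ℤ) ∣ c)) ∧
      (∀ k : ℕ, k % 2 = 1 → k < 8 → ModEqTwo k p → c % 8 = k) := by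
  obtain ⟨c, f, h, hc, hf⟩ := exists_squarefree_mul_sq_rat p hp
  by_cases hc2 : c % 2 = 1
  · exact ⟨c, 1, f, by rw [h]; ring, hc, hc2, hf, Or.inl rfl,
      fun l hl _ => odd_padicValRat_iff hl h hc hf,
      fun k hk hk8 hkp => emod_eight_of_modEqTwo hk hk8 h hc hf hkp⟩
  · obtain ⟨c, rfl⟩ : ∃ c', c = 2 * c' := ⟨c / 2, by omega⟩
    have h2 := not_dvd_of_squarefree_mul (l := 2) hc Nat.prime_two (by norm_num)
    refine ⟨c, 2, f, by rw [h]; push_cast; ring, hc.squarefree_of_dvd (dvd_mul_left _ _),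
      by push_cast at h2; omega, hf, Or.inr rfl, fun l hl hl2 => ?_, fun k hk hk8 hkp => ?_⟩
    · rw [odd_padicValRat_iff hl h hc hf]
      constructor
      · intro hd
        rcases (Nat.prime_iff_prime_int.1 hl).dvd_or_dvd hd with hd | hd
        · exact absurd ((Nat.prime_dvd_prime_iff_eq hl Nat.prime_two).1 (by exact_mod_cast hd)) hl2
        · exact hd
      · exact fun hd => hd.mul_left _
    · have := emod_eight_of_modEqTwo hk hk8 h hc hf hkp
      omega

theorem modEqTwo_natCast {k p : ℕ} (h : p ≡ k [MOD 8]) : ModEqTwo k (p : ℚ) := by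
  refine ⟨(((p : ℤ) - k) / 8 : ℤ), intCast_mem_Zloc Nat.prime_two _, ?_⟩
  have h1 : (8 : ℤ) ∣ (p : ℤ) - k := by
    have := Nat.modEq_iff_dvd.1 h.symm
    exact_mod_cast this
  have h2 := Int.mul_ediv_cancel' h1
  have h3 : (8 : ℚ) * (((p : ℤ) - k) / 8 : ℤ) = p - k := by exact_mod_cast h2
  rw [h3]; ring

theorem oddPrimes_natCast {p : ℕ} (hp : p.Prime) : oddPrimes (p : ℚ) = {p} := by
  ext l
  simp only [oddPrimes, Set.mem_ofPred_eq, Set.mem_singleton_iff]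
  have hval : l.Prime → (Odd (padicValRat l (p : ℚ)) ↔ (l : ℤ) ∣ p) := fun hl =>
    odd_padicValRat_iff hl (f := 1) (c := p) (by push_cast; ring)
      (Nat.prime_iff_prime_int.1 hp).squarefree one_ne_zero
  constructor
  · rintro ⟨hl, h1⟩
    rw [hval hl] at h1
    exact (Nat.prime_dvd_prime_iff_eq hl hp).1 (by exact_mod_cast h1)
  · rintro rfl
    exact ⟨hp, (hval hp).2 dvd_rfl⟩

/-- Common treatment of the rings attached to a residue class modulo `8`. -/
theorem ring_of_residue_class {R : ℚ → Set ℚ} {k : ℕ} {m₁ m₂ s₁ s₂ : ℤ}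
    (hk : k % 2 = 1) (hk8 : k < 8)
    (hm₁ : m₁ = -1 ∨ m₁ = 2 ∨ m₁ = -2) (hm₂ : m₂ = -1 ∨ m₂ = 2 ∨ m₂ = -2)
    (hs₁ : s₁ = 1 ∨ s₁ = -1) (hs₂ : s₂ = 1 ∨ s₂ = -1)
    (hR : ∀ p, p ≠ 0 → R p = T m₁ (s₁ * p) + T m₂ (s₂ * p))
    (hodd : ∀ l : ℕ, l.Prime → l ≠ 2 →
      ((jacobiSym m₁ l = -1 ∧ jacobiSym m₂ l = -1) ↔ l % 8 = k))
    (htwo : ∀ c : ℤ, c % 8 = k → ¬ (RamifiedTwo 1 m₁ (s₁ * c) ∧ RamifiedTwo 1 m₂ (s₂ * c)))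
    (hreal : ∀ c : ℤ, ¬ (RamifiedReal 1 m₁ (s₁ * c) ∧ RamifiedReal 1 m₂ (s₂ * c))) :
    (∀ p : ℚ, p ≠ 0 →
      (ModEqTwo k p → R p = ⋂ l ∈ oddPrimesMod k p, Zloc l) ∧
      (¬ ModEqTwo k p → R p = (⋂ l ∈ oddPrimesMod k p, Zloc l) ∨
        R p = ⋂ l ∈ oddPrimesMod k p ∪ {2}, Zloc l)) ∧
    (∀ p : ℕ, p.Prime → p ≡ k [MOD 8] → Zloc p = R (p : ℚ)) := by
  have sgn : ∀ s c : ℤ, (s = 1 ∨ s = -1) → Squarefree c → c % 2 = 1 →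
      Squarefree (s * c) ∧ s * c % 2 = 1 := by
    rintro s c (rfl | rfl) hc hc2
    · rw [one_mul]; exact ⟨hc, hc2⟩
    · refine ⟨?_, by omega⟩
      rw [← Int.squarefree_natAbs] at hc ⊢
      simpa using hc
  have sgn_dvd : ∀ (s c : ℤ) (l : ℕ), (s = 1 ∨ s = -1) → ((l : ℤ) ∣ s * c ↔ (l : ℤ) ∣ c) := by
    rintro s c l (rfl | rfl) <;> simp
  have main : ∀ p : ℚ, p ≠ 0 →
      (ModEqTwo k p → R p = ⋂ l ∈ oddPrimesMod k p, Zloc l) ∧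
      (¬ ModEqTwo k p → R p = (⋂ l ∈ oddPrimesMod k p, Zloc l) ∨
        R p = ⋂ l ∈ oddPrimesMod k p ∪ {2}, Zloc l) := by
    intro p hp
    obtain ⟨c, N, f, h, hc, hc2, hf, hN, hval, hmod⟩ := exists_odd_squarefree_mul p hp
    obtain ⟨q1, q2⟩ := sgn s₁ c hs₁ hc hc2
    obtain ⟨q3, q4⟩ := sgn s₂ c hs₂ hc hc2
    have a1 := admissible_one hm₁ q1 q2
    have a2 := admissible_one hm₂ q3 q4
    have hRp : R p = ⋂ l ∈ {l | Ramified 1 m₁ (s₁ * c) l ∧ Ramified 1 m₂ (s₂ * c) l}, Zloc l := by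
      rw [hR p hp, ← T_add_T_eq a1 a2 (hreal c)]
      have e1 := T_eq_of_odd_part hm₁ (s₁ * c) f hf N hN
      have e2 := T_eq_of_odd_part hm₂ (s₂ * c) f hf N hN
      have e3 : ∀ s : ℤ, (s : ℚ) * p = s * c * N * f ^ 2 := fun s => by rw [h]; ring
      rw [e3, e3, e1, e2]
      push_cast
      simp only [one_mul]
    have hsets := iInter_insert_two
      (X := {l | Ramified 1 m₁ (s₁ * c) l ∧ Ramified 1 m₂ (s₂ * c) l}) (Y := oddPrimesMod k p) (by
        intro l hl2
        simp only [Set.mem_ofPred_eq, oddPrimesMod, oddPrimes]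
        constructor
        · rintro ⟨h1, h2⟩
          have hl := h1.1
          rw [ramified_one_iff hm₁ hl hl2, sgn_dvd _ _ _ hs₁] at h1
          rw [ramified_one_iff hm₂ hl hl2] at h2
          refine ⟨⟨hl, (hval l hl hl2).2 h1.1⟩, ?_⟩
          have := (hodd l hl hl2).1 ⟨h1.2, h2.2⟩
          rw [Nat.ModEq, this, Nat.mod_eq_of_lt hk8]
        · rintro ⟨⟨hl, h1⟩, h2⟩
          rw [Nat.ModEq, Nat.mod_eq_of_lt hk8] at h2
          have h3 := (hodd l hl hl2).2 h2
          have h4 := (hval l hl hl2).1 h1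
          rw [ramified_one_iff hm₁ hl hl2, ramified_one_iff hm₂ hl hl2, sgn_dvd _ _ _ hs₁,
            sgn_dvd _ _ _ hs₂]
          exact ⟨⟨h4, h3.1⟩, h4, h3.2⟩) (by
        rintro ⟨-, h1⟩
        rw [Nat.ModEq, Nat.mod_eq_of_lt hk8] at h1
        omega)
    constructor
    · intro hpk
      have h2 : 2 ∉ {l | Ramified 1 m₁ (s₁ * c) l ∧ Ramified 1 m₂ (s₂ * c) l} := by
        rintro ⟨h1, h2⟩
        exact htwo c (hmod k hk hk8 hpk) ⟨by simpa using h1.2, by simpa using h2.2⟩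
      rw [hRp, hsets.1 h2]
    · intro _
      by_cases h2 : 2 ∈ {l | Ramified 1 m₁ (s₁ * c) l ∧ Ramified 1 m₂ (s₂ * c) l}
      · right
        rw [hRp, hsets.2 h2]
      · left
        rw [hRp, hsets.1 h2]
  refine ⟨main, fun p hp hpk => ?_⟩
  have hp0 : (p : ℚ) ≠ 0 := by exact_mod_cast hp.ne_zero
  have hset : oddPrimesMod k (p : ℚ) = {p} := by
    ext l
    simp only [oddPrimesMod, oddPrimes_natCast hp, Set.mem_ofPred_eq, Set.mem_singleton_iff]
    exact ⟨fun h => h.1, by rintro rfl; exact ⟨rfl, hpk⟩⟩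
  rw [(main p hp0).1 (modEqTwo_natCast hpk), hset]
  simp

theorem jacobiSym_neg_two_eq {n : ℕ} (hn : Odd n) :
    jacobiSym (-2) n = if n % 8 = 1 ∨ n % 8 = 3 then 1 else -1 := by
  rw [show (-2 : ℤ) = -1 * 2 by norm_num, jacobiSym.mul_left, jacobiSym_neg_one_eq hn,
    jacobiSym_two_eq hn]
  have := Nat.odd_iff.1 hn
  split_ifs <;> first | rfl | (exfalso; omega)

/-- By the isomorphism `(a,b) ≅ (-ab,b)`, `(-p,-p)` becomes `(-p²,-p)` and `(2p,-p)` becomes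
`(2p²,-p)`; the square `p²` is then dropped. The next two reductions are analogous. -/
theorem R3_eq {p : ℚ} (hp : p ≠ 0) :
    R3 p = T ((-1 : ℤ) : ℚ) (((-1 : ℤ) : ℚ) * p) + T ((2 : ℤ) : ℚ) (((-1 : ℤ) : ℚ) * p) := by
  have hp' : -p ≠ 0 := neg_ne_zero.2 hp
  have e1 : S (-p) (-p) = S (-1) (-p) := by
    rw [S_comm_scale _ hp', ← S_mul_sq_left (-1) _ hp]; congr 1; ring
  have e2 : S (2 * p) (-p) = S 2 (-p) := by
    rw [S_comm_scale _ hp', ← S_mul_sq_left 2 _ hp]; congr 1; ring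
  rw [R3, T, T, e1, e2, T, T]
  push_cast
  simp only [neg_one_mul]

theorem R5_eq {p : ℚ} (hp : p ≠ 0) :
    R5 p = T ((-2 : ℤ) : ℚ) (((-1 : ℤ) : ℚ) * p) + T ((2 : ℤ) : ℚ) (((-1 : ℤ) : ℚ) * p) := by
  have hp' : -p ≠ 0 := neg_ne_zero.2 hp
  have e1 : S (-2 * p) (-p) = S (-2) (-p) := by
    rw [S_comm_scale _ hp', ← S_mul_sq_left (-2) _ hp]; congr 1; ring
  have e2 : S (2 * p) (-p) = S 2 (-p) := by
    rw [S_comm_scale _ hp', ← S_mul_sq_left 2 _ hp]; congr 1; ring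
  rw [R5, T, T, e1, e2, T, T]
  push_cast
  simp only [neg_one_mul]

theorem R7_eq {p : ℚ} (hp : p ≠ 0) :
    R7 p = T ((-1 : ℤ) : ℚ) (((-1 : ℤ) : ℚ) * p) + T ((-2 : ℤ) : ℚ) (((1 : ℤ) : ℚ) * p) := by
  have hp' : -p ≠ 0 := neg_ne_zero.2 hp
  have e1 : S (-p) (-p) = S (-1) (-p) := by
    rw [S_comm_scale _ hp', ← S_mul_sq_left (-1) _ hp]; congr 1; ring
  have e2 : S (2 * p) p = S (-2) p := by
    rw [S_comm_scale _ hp, ← S_mul_sq_left (-2) _ hp]; congr 1; ring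
  rw [R7, T, T, e1, e2, T, T]
  push_cast
  simp only [neg_one_mul, one_mul]

theorem R1_eq (p : ℚ) {q : ℚ} (hq : q ≠ 0) : R1 p q = T (2 * p) q + T (-(2 * p)) q := by
  have e1 : S (2 * p * q) q = S (-(2 * p)) q := by
    rw [S_comm_scale _ hq, ← S_mul_sq_left (-(2 * p)) _ hq]; congr 1; ring
  have e2 : S (-2 * p * q) q = S (2 * p) q := by
    rw [S_comm_scale _ hq, ← S_mul_sq_left (2 * p) _ hq]; congr 1; ring
  rw [R1, T, T, e1, e2, T, T, add_comm]

/-- The algebra `(3,3) ≅ (-1,3)` is ramified at `2` and `3`, and `(2,5)` at `2` and `5`; they share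
only `2`. -/
theorem Zloc_two_eq : Zloc 2 = T 3 3 + T 2 5 := by
  have e1 : T 3 3 = T (((1 : ℤ) : ℚ) * ((-1 : ℤ) : ℚ)) (((1 : ℤ) : ℚ) * ((3 : ℤ) : ℚ)) := by
    have : S 3 3 = S (-1) 3 := by
      rw [S_comm_scale _ three_ne_zero, ← S_mul_sq_left (-1) _ (three_ne_zero' ℚ)]; norm_num
    rw [T, this, T]
    norm_num
  have e2 : T 2 5 = T (((1 : ℤ) : ℚ) * ((2 : ℤ) : ℚ)) (((1 : ℤ) : ℚ) * ((5 : ℤ) : ℚ)) := by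
    norm_num
  have h3 : Squarefree (3 : ℤ) := (Nat.prime_iff_prime_int.1 Nat.prime_three).squarefree
  have h5 : Squarefree (5 : ℤ) := (Nat.prime_iff_prime_int.1 Nat.prime_five).squarefree
  have m1 : (-1 : ℤ) = -1 ∨ (-1 : ℤ) = 2 ∨ (-1 : ℤ) = -2 := Or.inl rfl
  have m2 : (2 : ℤ) = -1 ∨ (2 : ℤ) = 2 ∨ (2 : ℤ) = -2 := Or.inr (Or.inl rfl)
  rw [e1, e2, T_add_T_eq (admissible_one m1 h3 (by norm_num)) (admissible_one m2 h5 (by norm_num))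
    (by rintro ⟨-, h, -⟩; norm_num at h)]
  have hset : {l | Ramified 1 (-1) 3 l ∧ Ramified 1 2 5 l} = {2} := by
    ext l
    simp only [Set.mem_ofPred_eq, Set.mem_singleton_iff]
    constructor
    · rintro ⟨h1, h2⟩
      by_contra hl2
      have hl := h1.1
      rw [ramified_one_iff m1 hl hl2] at h1
      rw [ramified_one_iff m2 hl hl2] at h2
      have e3 := (Nat.prime_dvd_prime_iff_eq hl Nat.prime_three).1 (by exact_mod_cast h1.1)
      have e5 := (Nat.prime_dvd_prime_iff_eq hl Nat.prime_five).1 (by exact_mod_cast h2.1)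
      omega
    · rintro rfl
      exact ⟨⟨Nat.prime_two, by simp [RamifiedTwo]⟩, ⟨Nat.prime_two, by simp [RamifiedTwo]⟩⟩
  rw [hset]
  simp

/-! ### Part (c): the algebras `(±2p, q)` -/

section TwoParameters

/-- Two odd squarefree integers and their greatest common divisor. -/
theorem exists_gcd_factor {p q : ℤ} (hp : p ≠ 0) :
    ∃ g p' q' : ℤ, 0 < g ∧ p = g * p' ∧ q = g * q' ∧ IsCoprime p' q' := by
  have hg : 0 < Int.gcd p q := Int.gcd_pos_of_ne_zero_left q hp
  obtain ⟨p', q', h1, h2, h3⟩ := Int.exists_gcd_one hg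
  exact ⟨Int.gcd p q, p', q', by exact_mod_cast hg, by rw [mul_comm]; exact h2,
    by rw [mul_comm]; exact h3, Int.isCoprime_iff_gcd_eq_one.2 h1⟩

variable {g p q : ℤ}

/-- Here `gp` and `gq` are the squarefree kernels of the two parameters and `g` is their common
factor. Since `gp ≡ 1 mod 8`, the product `g·εp` is `±2` modulo `16`. -/
theorem admissible_two_mul (hg : 0 < g) (hp : Squarefree (g * p)) (hq : Squarefree (g * q))
    (hpq : IsCoprime p q) (hp8 : g * p % 8 = 1) (hq2 : g * q % 2 = 1) {ε : ℤ}
    (hε : ε = 2 ∨ ε = -2) : Admissible g (ε * p) q := by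
  have hgo : ¬ (2 : ℤ) ∣ g := by rintro ⟨i, rfl⟩; rw [mul_assoc] at hq2; omega
  have hqo : ¬ (2 : ℤ) ∣ q := by
    rintro ⟨i, rfl⟩; rw [show g * (2 * i) = 2 * (g * i) by ring] at hq2; omega
  have hpo : ¬ (2 : ℤ) ∣ p := by
    rintro ⟨i, rfl⟩; rw [show g * (2 * i) = 2 * (g * i) by ring] at hp8; omega
  have c2 : ∀ x : ℤ, ¬ (2 : ℤ) ∣ x → IsRelPrime (2 : ℤ) x := fun x hx =>
    ((Prime.coprime_iff_not_dvd Int.prime_two).2 hx).isRelPrime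
  refine ⟨hg, ?_, ?_, ?_, ?_⟩
  · have h1 : Squarefree (2 * (g * p * q)) := by
      obtain ⟨g1, g2, g3⟩ := squarefree_mul_iff.1 hp
      obtain ⟨g4, -, g6⟩ := squarefree_mul_iff.1 hq
      refine squarefree_mul_iff.2 ⟨?_, Int.prime_two.squarefree, squarefree_mul_iff.2
        ⟨IsRelPrime.mul_left g4 hpq.isRelPrime, hp, g6⟩⟩
      exact ((c2 g hgo).mul_right (c2 p hpo)).mul_right (c2 q hqo)
    rw [← Int.squarefree_natAbs] at h1 ⊢
    convert h1 using 1
    rcases hε with rfl | rfl <;> simp only [Int.natAbs_mul, Int.natAbs_neg] <;> ring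
  · rw [Int.odd_iff]; omega
  · rw [Int.odd_iff]; omega
  · right
    rcases hε with rfl | rfl
    · left; rw [show g * (2 * p) = 2 * (g * p) by ring]; omega
    · right; rw [show g * (-2 * p) = -2 * (g * p) by ring]; omega

/-- The three alternatives are those of `primesPQ`. At primes dividing `g` the sign of `ε` flips,
which is harmless once both values of `ε` are imposed together. -/
theorem ramified_two_mul_iff (hpq : IsCoprime p q)
    {ε : ℤ} (hε : ε = 2 ∨ ε = -2)
    {l : ℕ} (hl : l.Prime) (hl2 : l ≠ 2) :
    Ramified g (ε * p) q l ↔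
      ((l : ℤ) ∣ g * p ∧ ¬ (l : ℤ) ∣ g * q ∧ jacobiSym (g * q) l = -1) ∨
      ((l : ℤ) ∣ g * q ∧ ¬ (l : ℤ) ∣ g * p ∧ jacobiSym (ε * (g * p)) l = -1) ∨
      ((l : ℤ) ∣ g ∧ jacobiSym (-ε * (p * q)) l = -1) := by
  have hli := Nat.prime_iff_prime_int.1 hl
  have hle : ∀ x : ℤ, (l : ℤ) ∣ ε * x ↔ (l : ℤ) ∣ x := by
    intro x
    have h2 : ¬ (l : ℤ) ∣ 2 := fun h =>
      hl2 ((Nat.prime_dvd_prime_iff_eq hl Nat.prime_two).1 (by exact_mod_cast h))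
    refine ⟨fun h => ?_, fun h => h.mul_left _⟩
    rcases hε with rfl | rfl
    · exact (hli.dvd_or_dvd h).resolve_left h2
    · exact (hli.dvd_or_dvd h).resolve_left (by rwa [dvd_neg])
  have npq : (l : ℤ) ∣ p → ¬ (l : ℤ) ∣ q := fun h1 h2 => hli.not_isUnit (hpq.isUnit_of_dvd' h1 h2)
  simp only [Ramified, hl, hl2, localSymbol, hle, if_false, true_and]
  by_cases hg : (l : ℤ) ∣ g
  · simp only [hg, hg.mul_right, if_true, not_true, false_and, and_false, true_and, false_or]
    rw [show -(ε * p * q) = -ε * (p * q) by ring]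
  · have hgx : ∀ x : ℤ, (l : ℤ) ∣ g * x ↔ (l : ℤ) ∣ x := fun x =>
      ⟨fun h => (hli.dvd_or_dvd h).resolve_left hg, fun h => h.mul_left _⟩
    simp only [hg, hgx, if_false, false_and, or_false]
    by_cases hlp : (l : ℤ) ∣ p
    · simp [hlp, npq hlp]
    · by_cases hlq : (l : ℤ) ∣ q
      · simp only [hlp, hlq, if_true, if_false, false_and, not_false_eq_true, true_and, false_or]
        rw [show g * (ε * p) = ε * (g * p) by ring]
      · simp [hlp, hlq]

end TwoParameters

theorem R1_eq_iInter {p q : ℚ} (hp : p ≠ 0) (hq : q ≠ 0) (hp1 : ModEqTwo 1 p)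
    (hq3 : ModEqTwo 3 q) : R1 p q = ⋂ l ∈ primesPQ p q, Zloc l := by
  obtain ⟨a, f, ha, has, hf⟩ := exists_squarefree_mul_sq_rat p hp
  obtain ⟨b, h, hb, hbs, hh⟩ := exists_squarefree_mul_sq_rat q hq
  have ha8 : a % 8 = 1 := emod_eight_of_modEqTwo (k := 1) rfl (by norm_num) ha has hf hp1
  have hb8 : b % 8 = 3 := emod_eight_of_modEqTwo (k := 3) rfl (by norm_num) hb hbs hh hq3
  obtain ⟨g, p', q', hg, rfl, rfl, hpq⟩ := exists_gcd_factor (p := a) (q := b) has.ne_zero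
  have a1 := admissible_two_mul hg has hbs hpq ha8 (by omega) (ε := 2) (Or.inl rfl)
  have a2 := admissible_two_mul hg has hbs hpq ha8 (by omega) (ε := -2) (Or.inr rfl)
  have e1 : S (2 * p) q = S ((g : ℚ) * ((2 * p' : ℤ) : ℚ)) ((g : ℚ) * (q' : ℚ)) := by
    rw [ha, hb]
    push_cast
    rw [S_mul_sq_right _ _ hh, ← S_mul_sq_left ((g : ℚ) * (2 * p')) _ hf]
    congr 1; ring
  have e2 : S (-(2 * p)) q = S ((g : ℚ) * ((-2 * p' : ℤ) : ℚ)) ((g : ℚ) * (q' : ℚ)) := by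
    rw [ha, hb]
    push_cast
    rw [S_mul_sq_right _ _ hh, ← S_mul_sq_left ((g : ℚ) * (-2 * p')) _ hf]
    congr 1; ring
  -- The first entries of the two algebras have opposite signs.
  have hreal : ¬ (RamifiedReal g (2 * p') q' ∧ RamifiedReal g (-2 * p') q') := by
    rintro ⟨⟨h1, -⟩, ⟨h2, -⟩⟩
    have : g * (-2 * p') = -(g * (2 * p')) := by ring
    omega
  rw [R1_eq p hq, T, T, e1, e2, ← T, ← T, T_add_T_eq a1 a2 hreal]
  have val_p : ∀ l : ℕ, l.Prime → (l ∈ oddPrimes p ↔ (l : ℤ) ∣ g * p') := fun l hl => by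
    rw [oddPrimes, Set.mem_ofPred_eq, odd_padicValRat_iff hl ha has hf]
    simp [hl]
  have val_q : ∀ l : ℕ, l.Prime → (l ∈ oddPrimes q ↔ (l : ℤ) ∣ g * q') := fun l hl => by
    rw [oddPrimes, Set.mem_ofPred_eq, odd_padicValRat_iff hl hb hbs hh]
    simp [hl]
  have hset : {l | Ramified g (2 * p') q' l ∧ Ramified g (-2 * p') q' l} = primesPQ p q := by
    ext l
    by_cases hl : l.Prime
    swap
    · have n1 : l ∉ oddPrimes p := fun h => hl h.1
      have n2 : l ∉ oddPrimes q := fun h => hl h.1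
      simp [Ramified, hl, primesPQ, n1, n2]
    have hli := Nat.prime_iff_prime_int.1 hl
    by_cases hl2 : l = 2
    · subst hl2
      have n1 : 2 ∉ oddPrimes p := by rw [val_p 2 hl]; push_cast; omega
      have n2 : 2 ∉ oddPrimes q := by rw [val_q 2 hl]; push_cast; omega
      -- The first entry is `14` modulo `16` and the second is `3` modulo `8`, so this algebra
      -- splits at `2`.
      have n3 : ¬ RamifiedTwo g (-2 * p') q' := by
        have : g * (-2 * p') = -2 * (g * p') := by ring
        rw [RamifiedTwo, this]
        omega
      constructor
      · rintro ⟨-, h2⟩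
        have h3 := h2.2
        rw [if_pos rfl] at h3
        exact absurd h3 n3
      · rintro (⟨h, -⟩ | ⟨h, -⟩ | ⟨h, -⟩)
        exacts [absurd h.1 n1, absurd h.1 n2, absurd h.1 n1]
    have nd2 : ¬ (l : ℤ) ∣ 2 := fun h =>
      hl2 ((Nat.prime_dvd_prime_iff_eq hl Nat.prime_two).1 (by exact_mod_cast h))
    have nd2' : ¬ (l : ℤ) ∣ -2 := by rwa [dvd_neg]
    have nd_mul : ∀ {x y : ℤ}, ¬ (l : ℤ) ∣ x → ¬ (l : ℤ) ∣ y → ¬ (l : ℤ) ∣ x * y :=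
      fun h1 h2 h3 => (hli.dvd_or_dvd h3).elim h1 h2
    rw [Set.mem_ofPred_eq, ramified_two_mul_iff hpq (Or.inl rfl) hl hl2,
      ramified_two_mul_iff hpq (Or.inr rfl) hl hl2]
    simp only [primesPQ, Set.mem_ofPred_eq, Set.mem_sdiff, Set.mem_inter_iff, val_p l hl,
      val_q l hl, neg_neg]
    by_cases h1 : (l : ℤ) ∣ g
    · have hgp : ¬ (l : ℤ) ∣ p' := not_dvd_of_squarefree_mul has hl h1
      have hgq : ¬ (l : ℤ) ∣ q' := not_dvd_of_squarefree_mul hbs hl h1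
      have hg0 : (g : ℚ) ≠ 0 := by exact_mod_cast hg.ne'
      have hne : (g : ℚ) * f * h ≠ 0 := mul_ne_zero (mul_ne_zero hg0 hf) hh
      have g1 := genLegendre_eq_neg_one_iff hl (a := 2 * p * q) (n := 2 * (p' * q'))
        (h := g * f * h) (by rw [ha, hb]; push_cast; ring) hne (nd_mul nd2 (nd_mul hgp hgq))
      have g2 := genLegendre_eq_neg_one_iff hl (a := -2 * p * q) (n := -2 * (p' * q'))
        (h := g * f * h) (by rw [ha, hb]; push_cast; ring) hne (nd_mul nd2' (nd_mul hgp hgq))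
      simp only [h1, h1.mul_right, not_true, false_and, and_false, true_and, false_or, and_self,
        g1, g2]
      exact and_comm
    · have dgx : ∀ x : ℤ, (l : ℤ) ∣ g * x ↔ (l : ℤ) ∣ x := fun x =>
        ⟨fun h => (hli.dvd_or_dvd h).resolve_left h1, fun h => h.mul_left _⟩
      simp only [h1, dgx, false_and, or_false]
      by_cases hlp : (l : ℤ) ∣ p'
      · have hlq : ¬ (l : ℤ) ∣ q' := fun h2 => hli.not_isUnit (hpq.isUnit_of_dvd' hlp h2)
        have g1 := genLegendre_eq_neg_one_iff hl hb hh (nd_mul h1 hlq)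
        simp [hlp, hlq, g1]
      · have g1 := genLegendre_eq_neg_one_iff hl (a := 2 * p) (n := 2 * (g * p')) (h := f)
          (by rw [ha]; push_cast; ring) hf (nd_mul nd2 (nd_mul h1 hlp))
        have g2 := genLegendre_eq_neg_one_iff hl (a := -2 * p) (n := -2 * (g * p')) (h := f)
          (by rw [ha]; push_cast; ring) hf (nd_mul nd2' (nd_mul h1 hlp))
        by_cases hlq : (l : ℤ) ∣ q'
        · simp only [hlp, hlq, not_true, not_false_eq_true, true_and, false_and,
            false_or, or_false, and_self, g1, g2]
        · simp [hlp, hlq]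
  rw [hset]

/-- The prime `q` drops out because `(2p/q) = (2/q)(p/q) = (-1)(-1) = 1`; the prime `p` stays
because reciprocity gives `(q/p) = (p/q) = -1`. -/
theorem primesPQ_natCast {p q : ℕ} [hp : Fact p.Prime] [hq : Fact q.Prime] (hp1 : p ≡ 1 [MOD 8])
    (hq3 : q ≡ 3 [MOD 8]) (h : legendreSym q (p : ℤ) = -1) : primesPQ (p : ℚ) (q : ℚ) = {p} := by
  have hp8 : p % 8 = 1 := hp1
  have hq8 : q % 8 = 3 := hq3
  have hpq : p ≠ q := by rintro rfl; omega
  have hpo : Odd p := Nat.odd_iff.2 (by omega)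
  have hqo : Odd q := Nat.odd_iff.2 (by omega)
  have hJ : jacobiSym p q = -1 := by rw [← jacobiSym.legendreSym.to_jacobiSym]; exact h
  have hJ' : jacobiSym q p = -1 := by
    rw [← hJ, jacobiSym.quadratic_reciprocity_one_mod_four' hqo (by omega)]
  have nd : ∀ {a b : ℕ}, a.Prime → b.Prime → a ≠ b → ¬ (a : ℤ) ∣ b := fun ha hb hab hd =>
    hab ((Nat.prime_dvd_prime_iff_eq ha hb).1 (by exact_mod_cast hd))
  have nd2 : ¬ (q : ℤ) ∣ 2 * p := by
    intro hd
    rcases (Nat.prime_iff_prime_int.1 hq.out).dvd_or_dvd hd with hd | hd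
    · exact nd hq.out Nat.prime_two (by omega) (by exact_mod_cast hd)
    · exact nd hq.out hp.out hpq.symm hd
  ext l
  simp only [primesPQ, Set.mem_ofPred_eq, oddPrimes_natCast hp.out, oddPrimes_natCast hq.out,
    Set.mem_sdiff, Set.mem_inter_iff, Set.mem_singleton_iff]
  constructor
  · rintro (⟨⟨rfl, -⟩, -⟩ | ⟨⟨rfl, -⟩, h1, -⟩ | ⟨⟨rfl, -⟩, -⟩)
    · rfl
    · exfalso
      rw [genLegendre_eq_neg_one_iff hq.out (n := 2 * p) (h := 1) (by push_cast; ring) one_ne_zero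
        nd2, jacobiSym.mul_left, hJ, jacobiSym_two_eq hqo, if_neg (by omega)] at h1
      norm_num at h1
    · rfl
  · rintro rfl
    refine Or.inl ⟨⟨rfl, hpq⟩, ?_⟩
    rw [genLegendre_eq_neg_one_iff hp.out (n := q) (h := 1) (by push_cast; ring) one_ne_zero
      (nd hp.out hq.out hpq)]
    exact hJ'

theorem residue_three : ∀ l : ℕ, l.Prime → l ≠ 2 →
    ((jacobiSym (-1) l = -1 ∧ jacobiSym 2 l = -1) ↔ l % 8 = 3) := by
  intro l hl hl2
  have ho := hl.odd_of_ne_two hl2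
  have := Nat.odd_iff.1 ho
  rw [jacobiSym_neg_one_eq ho, jacobiSym_two_eq ho]
  split_ifs <;> simp <;> omega

theorem residue_five : ∀ l : ℕ, l.Prime → l ≠ 2 →
    ((jacobiSym (-2) l = -1 ∧ jacobiSym 2 l = -1) ↔ l % 8 = 5) := by
  intro l hl hl2
  have ho := hl.odd_of_ne_two hl2
  have := Nat.odd_iff.1 ho
  rw [jacobiSym_neg_two_eq ho, jacobiSym_two_eq ho]
  split_ifs <;> simp <;> omega

theorem residue_seven : ∀ l : ℕ, l.Prime → l ≠ 2 →
    ((jacobiSym (-1) l = -1 ∧ jacobiSym (-2) l = -1) ↔ l % 8 = 7) := by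
  intro l hl hl2
  have ho := hl.odd_of_ne_two hl2
  have := Nat.odd_iff.1 ho
  rw [jacobiSym_neg_one_eq ho, jacobiSym_neg_two_eq ho]
  split_ifs <;> simp <;> omega

end LocalRings

/-! ### Assembly of the proposition -/

theorem mainTheorem8 :
    -- part (a)
    (LocalRings.Zloc 2 = LocalRings.T 3 3 + LocalRings.T 2 5) ∧
    -- part (b), for each pair of k and the corresponding ring
    (∀ (k : ℕ) (R : ℚ → Set ℚ),
      (k = 3 ∧ R = LocalRings.R3) ∨ (k = 5 ∧ R = LocalRings.R5) ∨ (k = 7 ∧ R = LocalRings.R7) →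
      (∀ p : ℚ, p ≠ 0 →
        (LocalRings.ModEqTwo k p →
          R p = ⋂ l ∈ LocalRings.oddPrimesMod k p, LocalRings.Zloc l) ∧
        (¬ LocalRings.ModEqTwo k p →
          R p = (⋂ l ∈ LocalRings.oddPrimesMod k p, LocalRings.Zloc l) ∨
          R p = ⋂ l ∈ LocalRings.oddPrimesMod k p ∪ {2}, LocalRings.Zloc l)) ∧
      (∀ p : ℕ, p.Prime → p ≡ k [MOD 8] → LocalRings.Zloc p = R (p : ℚ))) ∧
    -- part (c)
    (∀ p q : ℚ, p ≠ 0 → q ≠ 0 → LocalRings.ModEqTwo 1 p → LocalRings.ModEqTwo 3 q →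
      ((LocalRings.primesPQ p q).Nonempty →
        LocalRings.R1 p q = ⋂ l ∈ LocalRings.primesPQ p q, LocalRings.Zloc l) ∧
      (LocalRings.primesPQ p q = ∅ → LocalRings.R1 p q = Set.univ)) ∧
    (∀ (p q : ℕ) [Fact p.Prime] [Fact q.Prime], p ≡ 1 [MOD 8] → q ≡ 3 [MOD 8] →
      legendreSym q (p : ℤ) = -1 → LocalRings.Zloc p = LocalRings.R1 (p : ℚ) (q : ℚ)) := by
  open LocalRings in
  refine ⟨Zloc_two_eq, ?_, fun p q hp hq hp1 hq3 => ⟨fun _ => R1_eq_iInter hp hq hp1 hq3,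
    fun h => by rw [R1_eq_iInter hp hq hp1 hq3, h]; simp⟩, ?_⟩
  · rintro k R (⟨rfl, rfl⟩ | ⟨rfl, rfl⟩ | ⟨rfl, rfl⟩)
    · refine ring_of_residue_class (m₁ := -1) (m₂ := 2) (s₁ := -1) (s₂ := -1) rfl (by norm_num)
        (by norm_num) (by norm_num) (by norm_num) (by norm_num) (fun p hp => R3_eq hp)
        residue_three (fun c hc => ?_) (fun c => ?_)
      -- For `c ≡ k mod 8` the first algebra always splits at `2`: for `k = 3, 7` one has `-c ≡ 1
      -- mod 4` against `-1`, and for `k = 5` one has `-c ≡ 3 mod 8` against `-2`.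
      · simp only [RamifiedTwo]; omega
      · simp only [RamifiedReal]; omega
    · refine ring_of_residue_class (m₁ := -2) (m₂ := 2) (s₁ := -1) (s₂ := -1) rfl (by norm_num)
        (by norm_num) (by norm_num) (by norm_num) (by norm_num) (fun p hp => R5_eq hp)
        residue_five (fun c hc => ?_) (fun c => ?_)
      · simp only [RamifiedTwo]; omega
      · simp only [RamifiedReal]; omega
    · refine ring_of_residue_class (m₁ := -1) (m₂ := -2) (s₁ := -1) (s₂ := 1) rfl (by norm_num)
        (by norm_num) (by norm_num) (by norm_num) (by norm_num) (fun p hp => R7_eq hp)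
        residue_seven (fun c hc => ?_) (fun c => ?_)
      · simp only [RamifiedTwo]; omega
      -- For `k = 7` the second entries are `-c` and `c`, not both negative; for `k = 3, 5` the
      -- second algebra has first entry `2 > 0`.
      · simp only [RamifiedReal]; omega
  · intro p q hp hq hp1 hq3 h
    have hp0 : (p : ℚ) ≠ 0 := by exact_mod_cast hp.out.ne_zero
    have hq0 : (q : ℚ) ≠ 0 := by exact_mod_cast hq.out.ne_zero
    rw [R1_eq_iInter hp0 hq0 (modEqTwo_natCast hp1) (modEqTwo_natCast hq3),
      primesPQ_natCast hp1 hq3 h]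
    simp
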